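/- \textbf{Setting.} Let $(\boldsymbol x,T,Y_1,Y_0)$ have law $P$ on $\mathbb R^p\times\{0,1\}\times\mathbb R\times\mathbb R$ (covariates, treatment indicator, potential outcomes), let $\mu_i=\operatorname E(Y_i)$, $\theta^0=\mu_1-\mu_0$, and let $(\boldsymbol x_j,T_j,Y_{1j},Y_{0j})$, $j=1,2,\dots$, be i.i.d. from $P$; write $\tilde{\boldsymbol x}=(1,\boldsymbol x^\top)^\top$, $\mathcal S_1=\{j\le n:T_j=1\}$, $\mathcal S_0=\{j\le n:T_j=0\}$. The working propensity score model is logistic, $\tau(\boldsymbol x;\boldsymbol\alpha)=e^{\tilde{\boldsymbol x}^\top\boldsymbol\alpha}/(1+e^{\tilde{\boldsymbol x}^\top\boldsymbol\alpha})$. The working outcome regression models are measurable functions $m_i(\boldsymbol x;\boldsymbol\beta_i)$, $\boldsymbol\beta_i\in\mathbb R^{q_i}$, $i=1,0$, with estimating functions $g_1(\boldsymbol\beta_1)=T\{Y_1-m_1(\boldsymbol x;\boldsymbol\beta_1)\}\boldsymbol a_1(\boldsymbol x;\boldsymbol\beta_1)$ and $g_0(\boldsymbol\beta_0)=(1-T)\{Y_0-m_0(\boldsymbol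 x;\boldsymbol\beta_0)\}\boldsymbol a_0(\boldsymbol x;\boldsymbol\beta_0)$, where $\boldsymbol a_i$ is a given measurable $\mathbb R^{q_i}$-valued function (e.g. $\boldsymbol a_i=\tilde{\boldsymbol x}$ for linear models). None of the models is assumed to be correct. \textbf{Estimators.} Let $\hat{\boldsymbol\alpha},\hat{\boldsymbol\beta}_1,\hat{\boldsymbol\beta}_0$ be random vectors (depending on $n$) such that, with probability tending to one, $\hat{\boldsymbol\alpha}$ maximizes the likelihood $\prod_{j\le n}\tau(\boldsymbol x_j;\boldsymbol\alpha)^{T_j}\{1-\tau(\boldsymbol x_j;\boldsymbol\alpha)\}^{1-T_j}$ and $\hat{\boldsymbol\beta}_i$ solves $\sum_{j\le n}g_{ij}(\boldsymbol\beta_i)=0$. Let $\boldsymbol\alpha^*$ solve $\operatorname E[\tilde{\boldsymbol x}\{T-\tau(\boldsymbol x;\boldsymbol\alpha^*)\}]=0$ and let $\boldsymbol\beta_i^*$ be the limit in probability of $\hat{\boldsymbol\beta}_i$. With $\hat\tau_j=\tau(\boldsymbol x_j;\hat{\boldsymbol\alpha})$, $\hat m_{ij}=m_i(\boldsymbol x_j;\hat{\boldsymbol\beta}_i)$,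 $\bar{\hat m}_i=n^{-1}\sum_{j\le n}\hat m_{ij}$ put \[\hat\mu_{1,\mathrm{AIPW1}}=\frac1n\sum_{j\in\mathcal S_1}\frac{Y_{1j}-\hat m_{1j}}{\hat\tau_j}+\bar{\hat m}_1,\qquad \hat\mu_{0,\mathrm{AIPW1}}=\frac1n\sum_{j\in\mathcal S_0}\frac{Y_{0j}-\hat m_{0j}}{1-\hat\tau_j}+\bar{\hat m}_0,\] \[\hat\mu_{1,\mathrm{AIPW2}}=\frac{\sum_{j\in\mathcal S_1}\hat\tau_j^{-1}(Y_{1j}-\hat m_{1j})}{\sum_{j\in\mathcal S_1}\hat\tau_j^{-1}}+\bar{\hat m}_1,\qquad \hat\mu_{0,\mathrm{AIPW2}}=\frac{\sum_{j\in\mathcal S_0}(1-\hat\tau_j)^{-1}(Y_{0j}-\hat m_{0j})}{\sum_{j\in\mathcal S_0}(1-\hat\tau_j)^{-1}}+\bar{\hat m}_0,\] and $\hat\theta=\hat\mu_1-\hat\mu_0$ for either type. Let $\Psi=(\mu_1,\theta,\bar m_1,\bar m_0,\boldsymbol\alpha^\top,\boldsymbol\beta_1^\top,\boldsymbol\beta_0^\top)^\top$,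 $\boldsymbol{\mathrm U}(\Psi)=n^{-1}\sum_{j\le n}\boldsymbol{\mathrm U}_j(\Psi)$ and \[\boldsymbol{\mathrm U}_j(\Psi)=\begin{pmatrix}\frac{T_j}{\tau_j}(Y_{1j}-m_{1j}+\bar m_1-\mu_1)+\Delta_1\frac{T_j-\tau_j}{\tau_j}\\ \frac{1-T_j}{1-\tau_j}\{Y_{0j}-m_{0j}+\bar m_0-(\mu_1-\theta)\}+\Delta_0\frac{\tau_j-T_j}{1-\tau_j}\\ m_{1j}-\bar m_1\\ m_{0j}-\bar m_0\\ \tilde{\boldsymbol x}_j(T_j-\tau_j)\\ g_{1j}(\boldsymbol\beta_1)\\ g_{0j}(\boldsymbol\beta_0)\end{pmatrix},\] where $\tau_j=\tau(\boldsymbol x_j;\boldsymbol\alpha)$, $m_{ij}=m_i(\boldsymbol x_j;\boldsymbol\beta_i)$, and $(\Delta_1,\Delta_0)=(\mu_1-\bar m_1,\ \mu_1-\theta-\bar m_0)$ for AIPW1, $(0,0)$ for AIPW2. Let $\hat\Psi=(\hat\mu_1,\hat\theta,\bar{\hat m}_1,\bar{\hat m}_0,\hat{\boldsymbol\alpha}^\top,\hat{\boldsymbol\beta}_1^\top,\hat{\boldsymbol\beta}_0^\top)^\top$,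 $\boldsymbol{\mathrm H}=\partial\boldsymbol{\mathrm U}/\partial\Psi$, $\boldsymbol{\mathrm H}_j=\partial\boldsymbol{\mathrm U}_j/\partial\Psi$; the sandwich variance estimator $\operatorname{var}(\hat\theta)$ is the second diagonal element of \[\{\boldsymbol{\mathrm H}(\hat\Psi)\}^{-1}\Big\{\frac1{n^2}\sum_{j=1}^n\boldsymbol{\mathrm U}_j(\hat\Psi)\boldsymbol{\mathrm U}_j^\top(\hat\Psi)\Big\}\{\boldsymbol{\mathrm H}^\top(\hat\Psi)\}^{-1}.\] Let $\Psi^*=(\mu_1^*,\theta^*,\operatorname E m_1(\boldsymbol x;\boldsymbol\beta_1^*),\operatorname E m_0(\boldsymbol x;\boldsymbol\beta_0^*),\boldsymbol\alpha^{*\top},\boldsymbol\beta_1^{*\top},\boldsymbol\beta_0^{*\top})^\top$ and $\theta^*=\mu_1^*-\mu_0^*$. With $m_i^*=m_i(\boldsymbol x;\boldsymbol\beta_i^*)$, $\tau^*=\tau(\boldsymbol x;\boldsymbol\alpha^*)$, $R_1=\operatorname E\{T(Y_1-m_1^*)/\tau^*\}$ and $R_0=\operatorname E\{(1-T)(Y_0-m_0^*)/(1-\tau^*)\}$,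 here $\mu_i^*=R_i+\operatorname E(m_i^*)$ for AIPW1, while for AIPW2 $\mu_1^*=R_1/\operatorname E(T/\tau^*)+\operatorname E(m_1^*)$ and $\mu_0^*=R_0/\operatorname E\{(1-T)/(1-\tau^*)\}+\operatorname E(m_0^*)$. \textbf{Regularity conditions.} (i) $\operatorname E(T)\in(0,1)$; (ii) $Y_1,Y_0,\|\boldsymbol x\|,m_1^*,m_0^*,\|g_1(\boldsymbol\beta_1^*)\|,\|g_0(\boldsymbol\beta_0^*)\|$ have finite second moments; (iii) for $i=1,0$, almost surely $m_i(\boldsymbol x;\cdot)$ and $g_i(\cdot)$ are continuously differentiable on a fixed ball around $\boldsymbol\beta_i^*$, with derivatives bounded there in norm by integrable random variables not depending on $\boldsymbol\beta_i$; (iv) for some constants $0<c_1\le c_2<1$, $c_1\le\tau(\boldsymbol x;\boldsymbol\alpha^*)\le c_2$ almost surely; (v) the matrices $\operatorname E(\tilde{\boldsymbol x}\tilde{\boldsymbol x}^\top)$ and $\operatorname E\{\partial g_i(\boldsymbol\beta_i^*)/\partial\boldsymbol\beta_i\}$, $i=1,0$, are nonsingular. \textbf{Corollary.} Under these conditions the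 following holds for each of $\hat\theta_{\mathrm{AIPW1}}$ and $\hat\theta_{\mathrm{AIPW2}}$, regardless of the correctness of the propensity score model or of the outcome regression models. With probability tending to one, $\boldsymbol{\mathrm U}(\hat\Psi)=\boldsymbol 0$, $\boldsymbol{\mathrm U}$ is differentiable at $\hat\Psi$ and $\boldsymbol{\mathrm H}(\hat\Psi)$ is nonsingular. The matrix $\operatorname E\{\boldsymbol{\mathrm H}_j(\Psi^*)\}$ is nonsingular, and with $V\ge0$ the second diagonal element of $[\operatorname E\{\boldsymbol{\mathrm H}_j(\Psi^*)\}]^{-1}\operatorname E\{\boldsymbol{\mathrm U}_j(\Psi^*)\boldsymbol{\mathrm U}_j^\top(\Psi^*)\}[\operatorname E\{\boldsymbol{\mathrm H}_j(\Psi^*)\}^\top]^{-1}$, \[\sqrt n\,(\hat\theta-\theta^*)\xrightarrow{d}\operatorname N(0,V)\qquad\text{and}\qquad n\,\operatorname{var}(\hat\theta)\xrightarrow{P}V .\] Moreover $\theta^*=\theta^0$ if $T$ and $(Y_1,Y_0)$ are conditionally independent given $\boldsymbol x$ and either $P(T=1\mid\boldsymbol x)=\tau(\boldsymbol x;\boldsymbol\alpha)$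 almost surely for some $\boldsymbol\alpha$, or $\operatorname E(Y_i\mid\boldsymbol x)=m_i(\boldsymbol x;\boldsymbol\beta_i^*)$ almost surely for $i=1$ and $i=0$. -/

import Mathlib

open MeasureTheory ProbabilityTheory Filter Topology Set

noncomputable section

namespace AIPW

/-! ## Population and data -/

/-- One subject: `(x, T, Y₁, Y₀)` with covariates `x ∈ ℝᵖ`, treatment indicator `T`
(`true` = treated) and the two potential outcomes. -/
abbrev Obs (p : ℕ) : Type := (Fin p → ℝ) × Bool × ℝ × ℝ

variable {p q₁ q₀ q : ℕ}

/-- The covariate vector `x`. -/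
def covar (z : Obs p) : Fin p → ℝ := z.1

/-- The treatment indicator `T`, as a real number in `{0, 1}`. -/
def trt (z : Obs p) : ℝ := if z.2.1 = true then 1 else 0

/-- The potential outcome `Y₁` under treatment. -/
def y1 (z : Obs p) : ℝ := z.2.2.1

/-- The potential outcome `Y₀` under control. -/
def y0 (z : Obs p) : ℝ := z.2.2.2

/-- The covariate vector with an intercept, `x̃ = (1, xᵀ)ᵀ`. -/
def xt (x : Fin p → ℝ) : Fin (p + 1) → ℝ := Fin.cons 1 x

/-- The sub-sample `𝒮₁` of treated subjects among the first `n`. -/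
def treated (n : ℕ) (z : ℕ → Obs p) : Finset ℕ := {j ∈ Finset.range n | (z j).2.1 = true}

/-- The sub-sample `𝒮₀` of control subjects among the first `n`. -/
def controls (n : ℕ) (z : ℕ → Obs p) : Finset ℕ := {j ∈ Finset.range n | (z j).2.1 = false}

/-! ## Working models -/

/-- The logistic propensity score model `τ(x; α) = exp(x̃ᵀα) / (1 + exp(x̃ᵀα))`. -/
def ps (x : Fin p → ℝ) (α : Fin (p + 1) → ℝ) : ℝ :=
  Real.exp (xt x ⬝ᵥ α) / (1 + Real.exp (xt x ⬝ᵥ α))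

/-- The likelihood `L(α) = ∏ⱼ τ(xⱼ; α)^{Tⱼ} (1 - τ(xⱼ; α))^{1 - Tⱼ}` of the propensity score
model for the first `n` subjects. -/
def likelihood (n : ℕ) (z : ℕ → Obs p) (α : Fin (p + 1) → ℝ) : ℝ :=
  ∏ j ∈ Finset.range n, if (z j).2.1 = true then ps (covar (z j)) α else 1 - ps (covar (z j)) α

/-- `α` is a maximum likelihood estimate from the first `n` subjects. -/
def IsMLE (n : ℕ) (z : ℕ → Obs p) (α : Fin (p + 1) → ℝ) : Prop :=
  IsMaxOn (likelihood n z) univ α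

/-- A parametric outcome regression model: the mean function `m(x; β)`, `β ∈ ℝ^q`, and the vector
`a(x; β) ∈ ℝ^q` by which the residuals are multiplied in the estimating equations for `β`.
With `a(x; β) = x̃` these are the estimating equations of a linear model or of a generalized linear
model with canonical link; with `a = ∂m/∂β` they are those of nonlinear least squares. -/
structure OutcomeModel (p q : ℕ) where
  m : (Fin p → ℝ) → (Fin q → ℝ) → ℝ
  a : (Fin p → ℝ) → (Fin q → ℝ) → (Fin q → ℝ)
  measurable_m : Measurable (Function.uncurry m)
  measurable_a : Measurable (Function.uncurry a)

/-- The linear outcome regression model `m(x; β) = x̃ᵀβ`, fitted by least squares. -/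
def OutcomeModel.linear (p : ℕ) : OutcomeModel p (p + 1) where
  m x β := xt x ⬝ᵥ β
  a x _ := xt x
  measurable_m := by
    have h : Measurable (fun x : Fin p → ℝ => xt x) :=
      measurable_pi_lambda _ fun i => by
        refine Fin.cases ?_ (fun i => ?_) i
        · simp [xt]
        · simpa [xt] using measurable_pi_apply i
    unfold Function.uncurry dotProduct
    fun_prop
  measurable_a := by
    have h : Measurable (fun x : Fin p → ℝ => xt x) :=
      measurable_pi_lambda _ fun i => by
        refine Fin.cases ?_ (fun i => ?_) i
        · simp [xt]
        · simpa [xt] using measurable_pi_apply i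
    exact h.comp measurable_fst

/-- The estimating function `T (Y₁ - m₁(x; β)) a₁(x; β)` of the outcome model for the treated. -/
def g1 (M : OutcomeModel p q) (z : Obs p) (β : Fin q → ℝ) : Fin q → ℝ :=
  (trt z * (y1 z - M.m (covar z) β)) • M.a (covar z) β

/-- The estimating function `(1 - T) (Y₀ - m₀(x; β)) a₀(x; β)` of the outcome model for the
controls. -/
def g0 (M : OutcomeModel p q) (z : Obs p) (β : Fin q → ℝ) : Fin q → ℝ :=
  ((1 - trt z) * (y0 z - M.m (covar z) β)) • M.a (covar z) β

/-! ## The two augmented IPW estimators -/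

/-- The two types of estimators: `aipw1` with weights `1/n`, `aipw2` with Hájek-type weights. -/
inductive Variant
  | aipw1
  | aipw2

/-- `m̄̂ = n⁻¹ ∑ⱼ m(xⱼ; β)`. -/
def mbarHat (n : ℕ) (z : ℕ → Obs p) (M : OutcomeModel p q) (β : Fin q → ℝ) : ℝ :=
  (n : ℝ)⁻¹ * ∑ j ∈ Finset.range n, M.m (covar (z j)) β

/-- The augmented IPW estimators of `μ₁`. -/
def mu1Hat (v : Variant) (n : ℕ) (z : ℕ → Obs p) (M : OutcomeModel p q)
    (α : Fin (p + 1) → ℝ) (β : Fin q → ℝ) : ℝ :=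
  match v with
  | .aipw1 =>
      (n : ℝ)⁻¹ * ∑ j ∈ treated n z, (y1 (z j) - M.m (covar (z j)) β) / ps (covar (z j)) α
        + mbarHat n z M β
  | .aipw2 =>
      ∑ j ∈ treated n z,
        ((ps (covar (z j)) α)⁻¹ / ∑ l ∈ treated n z, (ps (covar (z l)) α)⁻¹)
          * (y1 (z j) - M.m (covar (z j)) β)
        + mbarHat n z M β

/-- The augmented IPW estimators of `μ₀`. -/
def mu0Hat (v : Variant) (n : ℕ) (z : ℕ → Obs p) (M : OutcomeModel p q)
    (α : Fin (p + 1) → ℝ) (β : Fin q → ℝ) : ℝ :=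
  match v with
  | .aipw1 =>
      (n : ℝ)⁻¹ * ∑ j ∈ controls n z, (y0 (z j) - M.m (covar (z j)) β) / (1 - ps (covar (z j)) α)
        + mbarHat n z M β
  | .aipw2 =>
      ∑ j ∈ controls n z,
        ((1 - ps (covar (z j)) α)⁻¹ / ∑ l ∈ controls n z, (1 - ps (covar (z l)) α)⁻¹)
          * (y0 (z j) - M.m (covar (z j)) β)
        + mbarHat n z M β

/-- The augmented IPW estimators `θ̂ = μ̂₁ - μ̂₀` of the average treatment effect. -/
def thetaHat (v : Variant) (n : ℕ) (z : ℕ → Obs p) (M₁ : OutcomeModel p q₁)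
    (M₀ : OutcomeModel p q₀) (α : Fin (p + 1) → ℝ) (β₁ : Fin q₁ → ℝ) (β₀ : Fin q₀ → ℝ) : ℝ :=
  mu1Hat v n z M₁ α β₁ - mu0Hat v n z M₀ α β₀

/-! ## The stacked estimating equations -/

/-- Index set of the stacked parameter `Ψ = (μ₁, θ, m̄₁, m̄₀, α, β₁, β₀)`. -/
abbrev PIdx (p q₁ q₀ : ℕ) : Type := Fin 4 ⊕ Fin (p + 1) ⊕ Fin q₁ ⊕ Fin q₀

/-- The index of the coordinate `θ` of `Ψ`. -/
abbrev idxTheta : PIdx p q₁ q₀ := Sum.inl 1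

/-- The stacked parameter `Ψ`. -/
abbrev Param (p q₁ q₀ : ℕ) : Type := PIdx p q₁ q₀ → ℝ

/-- Assemble `Ψ` from its blocks. -/
def Param.mk (μ₁ θ mb₁ mb₀ : ℝ) (α : Fin (p + 1) → ℝ) (β₁ : Fin q₁ → ℝ) (β₀ : Fin q₀ → ℝ) :
    Param p q₁ q₀ :=
  Sum.elim ![μ₁, θ, mb₁, mb₀] (Sum.elim α (Sum.elim β₁ β₀))

/-- The coordinate `μ₁` of `Ψ`. -/
def Param.mu1 (ψ : Param p q₁ q₀) : ℝ := ψ (Sum.inl 0)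
/-- The coordinate `θ` of `Ψ`. -/
def Param.theta (ψ : Param p q₁ q₀) : ℝ := ψ idxTheta
/-- The coordinate `m̄₁` of `Ψ`. -/
def Param.mbar1 (ψ : Param p q₁ q₀) : ℝ := ψ (Sum.inl 2)
/-- The coordinate `m̄₀` of `Ψ`. -/
def Param.mbar0 (ψ : Param p q₁ q₀) : ℝ := ψ (Sum.inl 3)
/-- The block `α` of `Ψ`. -/
def Param.alpha (ψ : Param p q₁ q₀) : Fin (p + 1) → ℝ := fun k => ψ (Sum.inr (Sum.inl k))
/-- The block `β₁` of `Ψ`. -/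
def Param.beta1 (ψ : Param p q₁ q₀) : Fin q₁ → ℝ := fun k => ψ (Sum.inr (Sum.inr (Sum.inl k)))
/-- The block `β₀` of `Ψ`. -/
def Param.beta0 (ψ : Param p q₁ q₀) : Fin q₀ → ℝ := fun k => ψ (Sum.inr (Sum.inr (Sum.inr k)))

/-- `Δ₁`: equal to `μ₁ - m̄₁` for `aipw1` and to `0` for `aipw2`. -/
def Delta1 (v : Variant) (ψ : Param p q₁ q₀) : ℝ :=
  match v with
  | .aipw1 => ψ.mu1 - ψ.mbar1
  | .aipw2 => 0

/-- `Δ₀`: equal to `μ₁ - θ - m̄₀` for `aipw1` and to `0` for `aipw2`. -/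
def Delta0 (v : Variant) (ψ : Param p q₁ q₀) : ℝ :=
  match v with
  | .aipw1 => ψ.mu1 - ψ.theta - ψ.mbar0
  | .aipw2 => 0

/-- The contribution `Uⱼ(Ψ)` of one subject to the stacked estimating equations. -/
def estFun (v : Variant) (M₁ : OutcomeModel p q₁) (M₀ : OutcomeModel p q₀) (z : Obs p)
    (ψ : Param p q₁ q₀) : Param p q₁ q₀ :=
  let τ := ps (covar z) ψ.alpha
  let m₁ := M₁.m (covar z) ψ.beta1
  let m₀ := M₀.m (covar z) ψ.beta0
  Param.mk
    (trt z / τ * (y1 z - m₁ + ψ.mbar1 - ψ.mu1) + Delta1 v ψ * ((trt z - τ) / τ))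
    ((1 - trt z) / (1 - τ) * (y0 z - m₀ + ψ.mbar0 - (ψ.mu1 - ψ.theta))
      + Delta0 v ψ * ((τ - trt z) / (1 - τ)))
    (m₁ - ψ.mbar1)
    (m₀ - ψ.mbar0)
    ((trt z - τ) • xt (covar z))
    (g1 M₁ z ψ.beta1)
    (g0 M₀ z ψ.beta0)

/-- The stacked estimating function `U(Ψ) = n⁻¹ ∑ⱼ Uⱼ(Ψ)`. -/
def estEq (v : Variant) (M₁ : OutcomeModel p q₁) (M₀ : OutcomeModel p q₀) (n : ℕ)
    (z : ℕ → Obs p) (ψ : Param p q₁ q₀) : Param p q₁ q₀ :=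
  (n : ℝ)⁻¹ • ∑ j ∈ Finset.range n, estFun v M₁ M₀ (z j) ψ

/-- The Jacobian matrix `∂F/∂Ψ` at `ψ`. -/
def jacobian {ι : Type*} [Fintype ι] [DecidableEq ι] (F : (ι → ℝ) → (ι → ℝ)) (ψ : ι → ℝ) :
    Matrix ι ι ℝ :=
  Matrix.of fun k l => fderiv ℝ F ψ (Pi.single l 1) k

/-- The sandwich variance estimator
`H(Ψ)⁻¹ {n⁻² ∑ⱼ Uⱼ(Ψ) Uⱼ(Ψ)ᵀ} {H(Ψ)ᵀ}⁻¹` with `H(Ψ) = ∂U(Ψ)/∂Ψ`. -/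
def sandwich (v : Variant) (M₁ : OutcomeModel p q₁) (M₀ : OutcomeModel p q₀) (n : ℕ)
    (z : ℕ → Obs p) (ψ : Param p q₁ q₀) : Matrix (PIdx p q₁ q₀) (PIdx p q₁ q₀) ℝ :=
  (jacobian (estEq v M₁ M₀ n z) ψ)⁻¹
    * (((n : ℝ) ^ 2)⁻¹ • ∑ j ∈ Finset.range n,
        Matrix.vecMulVec (estFun v M₁ M₀ (z j) ψ) (estFun v M₁ M₀ (z j) ψ))
    * ((jacobian (estEq v M₁ M₀ n z) ψ).transpose)⁻¹

/-- The stacked estimator `Ψ̂ = (μ̂₁, θ̂, m̄̂₁, m̄̂₀, α̂, β̂₁, β̂₀)` built from `α̂, β̂₁, β̂₀`. -/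
def psiHat (v : Variant) (M₁ : OutcomeModel p q₁) (M₀ : OutcomeModel p q₀) (n : ℕ)
    (z : ℕ → Obs p) (α : Fin (p + 1) → ℝ) (β₁ : Fin q₁ → ℝ) (β₀ : Fin q₀ → ℝ) :
    Param p q₁ q₀ :=
  Param.mk (mu1Hat v n z M₁ α β₁) (thetaHat v n z M₁ M₀ α β₁ β₀)
    (mbarHat n z M₁ β₁) (mbarHat n z M₀ β₀) α β₁ β₀

/-! ## Population counterparts -/

/-- The limit `μ₁*` of `μ̂₁`. -/
def mu1Star (v : Variant) (P : Measure (Obs p)) (M : OutcomeModel p q)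
    (α : Fin (p + 1) → ℝ) (β : Fin q → ℝ) : ℝ :=
  match v with
  | .aipw1 =>
      (∫ z, trt z * (y1 z - M.m (covar z) β) / ps (covar z) α ∂P) + ∫ z, M.m (covar z) β ∂P
  | .aipw2 =>
      (∫ z, trt z * (y1 z - M.m (covar z) β) / ps (covar z) α ∂P)
          / (∫ z, trt z / ps (covar z) α ∂P)
        + ∫ z, M.m (covar z) β ∂P

/-- The limit `μ₀*` of `μ̂₀`. -/
def mu0Star (v : Variant) (P : Measure (Obs p)) (M : OutcomeModel p q)
    (α : Fin (p + 1) → ℝ) (β : Fin q → ℝ) : ℝ :=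
  match v with
  | .aipw1 =>
      (∫ z, (1 - trt z) * (y0 z - M.m (covar z) β) / (1 - ps (covar z) α) ∂P)
        + ∫ z, M.m (covar z) β ∂P
  | .aipw2 =>
      (∫ z, (1 - trt z) * (y0 z - M.m (covar z) β) / (1 - ps (covar z) α) ∂P)
          / (∫ z, (1 - trt z) / (1 - ps (covar z) α) ∂P)
        + ∫ z, M.m (covar z) β ∂P

/-- The limit `θ* = μ₁* - μ₀*` of `θ̂`. -/
def thetaStar (v : Variant) (P : Measure (Obs p)) (M₁ : OutcomeModel p q₁)
    (M₀ : OutcomeModel p q₀) (α : Fin (p + 1) → ℝ) (β₁ : Fin q₁ → ℝ) (β₀ : Fin q₀ → ℝ) : ℝ :=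
  mu1Star v P M₁ α β₁ - mu0Star v P M₀ α β₀

/-- The limit `Ψ*` of `Ψ̂`. -/
def psiStar (v : Variant) (P : Measure (Obs p)) (M₁ : OutcomeModel p q₁)
    (M₀ : OutcomeModel p q₀) (α : Fin (p + 1) → ℝ) (β₁ : Fin q₁ → ℝ) (β₀ : Fin q₀ → ℝ) :
    Param p q₁ q₀ :=
  Param.mk (mu1Star v P M₁ α β₁) (thetaStar v P M₁ M₀ α β₁ β₀)
    (∫ z, M₁.m (covar z) β₁ ∂P) (∫ z, M₀.m (covar z) β₀ ∂P) α β₁ β₀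

/-- `E{H(Ψ)}`, with `H` the Jacobian of the estimating function. -/
def popJacobian (v : Variant) (P : Measure (Obs p)) (M₁ : OutcomeModel p q₁)
    (M₀ : OutcomeModel p q₀) (ψ : Param p q₁ q₀) : Matrix (PIdx p q₁ q₀) (PIdx p q₁ q₀) ℝ :=
  Matrix.of fun k l => ∫ z, jacobian (estFun v M₁ M₀ z) ψ k l ∂P

/-- `E{Uⱼ(Ψ) Uⱼ(Ψ)ᵀ}`. -/
def popOuter (v : Variant) (P : Measure (Obs p)) (M₁ : OutcomeModel p q₁)
    (M₀ : OutcomeModel p q₀) (ψ : Param p q₁ q₀) : Matrix (PIdx p q₁ q₀) (PIdx p q₁ q₀) ℝ :=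
  Matrix.of fun k l => ∫ z, estFun v M₁ M₀ z ψ k * estFun v M₁ M₀ z ψ l ∂P

/-- The asymptotic variance matrix (of `√n (Ψ̂ - Ψ*)`) in sandwich form,
`[E{H(Ψ)}]⁻¹ E{Uⱼ(Ψ) Uⱼ(Ψ)ᵀ} [E{H(Ψ)}ᵀ]⁻¹`. -/
def popSandwich (v : Variant) (P : Measure (Obs p)) (M₁ : OutcomeModel p q₁)
    (M₀ : OutcomeModel p q₀) (ψ : Param p q₁ q₀) : Matrix (PIdx p q₁ q₀) (PIdx p q₁ q₀) ℝ :=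
  (popJacobian v P M₁ M₀ ψ)⁻¹ * popOuter v P M₁ M₀ ψ
    * ((popJacobian v P M₁ M₀ ψ).transpose)⁻¹

/-! ## Regularity conditions -/

/-- `F(z, ·)` is continuously differentiable on a common ball around `β` with derivative dominated
there by an integrable function of `z`. -/
def DominatedC1 {E G : Type*} [NormedAddCommGroup E] [NormedSpace ℝ E]
    [NormedAddCommGroup G] [NormedSpace ℝ G]
    (P : Measure (Obs p)) (F : Obs p → E → G) (β : E) : Prop :=
  ∃ r : ℝ, 0 < r ∧ ∃ h : Obs p → ℝ, Integrable h P ∧ ∀ᵐ z ∂P,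
    ContDiffOn ℝ 1 (F z) (Metric.ball β r) ∧ ∀ b ∈ Metric.ball β r, ‖fderiv ℝ (F z) b‖ ≤ h z

/-- The regularity conditions, at the limits `α`, `β₁`, `β₀` of `α̂`, `β̂₁`, `β̂₀`. None of them says
that a working model is correct. -/
structure Regular (P : Measure (Obs p)) (M₁ : OutcomeModel p q₁) (M₀ : OutcomeModel p q₀)
    (α : Fin (p + 1) → ℝ) (β₁ : Fin q₁ → ℝ) (β₀ : Fin q₀ → ℝ) : Prop where
  /-- `E(T) ∈ (0, 1)`. -/
  treat_prob : (∫ z, trt z ∂P) ∈ Ioo (0 : ℝ) 1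
  /-- `E(Y₁²) < ∞`, `E(Y₀²) < ∞`, `E(‖x‖²) < ∞`. -/
  y1_sq : MemLp (y1 : Obs p → ℝ) 2 P
  y0_sq : MemLp (y0 : Obs p → ℝ) 2 P
  covar_sq : MemLp (covar : Obs p → Fin p → ℝ) 2 P
  /-- `E{m₁(x; β₁)²} < ∞` and `E{m₀(x; β₀)²} < ∞`. -/
  m1_sq : MemLp (fun z => M₁.m (covar z) β₁) 2 P
  m0_sq : MemLp (fun z => M₀.m (covar z) β₀) 2 P
  /-- The mean functions are smooth in the parameter with dominated derivatives. -/
  m1_smooth : DominatedC1 P (fun z => M₁.m (covar z)) β₁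
  m0_smooth : DominatedC1 P (fun z => M₀.m (covar z)) β₀
  /-- The same for the estimating functions of the outcome regression models. -/
  g1_smooth : DominatedC1 P (g1 M₁) β₁
  g0_smooth : DominatedC1 P (g0 M₀) β₀
  /-- The estimating functions have finite second moments at the limit. -/
  g1_sq : MemLp (fun z => g1 M₁ z β₁) 2 P
  g0_sq : MemLp (fun z => g0 M₀ z β₀) 2 P
  /-- The (limiting) working propensity scores are bounded away from `0` and `1`. -/
  overlap : ∃ c₁ c₂ : ℝ, 0 < c₁ ∧ c₂ < 1 ∧
    ∀ᵐ z ∂P, c₁ ≤ ps (covar z) α ∧ ps (covar z) α ≤ c₂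
  /-- The expected derivatives of the estimating functions of the three models are nonsingular;
  for the logistic model this means that `E(x̃ x̃ᵀ)` is. -/
  nonsing_x : IsUnit (Matrix.det (Matrix.of fun k l : Fin (p + 1) =>
    ∫ z, xt (covar z) k * xt (covar z) l ∂P))
  nonsing_1 : IsUnit (Matrix.det (Matrix.of fun k l => ∫ z, jacobian (g1 M₁ z) β₁ k l ∂P))
  nonsing_0 : IsUnit (Matrix.det (Matrix.of fun k l => ∫ z, jacobian (g0 M₀ z) β₀ k l ∂P))

/-- `α` solves the population score equation `E[x̃ {T - τ(x; α)}] = 0` of the logistic working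
model, whether or not that model is correct. -/
def IsPopScoreRoot (P : Measure (Obs p)) (α : Fin (p + 1) → ℝ) : Prop :=
  ∀ k, ∫ z, xt (covar z) k * (trt z - ps (covar z) α) ∂P = 0

/-- The sub-σ-algebra generated by the covariates. -/
abbrev covarSigma (p : ℕ) : MeasurableSpace (Obs p) := MeasurableSpace.comap covar inferInstance

lemma covarSigma_le (p : ℕ) :
    covarSigma p ≤ (inferInstance : MeasurableSpace (Obs p)) :=
  Measurable.comap_le (measurable_fst : Measurable (Prod.fst : Obs p → _))

/-- Strong ignorability: `T` and `(Y₁, Y₀)` are independent given `x`. -/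
def SITA (P : Measure (Obs p)) [IsFiniteMeasure P] : Prop :=
  CondIndepFun (covarSigma p) (covarSigma_le p) trt (fun z => (y1 z, y0 z)) P

/-- The propensity score model is correct: `P(T = 1 ∣ x) = τ(x; α)` for some `α`. -/
def PSCorrect (P : Measure (Obs p)) : Prop :=
  ∃ α : Fin (p + 1) → ℝ, P[trt | covarSigma p] =ᵐ[P] fun z => ps (covar z) α

/-- The outcome regression models are correct, `β₁` and `β₀` being the true parameters:
`E(Y₁ ∣ x) = m₁(x; β₁)` and `E(Y₀ ∣ x) = m₀(x; β₀)`. -/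
def ORCorrect (P : Measure (Obs p)) (M₁ : OutcomeModel p q₁) (M₀ : OutcomeModel p q₀)
    (β₁ : Fin q₁ → ℝ) (β₀ : Fin q₀ → ℝ) : Prop :=
  P[y1 | covarSigma p] =ᵐ[P] (fun z => M₁.m (covar z) β₁) ∧
    P[y0 | covarSigma p] =ᵐ[P] (fun z => M₀.m (covar z) β₀)

end AIPW

end

/-! The theorem is a Z-estimation argument. The stacked estimator solves `U(Ψ̂) = 0`
(`smean_estFun_psiHat`), the mean of `U_j(Ψ*)` is zero (`integral_estFun_psiStar`), and a first
order expansion at `Ψ*` gives `√n (Ψ̂ - Ψ*) = -(E H)⁻¹ √n U(Ψ*) + o_P(1)` (`tendsto_linearization`).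
The central limit theorem for the i.i.d. influence function yields normality, and its second moment
is the sandwich entry `V` (`popSandwich_eq_integral_sq`). Consistency of the variance estimator
follows from that of the empirical Jacobian and of the empirical second moments
(`tendsto_jacobian_estEq`, `tendsto_smean_outer`).

The difficulty is that overlap holds at `α*` only and `x` may be unbounded, so the inverse weights
need not be bounded for all `x` on any fixed neighbourhood of `α*`. What saves the argument is that
`‖x‖` is square integrable: the largest `‖x_j‖` among `n` subjects is `o_P(√n)`
(`IsSample.mul_max_le`). If `α̂` is root-`n` consistent, then `‖α̂ - α*‖ maxⱼ ‖x_j‖` tends to zero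
and all linear predictors of the sample move uniformly little. `SmoothMean` encodes this by
neighbourhoods `‖b' - b‖ s(z) ≤ δ` whose size depends on the observation, and `Localized` says that
the estimator lies in all of them.

The rate must therefore come before the expansion. For `α̂`, whose consistency is not assumed, it
comes from monotonicity of the logistic score (`IsMLE.norm_sub_le`, `op_sqrt_mle`). For `β̂_i`,
which are consistent by assumption, it comes from the usual argument with constant weight
(`DominatedC1.op_sqrt_root`), which also shows that `β_i*` solve the population equations. The
remaining coordinates inherit it from the triangular form of the system (`op_sqrt_stacked`). The
same triangular form makes the expected Jacobian nonsingular (`isUnit_det_popJacobian`).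

The derivatives are dominated by integrable functions only. This suffices even for second moments,
because `n⁻² ∑ h(Z_j)² → 0` in probability for integrable `h` (`IsSample.tendsto_smean_sq_div`).

Double robustness (`thetaStar_eq`) is a statement about the population: ignorability replaces `T` by
`E(T ∣ x)` inside the integrals. A correct propensity score then cancels the weights, and a correct
regression gives the weighted residuals mean zero. -/

namespace AIPW

/-! ### Convergence and boundedness in probability through a filter of likely events. -/

section InProbability

variable {Ω : Type*} [MeasurableSpace Ω]

/-- The filter on `ℕ × Ω` whose members are the events of probability tending to one. Convergence
in probability to a constant is convergence along this filter. -/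
def inProb (μ : Measure Ω) : Filter (ℕ × Ω) where
  sets := {S | Tendsto (fun n => μ {ω | (n, ω) ∉ S}) atTop (𝓝 0)}
  univ_sets := by simp
  sets_of_superset {S T} hS hST := by
    refine tendsto_of_tendsto_of_tendsto_of_le_of_le tendsto_const_nhds hS (fun _ => zero_le)
      fun n => measure_mono fun ω hω h => hω (hST h)
  inter_sets {S T} hS hT := by
    have h := Tendsto.add hS hT
    rw [add_zero] at h
    refine tendsto_of_tendsto_of_tendsto_of_le_of_le tendsto_const_nhds h (fun _ => zero_le)
      fun n => (measure_mono fun ω hω => ?_).trans (measure_union_le _ _)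
    by_contra hc
    simp only [mem_union, mem_ofPred_eq, not_or, not_not] at hc
    exact hω hc

variable {μ : Measure Ω}

lemma eventually_inProb {E : ℕ × Ω → Prop} :
    (∀ᶠ q in inProb μ, E q) ↔ Tendsto (fun n => μ {ω | ¬ E (n, ω)}) atTop (𝓝 0) := Iff.rfl

/-- Continuous mapping, squeezing and intersecting finitely many likely events become ordinary
filter calculus, with no measurability conditions on the random variables. -/
lemma tendsto_inProb_iff {E : Type*} [PseudoMetricSpace E] {X : ℕ × Ω → E} {c : E} :
    Tendsto X (inProb μ) (𝓝 c) ↔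
      TendstoInMeasure μ (fun n ω => X (n, ω)) atTop (fun _ => c) := by
  rw [tendstoInMeasure_iff_dist, Metric.tendsto_nhds]
  refine forall₂_congr fun ε _ => ?_
  rw [eventually_inProb]
  simp only [not_lt]

lemma tendsto_fst_inProb : Tendsto Prod.fst (inProb μ) atTop := by
  refine tendsto_atTop.2 fun N => ?_
  rw [eventually_inProb]
  refine tendsto_const_nhds.congr' ?_
  filter_upwards [eventually_ge_atTop N] with n hn
  simp [hn]

lemma eventually_inProb_of_ae {E : ℕ × Ω → Prop} (h : ∀ᵐ ω ∂μ, ∀ n, E (n, ω)) :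
    ∀ᶠ q in inProb μ, E q := by
  rw [eventually_inProb]
  refine tendsto_const_nhds.congr fun n => ?_
  refine (measure_mono_null (fun ω hω => ?_) (ae_iff.1 h)).symm
  exact fun hc => hω (hc n)

/-- Boundedness in probability: the product with anything that tends to zero in probability tends
to zero in probability. -/
def OP (μ : Measure Ω) (X : ℕ × Ω → ℝ) : Prop :=
  ∀ Y : ℕ × Ω → ℝ, Tendsto Y (inProb μ) (𝓝 0) → Tendsto (fun q => X q * Y q) (inProb μ) (𝓝 0)

lemma OP.mono {X X' : ℕ × Ω → ℝ} (h : OP μ X') (hle : ∀ᶠ q in inProb μ, |X q| ≤ |X' q|) :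
    OP μ X := by
  intro Y hY
  have := (h Y hY).abs
  rw [abs_zero] at this
  refine squeeze_zero_norm' ?_ this
  filter_upwards [hle] with q hq
  rw [Real.norm_eq_abs, abs_mul, abs_mul]
  gcongr

lemma OP.add {X X' : ℕ × Ω → ℝ} (h : OP μ X) (h' : OP μ X') : OP μ (fun q => X q + X' q) := by
  intro Y hY
  simpa [add_mul] using (h Y hY).add (h' Y hY)

lemma OP.mul {X X' : ℕ × Ω → ℝ} (h : OP μ X) (h' : OP μ X') : OP μ (fun q => X q * X' q) := by
  intro Y hY
  simpa [mul_assoc] using h _ (h' Y hY)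

lemma OP.abs {X : ℕ × Ω → ℝ} (h : OP μ X) : OP μ (fun q => |X q|) :=
  h.mono (Eventually.of_forall fun q => by simp)

lemma OP.of_tendsto {X : ℕ × Ω → ℝ} {c : ℝ} (h : Tendsto X (inProb μ) (𝓝 c)) : OP μ X := by
  intro Y hY
  simpa using h.mul hY

lemma OP.const (c : ℝ) : OP μ (fun _ => c) := OP.of_tendsto tendsto_const_nhds

lemma OP.sum {κ : Type*} (s : Finset κ) {X : κ → ℕ × Ω → ℝ} (h : ∀ k ∈ s, OP μ (X k)) :
    OP μ (fun q => ∑ k ∈ s, X k q) := by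
  classical
  induction s using Finset.induction_on with
  | empty => simpa using OP.const (μ := μ) 0
  | insert a s ha ih =>
    simp only [Finset.sum_insert ha]
    exact (h a (by simp)).add (ih fun k hk => h k (by simp [hk]))

/-- A sequence of random variables with bounded second moments is bounded in probability. -/
lemma OP.of_sq_bound [IsFiniteMeasure μ] {X : ℕ × Ω → ℝ} {K : ℝ}
    (hX : ∀ n, MemLp (fun ω => X (n, ω)) 2 μ) (hK : ∀ n, ∫ ω, X (n, ω) ^ 2 ∂μ ≤ K) : OP μ X := by
  have hK0 : 0 ≤ K := (integral_nonneg fun ω => sq_nonneg _).trans (hK 0)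
  intro Y hY
  rw [Metric.tendsto_nhds] at hY ⊢
  intro ε hε
  rw [eventually_inProb, ENNReal.tendsto_nhds_zero]
  intro η hη
  -- One `δ` pays for `X` being large, the other for `Y` not being small.
  obtain ⟨δ, hδ, hδη⟩ : ∃ δ : ℝ, 0 < δ ∧ ENNReal.ofReal δ + ENNReal.ofReal δ ≤ η := by
    rcases eq_or_ne η ⊤ with rfl | htop
    · exact ⟨1, one_pos, le_top⟩
    · refine ⟨η.toReal / 2, by have := ENNReal.toReal_pos hη.ne' htop; positivity, ?_⟩
      rw [← ENNReal.ofReal_add (by positivity) (by positivity), add_halves,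
        ENNReal.ofReal_toReal htop]
  -- Threshold for Markov's inequality applied to `X²`. The summand `1` keeps `C` positive when `K =
  -- 0`.
  obtain ⟨C, hC, hCK⟩ : ∃ C : ℝ, 0 < C ∧ K / C ^ 2 ≤ δ := by
    refine ⟨√((K + 1) / δ), by positivity, ?_⟩
    rw [Real.sq_sqrt (by positivity), div_div_eq_mul_div, div_le_iff₀ (by positivity)]
    nlinarith
  have h2 := hY (ε / C) (by positivity)
  rw [eventually_inProb, ENNReal.tendsto_nhds_zero] at h2
  filter_upwards [h2 _ (ENNReal.ofReal_pos.2 hδ)] with n hn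
  refine le_trans (measure_mono fun ω hω => ?_) (((measure_union_le {ω | C ^ 2 ≤ X (n, ω) ^ 2}
    {ω | ¬ dist (Y (n, ω)) 0 < ε / C}).trans (add_le_add ?_ hn)).trans hδη)
  · by_contra hc
    simp only [mem_union, mem_ofPred_eq, not_or, not_le, not_not, Real.dist_0_eq_abs] at hc hω
    apply hω
    rw [abs_mul]
    have h3 : |X (n, ω)| < C := abs_lt_of_sq_lt_sq hc.1 hC.le
    calc _ ≤ C * |Y (n, ω)| := by gcongr
      _ < C * (ε / C) := by gcongr; exact hc.2
      _ = ε := by field_simp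
  · have h4 := mul_meas_ge_le_integral_of_nonneg (Eventually.of_forall fun ω => sq_nonneg _)
      (hX n).integrable_sq (C ^ 2)
    rw [← ENNReal.ofReal_toReal (measure_ne_top μ _)]
    refine ENNReal.ofReal_le_ofReal (le_trans ?_ hCK)
    rw [le_div_iff₀ (by positivity), mul_comm]
    exact h4.trans (hK n)

end InProbability

/-! ### Algebra of sample means. -/

section SampleMean

variable {Ω 𝓩 : Type*}

/-- The sample mean of `f` over the first `q.1` observations at the sample point `q.2`. -/
noncomputable def smean (Z : ℕ → Ω → 𝓩) (q : ℕ × Ω) (f : 𝓩 → ℝ) : ℝ :=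
  (q.1 : ℝ)⁻¹ * ∑ j ∈ Finset.range q.1, f (Z j q.2)

variable {Z : ℕ → Ω → 𝓩} {q : ℕ × Ω}

lemma smean_add (f g : 𝓩 → ℝ) :
    smean Z q (fun z => f z + g z) = smean Z q f + smean Z q g := by
  simp [smean, Finset.sum_add_distrib, mul_add]

lemma smean_sub (f g : 𝓩 → ℝ) :
    smean Z q (fun z => f z - g z) = smean Z q f - smean Z q g := by
  simp [smean, Finset.sum_sub_distrib, mul_sub]

lemma smean_const_mul (c : ℝ) (f : 𝓩 → ℝ) :
    smean Z q (fun z => c * f z) = c * smean Z q f := by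
  simp only [smean, ← Finset.mul_sum]; ring

lemma smean_mul_const (c : ℝ) (f : 𝓩 → ℝ) :
    smean Z q (fun z => f z * c) = smean Z q f * c := by
  simp only [smean, ← Finset.sum_mul]; ring

lemma smean_sum {κ : Type*} (s : Finset κ) (f : κ → 𝓩 → ℝ) :
    smean Z q (fun z => ∑ k ∈ s, f k z) = ∑ k ∈ s, smean Z q (f k) := by
  simp only [smean]; rw [Finset.sum_comm, Finset.mul_sum]

lemma smean_mono {f g : 𝓩 → ℝ} (h : ∀ j < q.1, f (Z j q.2) ≤ g (Z j q.2)) :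
    smean Z q f ≤ smean Z q g := by
  simp only [smean]; gcongr with j hj
  exact h j (Finset.mem_range.1 hj)

lemma abs_smean_le {f g : 𝓩 → ℝ} (h : ∀ j < q.1, |f (Z j q.2)| ≤ g (Z j q.2)) :
    |smean Z q f| ≤ smean Z q g := by
  refine le_trans ?_ (smean_mono (f := fun z => |f z|) h)
  simp only [smean, abs_mul, abs_inv, Nat.abs_cast]
  gcongr
  exact Finset.abs_sum_le_sum_abs _ _

lemma smean_const (c : ℝ) (hq : q.1 ≠ 0) : smean Z q (fun _ => c) = c := by
  simp [smean, hq]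

lemma smean_nonneg {f : 𝓩 → ℝ} (h : ∀ j < q.1, 0 ≤ f (Z j q.2)) : 0 ≤ smean Z q f := by
  refine mul_nonneg (by positivity) (Finset.sum_nonneg fun j hj => h j (Finset.mem_range.1 hj))

/-- Cauchy–Schwarz inequality for sample means. -/
lemma smean_mul_sq_le (f g : 𝓩 → ℝ) :
    smean Z q (fun z => f z * g z) ^ 2
      ≤ smean Z q (fun z => f z ^ 2) * smean Z q (fun z => g z ^ 2) := by
  simp only [smean]
  have := Finset.sum_mul_sq_le_sq_mul_sq (Finset.range q.1) (fun j => f (Z j q.2))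
    (fun j => g (Z j q.2))
  calc _ = ((q.1 : ℝ)⁻¹) ^ 2 * (∑ j ∈ Finset.range q.1, f (Z j q.2) * g (Z j q.2)) ^ 2 := by ring
    _ ≤ ((q.1 : ℝ)⁻¹) ^ 2 * ((∑ j ∈ Finset.range q.1, f (Z j q.2) ^ 2)
        * ∑ j ∈ Finset.range q.1, g (Z j q.2) ^ 2) := by gcongr
    _ = _ := by ring

end SampleMean

/-! ### Laws of large numbers and maxima for i.i.d. samples. -/

section Sample

variable {Ω 𝓩 : Type*} [MeasurableSpace Ω] [MeasurableSpace 𝓩]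

/-- `Z₀, Z₁, …` is an i.i.d. sample from `P`. -/
structure IsSample (P : Measure 𝓩) (μ : Measure Ω) (Z : ℕ → Ω → 𝓩) : Prop where
  meas : ∀ j, Measurable (Z j)
  indep : iIndepFun Z μ
  law : ∀ j, μ.map (Z j) = P

variable {Z : ℕ → Ω → 𝓩} {P : Measure 𝓩} {μ : Measure Ω}

lemma IsSample.ae (h : IsSample P μ Z) {p : 𝓩 → Prop} (hp : ∀ᵐ z ∂P, p z) :
    ∀ᵐ ω ∂μ, ∀ j, p (Z j ω) := by
  refine ae_all_iff.2 fun j => ?_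
  rw [← h.law j] at hp
  exact ae_of_ae_map (h.meas j).aemeasurable hp

lemma IsSample.eventually (h : IsSample P μ Z) {p : 𝓩 → Prop} (hp : ∀ᵐ z ∂P, p z) :
    ∀ᶠ q in inProb μ, ∀ j, p (Z j q.2) :=
  eventually_inProb_of_ae ((h.ae hp).mono fun _ hω _ => hω)

lemma IsSample.measurePreserving (h : IsSample P μ Z) (j : ℕ) : MeasurePreserving (Z j) μ P :=
  ⟨h.meas j, h.law j⟩

/-- Independence passes through measurable maps, so `f` is first replaced by a measurable version,
which almost surely agrees with `f` at every `Z j`. -/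
lemma IsSample.indepFun_comp (h : IsSample P μ Z) {f : 𝓩 → ℝ} (hf : AEMeasurable f P) :
    iIndepFun (fun j ω => f (Z j ω)) μ := by
  have h1 : iIndepFun (fun j ω => hf.mk f (Z j ω)) μ :=
    h.indep.comp (fun _ => hf.mk f) fun _ => hf.measurable_mk
  refine h1.congr fun j => ?_
  filter_upwards [h.ae hf.ae_eq_mk] with ω hω using (hω j).symm

lemma IsSample.identDistrib_comp (h : IsSample P μ Z) {f : 𝓩 → ℝ} (hf : AEMeasurable f P)
    (j : ℕ) : IdentDistrib (fun ω => f (Z j ω)) (fun ω => f (Z 0 ω)) μ μ := by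
  have h0 : IdentDistrib (Z j) (Z 0) μ μ :=
    ⟨(h.meas j).aemeasurable, (h.meas 0).aemeasurable, by rw [h.law, h.law]⟩
  refine h0.comp_of_aemeasurable (u := f) ?_
  rwa [h.law]

lemma IsSample.memLp_comp (h : IsSample P μ Z) {f : 𝓩 → ℝ} {r : ENNReal} (hf : MemLp f r P)
    (j : ℕ) : MemLp (fun ω => f (Z j ω)) r μ :=
  hf.comp_measurePreserving (h.measurePreserving j)

lemma IsSample.integral_comp (h : IsSample P μ Z) {f : 𝓩 → ℝ} (hf : AEStronglyMeasurable f P)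
    (j : ℕ) : ∫ ω, f (Z j ω) ∂μ = ∫ z, f z ∂P := by
  rw [← h.law j, integral_map (h.meas j).aemeasurable (by rwa [h.law])]

/-- The weak law of large numbers. -/
lemma IsSample.tendsto_smean [IsProbabilityMeasure μ] (h : IsSample P μ Z) {f : 𝓩 → ℝ}
    (hf : Integrable f P) :
    Tendsto (fun q => smean Z q f) (inProb μ) (𝓝 (∫ z, f z ∂P)) := by
  rw [tendsto_inProb_iff]
  have hint (j : ℕ) : Integrable (fun ω => f (Z j ω)) μ :=
    memLp_one_iff_integrable.1 (h.memLp_comp (memLp_one_iff_integrable.2 hf) j)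
  refine tendstoInMeasure_of_tendsto_ae (fun n => ?_) ?_
  · simp only [smean]
    exact ((integrable_finsetSum _ fun j _ => hint j).aestronglyMeasurable).const_mul _
  · have := strong_law_ae_real (fun j ω => f (Z j ω)) (hint 0)
      (fun i j hij => (h.indepFun_comp hf.aemeasurable).indepFun hij)
      (h.identDistrib_comp hf.aemeasurable)
    rw [h.integral_comp hf.aestronglyMeasurable 0] at this
    filter_upwards [this] with ω hω
    refine hω.congr fun n => ?_
    simp [smean, div_eq_inv_mul]

/-- Centred sample means of square integrable functions are of order `n^{-1/2}`. -/
lemma IsSample.op_sqrt_smean [IsProbabilityMeasure μ] (h : IsSample P μ Z) {f : 𝓩 → ℝ}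
    (hf : MemLp f 2 P) (h0 : ∫ z, f z ∂P = 0) :
    OP μ (fun q => √(q.1 : ℝ) * smean Z q f) := by
  have hLp (j : ℕ) := h.memLp_comp hf j
  -- The summands are uncorrelated and centred, so the variance of the sum is `n` times a constant.
  -- This gives a second moment bound that is uniform in `n`.
  have hvar (n : ℕ) : ∫ ω, (∑ j ∈ Finset.range n, f (Z j ω)) ^ 2 ∂μ
      = n * ∫ ω, f (Z 0 ω) ^ 2 ∂μ := by
    have h1 := IndepFun.variance_sum (μ := μ) (X := fun j ω => f (Z j ω)) (s := Finset.range n)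
      (fun j _ => hLp j) (fun i _ j _ hij =>
        (h.indepFun_comp hf.aestronglyMeasurable.aemeasurable).indepFun hij)
    have hv (j : ℕ) : variance (fun ω => f (Z j ω)) μ = ∫ ω, f (Z 0 ω) ^ 2 ∂μ := by
      rw [(h.identDistrib_comp hf.aestronglyMeasurable.aemeasurable j).variance_eq,
        variance_of_integral_eq_zero (hLp 0).aestronglyMeasurable.aemeasurable
          (by rw [h.integral_comp hf.aestronglyMeasurable, h0])]
    rw [variance_of_integral_eq_zero] at h1
    · simpa [hv] using h1
    · exact (memLp_finsetSum' _ fun j _ => hLp j).aestronglyMeasurable.aemeasurable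
    · simp only [Finset.sum_apply]
      rw [integral_finsetSum _ fun j _ => (hLp j).integrable (by simp)]
      simp [h.integral_comp hf.aestronglyMeasurable, h0]
  refine OP.of_sq_bound (K := ∫ ω, f (Z 0 ω) ^ 2 ∂μ) (fun n => ?_) fun n => ?_
  · simp only [smean]
    exact ((memLp_finsetSum _ fun j _ => hLp j).const_mul _).const_mul _
  · simp only [smean]
    have e (ω : Ω) : (√(n : ℝ) * ((n : ℝ)⁻¹ * ∑ j ∈ Finset.range n, f (Z j ω))) ^ 2
        = (n : ℝ)⁻¹ * (∑ j ∈ Finset.range n, f (Z j ω)) ^ 2 := by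
      rw [mul_pow, Real.sq_sqrt (by positivity)]
      rcases eq_or_ne (n : ℝ) 0 with hn | hn
      · simp [hn]
      · field_simp
    simp_rw [e]
    rw [integral_const_mul, hvar]
    rcases eq_or_ne (n : ℝ) 0 with hn | hn
    · rw [hn]; simp; positivity
    · rw [← mul_assoc, inv_mul_cancel₀ hn, one_mul]

/-- The largest of `n` values of an integrable function is of smaller order than `n`. -/
lemma IsSample.max_le_eps_mul [IsProbabilityMeasure μ] (h : IsSample P μ Z) {f : 𝓩 → ℝ}
    (hf : Integrable f P) {ε : ℝ} (hε : 0 < ε) :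
    ∀ᶠ q in inProb μ, ∀ j < q.1, f (Z j q.2) ≤ ε * q.1 := by
  -- Truncation: each value is at most `K` plus the sum of all excesses over `K`. With `K` fixed so
  -- that the mean excess is below `ε / 2`, that sum is eventually at most `ε n / 2`, and `K ≤ ε n /
  -- 2` for large `n`.
  have hlim : Tendsto (fun K : ℕ => ∫ z, max (f z - K) 0 ∂P) atTop (𝓝 0) := by
    have := tendsto_integral_of_dominated_convergence (μ := P) (fun z => |f z|)
      (F := fun (K : ℕ) z => max (f z - K) 0) (f := fun _ => (0 : ℝ))
      (fun K => by
        have := hf.aestronglyMeasurable.aemeasurable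
        exact ((this.sub_const _).max aemeasurable_const).aestronglyMeasurable) hf.abs
      (fun K => Eventually.of_forall fun z => by
        rw [Real.norm_eq_abs, abs_of_nonneg (le_max_right _ _)]
        refine max_le ?_ (abs_nonneg _)
        have := le_abs_self (f z)
        have : (0 : ℝ) ≤ K := by positivity
        linarith)
      (Eventually.of_forall fun z => by
        obtain ⟨N, hN⟩ := exists_nat_ge (f z)
        refine tendsto_const_nhds.congr' ?_
        filter_upwards [eventually_ge_atTop N] with K hK
        have : (N : ℝ) ≤ K := by exact_mod_cast hK
        rw [max_eq_right]
        linarith)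
    simpa using this
  have hPP : IsProbabilityMeasure P := by
    rw [← h.law 0]; exact Measure.isProbabilityMeasure_map (h.meas 0).aemeasurable
  obtain ⟨K, hK⟩ := ((hlim.eventually (gt_mem_nhds (by positivity : 0 < ε / 2)))).exists
  have hint : Integrable (fun z => max (f z - K) 0) P :=
    (hf.sub (integrable_const _)).pos_part
  have h1 := (h.tendsto_smean hint).eventually (gt_mem_nhds hK)
  obtain ⟨N, hN⟩ := exists_nat_ge (2 * K / ε)
  filter_upwards [h1, tendsto_fst_inProb.eventually (eventually_ge_atTop (N + 1))]
    with q hq hqN j hj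
  have hq0 : (0 : ℝ) < q.1 := by exact_mod_cast (by omega : 0 < q.1)
  have h2 : max (f (Z j q.2) - K) 0 ≤ q.1 * smean Z q (fun z => max (f z - K) 0) := by
    simp only [smean]
    rw [← mul_assoc, mul_inv_cancel₀ hq0.ne', one_mul]
    exact Finset.single_le_sum (f := fun j => max (f (Z j q.2) - K) 0)
      (fun i _ => le_max_right _ _) (Finset.mem_range.2 hj)
  have h3 : f (Z j q.2) - K ≤ max (f (Z j q.2) - K) 0 := le_max_left _ _
  have h4 : (K : ℝ) ≤ ε / 2 * q.1 := by
    have h5 : (N : ℝ) ≤ q.1 := by exact_mod_cast (by omega : N ≤ q.1)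
    have := hN.trans h5
    rw [div_le_iff₀ hε] at this
    linarith
  have h6 : (q.1 : ℝ) * smean Z q (fun z => max (f z - K) 0) ≤ q.1 * (ε / 2) := by gcongr
  linarith

/-- For integrable `f`, `n⁻² ∑ f(Zⱼ)²` tends to zero in probability. -/
lemma IsSample.tendsto_smean_sq_div [IsProbabilityMeasure μ] (h : IsSample P μ Z) {f : 𝓩 → ℝ}
    (hf : Integrable f P) :
    Tendsto (fun q => smean Z q (fun z => f z ^ 2) / q.1) (inProb μ) (𝓝 0) := by
  have hlim := h.tendsto_smean hf.abs
  set m := ∫ z, |f z| ∂P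
  have hm : 0 ≤ m := integral_nonneg fun z => abs_nonneg _
  rw [Metric.tendsto_nhds]
  intro ε hε
  -- If `max |f| ≤ η n`, then `n⁻² ∑ f² ≤ η n⁻¹ ∑ |f|`, and the last mean is eventually below `m +
  -- 1`.
  have hη : 0 < ε / (2 * (m + 1)) := by positivity
  filter_upwards [h.max_le_eps_mul hf.abs hη, hlim.eventually (gt_mem_nhds (lt_add_one m)),
    tendsto_fst_inProb.eventually (eventually_ge_atTop 1)] with q h1 h2 h3
  have hq0 : (0 : ℝ) < q.1 := by exact_mod_cast h3
  have h4 : smean Z q (fun z => f z ^ 2)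
      ≤ (ε / (2 * (m + 1)) * q.1) * smean Z q (fun z => |f z|) := by
    rw [← smean_const_mul]
    refine smean_mono fun j hj => ?_
    rw [← sq_abs, sq]
    gcongr
    exact h1 j hj
  have h5 : 0 ≤ smean Z q (fun z => f z ^ 2) := smean_nonneg fun j _ => sq_nonneg _
  rw [Real.dist_0_eq_abs, abs_of_nonneg (by positivity), div_lt_iff₀ hq0]
  calc _ ≤ _ := h4
    _ ≤ (ε / (2 * (m + 1)) * q.1) * (m + 1) := by gcongr
    _ = ε / 2 * q.1 := by field_simp
    _ < ε * q.1 := by gcongr; linarith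

/-- For square integrable `f` and `ρ` of order `n^{-1/2}`, `ρ maxⱼ f(Zⱼ)` tends to zero in
probability. -/
lemma IsSample.mul_max_le [IsProbabilityMeasure μ] (h : IsSample P μ Z) {f : 𝓩 → ℝ}
    (hf : MemLp f 2 P) {ρ : ℕ × Ω → ℝ} (hρ0 : ∀ q, 0 ≤ ρ q)
    (hρ : OP μ (fun q => √(q.1 : ℝ) * ρ q)) {ε : ℝ} (hε : 0 < ε) :
    ∀ᶠ q in inProb μ, ∀ j < q.1, ρ q * |f (Z j q.2)| ≤ ε := by
  -- The maximum divided by `√n` tends to zero by the bound on maxima applied to `f²`. The product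
  -- `ρ max |f|` is then `(√n ρ) Y`, a bounded factor times a vanishing one.
  set Y : ℕ × Ω → ℝ := fun q => (⨆ j : Fin q.1, |f (Z j q.2)|) / √(q.1 : ℝ)
  have hY : Tendsto Y (inProb μ) (𝓝 0) := by
    rw [Metric.tendsto_nhds]
    intro δ hδ
    have h1 := h.max_le_eps_mul hf.integrable_sq (ε := (δ / 2) ^ 2) (by positivity)
    filter_upwards [h1, tendsto_fst_inProb.eventually (eventually_ge_atTop 1)] with q h1 h3
    have hq0 : (0 : ℝ) < q.1 := by exact_mod_cast h3
    have h4 : (⨆ j : Fin q.1, |f (Z j q.2)|) ≤ δ / 2 * √(q.1 : ℝ) := by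
      refine Real.iSup_le (fun j => ?_) (by positivity)
      refine abs_le_of_sq_le_sq ?_ (by positivity)
      rw [mul_pow, Real.sq_sqrt hq0.le]
      exact h1 j j.2
    have h5 : 0 ≤ (⨆ j : Fin q.1, |f (Z j q.2)|) := Real.iSup_nonneg fun j => abs_nonneg _
    rw [Real.dist_0_eq_abs, abs_of_nonneg (by positivity), div_lt_iff₀ (by positivity)]
    refine h4.trans_lt ?_
    gcongr
    linarith
  filter_upwards [(hρ Y hY).eventually (gt_mem_nhds hε),
    tendsto_fst_inProb.eventually (eventually_ge_atTop 1)] with q h1 h3 j hj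
  have hq0 : (0 : ℝ) < q.1 := by exact_mod_cast h3
  have h4 : |f (Z j q.2)| ≤ ⨆ j : Fin q.1, |f (Z j q.2)| :=
    le_ciSup (f := fun j : Fin q.1 => |f (Z j q.2)|) (Set.finite_range _).bddAbove ⟨j, hj⟩
  have h5 : √(q.1 : ℝ) * ρ q * Y q = ρ q * ⨆ j : Fin q.1, |f (Z j q.2)| := by
    have : √(q.1 : ℝ) ≠ 0 := by positivity
    simp only [Y]; field_simp
  rw [h5] at h1
  exact (mul_le_mul_of_nonneg_left h4 (hρ0 q)).trans h1.le

end Sample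

/-! ### Functions that are smooth in mean, on neighbourhoods depending on the observation. -/

section Smooth

variable {𝓩 : Type*} [MeasurableSpace 𝓩] {ι : Type*} [Fintype ι] {P : Measure 𝓩}

/-- `F(z, ·)` is differentiable near `b`, with an expected derivative at `b` and an expected
modulus of continuity of the derivative that tends to zero. The size of the neighbourhood may
depend on `z` through the weight `s`. -/
structure SmoothMean (P : Measure 𝓩) (s : 𝓩 → ℝ) (F : 𝓩 → (ι → ℝ) → ℝ) (b : ι → ℝ) : Prop where
  meas : ∀ b', AEStronglyMeasurable (fun z => F z b') P
  bound : ∃ h : 𝓩 → ℝ, Integrable h P ∧ ∀ᵐ z ∂P, ‖fderiv ℝ (F z) b‖ ≤ h z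
  modulus : ∀ ε > 0, ∃ δ > 0, ∃ W : 𝓩 → ℝ, Integrable W P ∧ ∫ z, W z ∂P ≤ ε ∧
    ∀ᵐ z ∂P, ∀ b', ‖b' - b‖ * s z ≤ δ → DifferentiableAt ℝ (F z) b' ∧
      ‖fderiv ℝ (F z) b' - fderiv ℝ (F z) b‖ ≤ W z

/-- The directional derivative is the almost everywhere limit of the measurable difference quotients
`n (F(b + v/n) - F(b))`. -/
lemma aestronglyMeasurable_fderiv_apply {F : 𝓩 → (ι → ℝ) → ℝ} {b : ι → ℝ}
    (hm : ∀ b', AEStronglyMeasurable (fun z => F z b') P)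
    (hd : ∀ᵐ z ∂P, DifferentiableAt ℝ (F z) b) (v : ι → ℝ) :
    AEStronglyMeasurable (fun z => fderiv ℝ (F z) b v) P := by
  refine aestronglyMeasurable_of_tendsto_ae (u := (atTop : Filter ℕ))
    (f := fun (n : ℕ) z => (n : ℝ) • (F z (b + (n : ℝ)⁻¹ • v) - F z b)) (fun n => ?_) ?_
  · simp only [smul_eq_mul]
    exact ((hm _).sub (hm _)).const_mul _
  · filter_upwards [hd] with z hz
    exact (hz.hasFDerivAt.lim_real v).comp tendsto_natCast_atTop_atTop

lemma clm_eq_sum [DecidableEq ι] (L : (ι → ℝ) →L[ℝ] ℝ) :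
    L = ∑ i, L (Pi.single i 1) • (ContinuousLinearMap.proj i : (ι → ℝ) →L[ℝ] ℝ) := by
  ext v
  conv_lhs => rw [← Finset.univ_sum_single v]
  rw [map_sum]
  simp only [FunLike.coe_sum, Finset.sum_apply, FunLike.coe_smul, Pi.smul_apply,
    ContinuousLinearMap.proj_apply, smul_eq_mul]
  refine Finset.sum_congr rfl fun i _ => ?_
  rw [show (Pi.single i (v i) : ι → ℝ) = v i • Pi.single i 1 by
    rw [← Pi.single_smul, smul_eq_mul, mul_one], map_smul, smul_eq_mul, mul_comm]

lemma clm_apply_eq_sum [DecidableEq ι] (L : (ι → ℝ) →L[ℝ] ℝ) (v : ι → ℝ) :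
    L v = ∑ i, L (Pi.single i 1) * v i := by
  conv_lhs => rw [clm_eq_sum L]
  simp

/-- In finite dimension the derivative is a finite combination of fixed functionals with measurable
coefficients. -/
lemma aestronglyMeasurable_fderiv {F : 𝓩 → (ι → ℝ) → ℝ} {b : ι → ℝ}
    (hm : ∀ b', AEStronglyMeasurable (fun z => F z b') P)
    (hd : ∀ᵐ z ∂P, DifferentiableAt ℝ (F z) b) :
    AEStronglyMeasurable (fun z => fderiv ℝ (F z) b) P := by
  classical
  have : (fun z => fderiv ℝ (F z) b) = fun z => ∑ i, fderiv ℝ (F z) b (Pi.single i 1) •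
      (ContinuousLinearMap.proj i : (ι → ℝ) →L[ℝ] ℝ) := by
    funext z; exact clm_eq_sum _
  rw [this]
  exact Finset.aestronglyMeasurable_fun_sum _ fun i _ =>
    (aestronglyMeasurable_fderiv_apply hm hd _).smul_const _

section Basic

variable {s : 𝓩 → ℝ} {F : 𝓩 → (ι → ℝ) → ℝ} {b : ι → ℝ}

lemma SmoothMean.differentiableAt (h : SmoothMean P s F b) :
    ∀ᵐ z ∂P, DifferentiableAt ℝ (F z) b := by
  obtain ⟨δ, hδ, W, -, -, hW⟩ := h.modulus 1 one_pos
  filter_upwards [hW] with z hz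
  exact (hz b (by simpa using hδ.le)).1

lemma SmoothMean.integrable_fderiv_apply (h : SmoothMean P s F b) (v : ι → ℝ) :
    Integrable (fun z => fderiv ℝ (F z) b v) P := by
  obtain ⟨H, hH, hb⟩ := h.bound
  refine (hH.mul_const ‖v‖).mono'
    (aestronglyMeasurable_fderiv_apply h.meas h.differentiableAt v) ?_
  filter_upwards [hb] with z hz
  exact (ContinuousLinearMap.le_opNorm _ _).trans (by gcongr)

/-- A larger weight shrinks the neighbourhoods. Conditions obtained with weight `1` thus join those
with weight `wt`. -/
lemma SmoothMean.mono_weight (h : SmoothMean P s F b) {s' : 𝓩 → ℝ}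
    (hs : ∀ z, s z ≤ s' z) : SmoothMean P s' F b := by
  refine ⟨h.meas, h.bound, fun ε hε => ?_⟩
  obtain ⟨δ, hδ, W, hW, hWε, hb⟩ := h.modulus ε hε
  refine ⟨δ, hδ, W, hW, hWε, ?_⟩
  filter_upwards [hb] with z hz b' hb'
  exact hz b' (le_trans (by gcongr; exact hs z) hb')

/-- The remainder of the first order expansion. -/
lemma norm_sub_sub_fderiv_le {f : (ι → ℝ) → ℝ} {c W δ : ℝ} (hc : 0 ≤ c)
    (hf : ∀ b', ‖b' - b‖ * c ≤ δ → DifferentiableAt ℝ f b' ∧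
      ‖fderiv ℝ f b' - fderiv ℝ f b‖ ≤ W) {b' : ι → ℝ} (hb' : ‖b' - b‖ * c ≤ δ) :
    |f b' - f b - fderiv ℝ f b (b' - b)| ≤ W * ‖b' - b‖ := by
  -- The admissible set is itself a ball around `b`, so the whole closed ball through `b'` is
  -- admissible and the mean value inequality applies on it.
  have hsub : ∀ y ∈ Metric.closedBall b ‖b' - b‖, ‖y - b‖ * c ≤ δ := fun y hy => by
    rw [Metric.mem_closedBall, dist_eq_norm] at hy
    exact le_trans (by gcongr) hb'
  exact (convex_closedBall b ‖b' - b‖).norm_image_sub_le_of_norm_fderiv_le'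
    (fun y hy => (hf y (hsub y hy)).1) (fun y hy => (hf y (hsub y hy)).2)
    (Metric.mem_closedBall_self (norm_nonneg _)) (by simp [dist_eq_norm])

/-- Linear part plus remainder. In the applications `H` and `W` are values of integrable functions,
so this is a Lipschitz bound with an integrable envelope. -/
lemma abs_sub_le_of_modulus {f : (ι → ℝ) → ℝ} {c W δ H : ℝ} (hc : 0 ≤ c)
    (hf : ∀ b', ‖b' - b‖ * c ≤ δ → DifferentiableAt ℝ f b' ∧
      ‖fderiv ℝ f b' - fderiv ℝ f b‖ ≤ W) (hH : ‖fderiv ℝ f b‖ ≤ H)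
    {b' : ι → ℝ} (hb' : ‖b' - b‖ * c ≤ δ) :
    |f b' - f b| ≤ (H + W) * ‖b' - b‖ := by
  have h1 := norm_sub_sub_fderiv_le hc hf hb'
  have h2 : |fderiv ℝ f b (b' - b)| ≤ H * ‖b' - b‖ :=
    ((fderiv ℝ f b).le_opNorm (b' - b)).trans (by gcongr)
  have h3 : f b' - f b = (f b' - f b - fderiv ℝ f b (b' - b)) + fderiv ℝ f b (b' - b) := by ring
  rw [h3]
  refine (abs_add_le _ _).trans ?_
  linarith

/-- Affine functions of the parameter with deterministic slope. -/
lemma SmoothMean.affine [IsFiniteMeasure P] {a : 𝓩 → ℝ} (ha : AEStronglyMeasurable a P)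
    (L : (ι → ℝ) →L[ℝ] ℝ) : SmoothMean P s (fun z b' => a z + L b') b := by
  have hd (z : 𝓩) (b' : ι → ℝ) : HasFDerivAt (fun b' => a z + L b') L b' :=
    L.hasFDerivAt.const_add _
  refine ⟨fun b' => ha.add_const _, ⟨fun _ => ‖L‖, integrable_const _,
    Eventually.of_forall fun z => by rw [(hd z b).fderiv]⟩, fun ε hε => ?_⟩
  refine ⟨1, one_pos, fun _ => 0, integrable_zero _ _ _, by simpa using hε.le,
    Eventually.of_forall fun z b' _ => ⟨(hd z b').differentiableAt, ?_⟩⟩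
  rw [(hd z b').fderiv, (hd z b).fderiv]; simp

lemma SmoothMean.add {F' : 𝓩 → (ι → ℝ) → ℝ} (h : SmoothMean P s F b)
    (h' : SmoothMean P s F' b) :
    SmoothMean P s (fun z b' => F z b' + F' z b') b := by
  refine ⟨fun b' => (h.meas b').add (h'.meas b'), ?_, fun ε hε => ?_⟩
  · obtain ⟨H, hH, hb⟩ := h.bound
    obtain ⟨H', hH', hb'⟩ := h'.bound
    refine ⟨fun z => H z + H' z, hH.add hH', ?_⟩
    filter_upwards [hb, hb', h.differentiableAt, h'.differentiableAt] with z h1 h2 h3 h4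
    rw [fderiv_fun_add h3 h4]
    exact (norm_add_le _ _).trans (add_le_add h1 h2)
  · obtain ⟨δ, hδ, W, hW, hWε, hb⟩ := h.modulus (ε / 2) (by positivity)
    obtain ⟨δ', hδ', W', hW', hWε', hb'⟩ := h'.modulus (ε / 2) (by positivity)
    refine ⟨min δ δ', lt_min hδ hδ', fun z => W z + W' z, hW.add hW', ?_, ?_⟩
    · rw [integral_add hW hW']; linarith
    · filter_upwards [hb, hb', h.differentiableAt, h'.differentiableAt] with z h1 h2 h3 h4 c hc
      obtain ⟨d1, e1⟩ := h1 c (hc.trans (min_le_left _ _))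
      obtain ⟨d2, e2⟩ := h2 c (hc.trans (min_le_right _ _))
      refine ⟨d1.fun_add d2, ?_⟩
      rw [fderiv_fun_add h3 h4, fderiv_fun_add d1 d2, add_sub_add_comm]
      exact (norm_add_le _ _).trans (add_le_add e1 e2)

/-- Functions of a sub-vector of the parameter. -/
lemma SmoothMean.reindex {ι' : Type*} [Fintype ι'] (e : ι' → ι) {F : 𝓩 → (ι' → ℝ) → ℝ}
    (h : SmoothMean P s F (fun k => b (e k))) (hs : ∀ z, 0 ≤ s z) :
    SmoothMean P s (fun z (b' : ι → ℝ) => F z (fun k => b' (e k))) b := by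
  let L : (ι → ℝ) →L[ℝ] (ι' → ℝ) := ContinuousLinearMap.pi fun k => ContinuousLinearMap.proj (e k)
  have hL (v : ι → ℝ) : ‖L v‖ ≤ 1 * ‖v‖ := by
    rw [one_mul]
    exact (pi_norm_le_iff_of_nonneg (norm_nonneg _)).2 fun k => norm_le_pi_norm v (e k)
  have hL1 : ‖L‖ ≤ 1 := ContinuousLinearMap.opNorm_le_bound _ zero_le_one hL
  have hd {z : 𝓩} {b' : ι → ℝ} (hz : DifferentiableAt ℝ (F z) (L b')) :
      HasFDerivAt (fun b' : ι → ℝ => F z (L b')) ((fderiv ℝ (F z) (L b')).comp L) b' :=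
    hz.hasFDerivAt.comp b' L.hasFDerivAt
  refine ⟨fun b' => h.meas (L b'), ?_, fun ε hε => ?_⟩
  · obtain ⟨H, hH, hb⟩ := h.bound
    refine ⟨H, hH, ?_⟩
    filter_upwards [hb, h.differentiableAt] with z hz hz'
    have := (hd (b' := b) hz').fderiv
    refine this ▸ (ContinuousLinearMap.opNorm_comp_le _ _).trans ?_
    exact (mul_le_of_le_one_right (norm_nonneg _) hL1).trans hz
  · obtain ⟨δ, hδ, W, hW, hWε, hb⟩ := h.modulus ε hε
    refine ⟨δ, hδ, W, hW, hWε, ?_⟩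
    filter_upwards [hb, h.differentiableAt] with z hz hz' b' hb'
    have h1 : ‖L b' - L b‖ * s z ≤ δ := by
      rw [← map_sub]
      refine le_trans ?_ hb'
      gcongr
      · exact hs z
      · simpa using hL (b' - b)
    obtain ⟨d1, e1⟩ := hz (L b') h1
    refine ⟨(hd d1).differentiableAt, ?_⟩
    have h2 := (hd d1).fderiv
    have h3 := (hd (b' := b) hz').fderiv
    change ‖fderiv ℝ (fun b' : ι → ℝ => F z (L b')) b'
      - fderiv ℝ (fun b' : ι → ℝ => F z (L b')) b‖ ≤ W z
    rw [h2, h3, ← ContinuousLinearMap.sub_comp]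
    refine (ContinuousLinearMap.opNorm_comp_le _ _).trans ?_
    exact (mul_le_of_le_one_right (norm_nonneg _) hL1).trans e1

end Basic

/-! ### Products with bounded factors, such as inverse probability weights. -/

section Factor

variable {s : 𝓩 → ℝ} {b : ι → ℝ}

/-- A factor that is bounded near `b`, with derivatives growing with the weight `s`. -/
structure BddFactor (P : Measure 𝓩) (s : 𝓩 → ℝ) (f : 𝓩 → (ι → ℝ) → ℝ) (b : ι → ℝ) : Prop where
  meas : ∀ b', AEStronglyMeasurable (fun z => f z b') P
  bound : ∃ C : ℝ, 0 ≤ C ∧ ∀ᵐ z ∂P, ∀ b', ‖b' - b‖ * s z ≤ 1 → DifferentiableAt ℝ (f z) b' ∧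
    |f z b'| ≤ C ∧ |f z b' - f z b| ≤ C * (‖b' - b‖ * s z) ∧ ‖fderiv ℝ (f z) b'‖ ≤ C * s z ∧
    ‖fderiv ℝ (f z) b' - fderiv ℝ (f z) b‖ ≤ C * s z * (‖b' - b‖ * s z)

/-- On `‖b' - b‖ s(z) ≤ 1` the argument `ℓ z b'` stays within `K` of `ℓ z b`, hence in a fixed
compact interval on which `φ` and its first two derivatives are bounded. Each differentiation in
`b'` costs a factor `‖ℓ z‖ ≤ K s(z)`. -/
lemma BddFactor.of_contDiff {φ : ℝ → ℝ} (hφ : ContDiff ℝ 2 φ) {c t : 𝓩 → ℝ}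
    {ℓ : 𝓩 → ((ι → ℝ) →L[ℝ] ℝ)} {B K : ℝ} (hc : AEStronglyMeasurable c P)
    (ht : AEStronglyMeasurable t P) (hℓ : ∀ v, AEStronglyMeasurable (fun z => ℓ z v) P)
    (hc1 : ∀ z, |c z| ≤ 1) (ht1 : ∀ z, |t z| ≤ 1) (hs : ∀ z, 0 ≤ s z)
    (hK : 0 ≤ K) (hℓK : ∀ z, ‖ℓ z‖ ≤ K * s z) (hB : ∀ᵐ z ∂P, |ℓ z b| ≤ B) :
    BddFactor P s (fun z b' => c z + t z * φ (ℓ z b')) b := by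
  refine ⟨fun b' => hc.add (ht.mul (hφ.continuous.comp_aestronglyMeasurable (hℓ b'))), ?_⟩
  have hφ1 : ContDiff ℝ 1 (deriv φ) := by
    have : ContDiff ℝ (1 + 1) φ := by norm_num; exact hφ
    exact (contDiff_succ_iff_deriv.1 this).2.2
  obtain ⟨A, hA⟩ := (isCompact_Icc (a := -(B + K)) (b := B + K)).exists_bound_of_continuousOn
    hφ.continuous.continuousOn
  obtain ⟨A', hA'⟩ := (isCompact_Icc (a := -(B + K)) (b := B + K)).exists_bound_of_continuousOn
    hφ1.continuous.continuousOn
  obtain ⟨A'', hA''⟩ := (isCompact_Icc (a := -(B + K)) (b := B + K)).exists_bound_of_continuousOn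
    (hφ1.continuous_deriv le_rfl).continuousOn
  set M := max (max |A| |A'|) (max |A''| 1) with hM
  have hM1 : 1 ≤ M := (le_max_right _ _).trans (le_max_right _ _)
  have hMA : A ≤ M := (le_abs_self A).trans ((le_max_left _ _).trans (le_max_left _ _))
  have hMA' : A' ≤ M := (le_abs_self A').trans ((le_max_right _ _).trans (le_max_left _ _))
  have hMA'' : A'' ≤ M := (le_abs_self A'').trans ((le_max_left _ _).trans (le_max_right _ _))
  -- Here `1 + M` bounds the values, `M K` the increments and the derivative, and `M K K` the
  -- increments of the derivative.
  refine ⟨1 + M + M * K + M * K * K, by positivity, ?_⟩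
  filter_upwards [hB] with z hz b' hb'
  have hsz := hs z
  have hd (x : ι → ℝ) : HasFDerivAt (fun b' => c z + t z * φ (ℓ z b'))
      ((t z * deriv φ (ℓ z x)) • ℓ z) x := by
    have h1 : HasDerivAt φ (deriv φ (ℓ z x)) (ℓ z x) :=
      (hφ.differentiable (by norm_num)).differentiableAt.hasDerivAt
    have h2 := ((h1.comp_hasFDerivAt x (ℓ z).hasFDerivAt).const_mul (t z)).const_add (c z)
    rwa [smul_smul] at h2
  have hdiff : |ℓ z b' - ℓ z b| ≤ K * (‖b' - b‖ * s z) := by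
    rw [← map_sub]
    refine ((ℓ z).le_opNorm _).trans ?_
    calc _ ≤ K * s z * ‖b' - b‖ := by gcongr; exact hℓK z
      _ = _ := by ring
  have hu : ℓ z b ∈ Icc (-(B + K)) (B + K) := by
    rw [mem_Icc]; rw [abs_le] at hz; constructor <;> linarith
  have hu' : ℓ z b' ∈ Icc (-(B + K)) (B + K) := by
    have h1 : |ℓ z b' - ℓ z b| ≤ K := hdiff.trans (mul_le_of_le_one_right hK hb')
    rw [abs_le] at h1 hz
    rw [mem_Icc]; constructor <;> linarith
  have mv (g : ℝ → ℝ) (hg : Differentiable ℝ g)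
      (hg' : ∀ x ∈ Icc (-(B + K)) (B + K), ‖deriv g x‖ ≤ M) :
      |g (ℓ z b') - g (ℓ z b)| ≤ M * |ℓ z b' - ℓ z b| :=
    (convex_Icc _ _).norm_image_sub_le_of_norm_deriv_le (fun x _ => hg.differentiableAt) hg' hu hu'
  have ht := ht1 z
  refine ⟨(hd b').differentiableAt, ?_, ?_, ?_, ?_⟩
  · refine (abs_add_le _ _).trans ?_
    rw [abs_mul]
    have h1 : |t z| * |φ (ℓ z b')| ≤ 1 * M := by
      gcongr
      exact (hA _ hu').trans hMA
    have := hc1 z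
    have : 0 ≤ M * K + M * K * K := by positivity
    linarith
  · rw [add_sub_add_left_eq_sub, ← mul_sub, abs_mul]
    have h1 := mv φ (hφ.differentiable (by norm_num)) fun x hx => (hA' x hx).trans hMA'
    calc |t z| * |φ (ℓ z b') - φ (ℓ z b)| ≤ 1 * (M * (K * (‖b' - b‖ * s z))) := by
          gcongr
          exact h1.trans (by gcongr)
      _ = (M * K) * (‖b' - b‖ * s z) := by ring
      _ ≤ _ := by
          gcongr
          have : 0 ≤ M * K * K := by positivity
          linarith
  · rw [(hd b').fderiv, norm_smul, Real.norm_eq_abs, abs_mul]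
    calc |t z| * |deriv φ (ℓ z b')| * ‖ℓ z‖ ≤ 1 * M * (K * s z) := by
          gcongr
          · exact (hA' _ hu').trans hMA'
          · exact hℓK z
      _ = (M * K) * s z := by ring
      _ ≤ _ := by
          gcongr
          have : 0 ≤ M * K * K := by positivity
          linarith
  · rw [(hd b').fderiv, (hd b).fderiv, show (t z * deriv φ (ℓ z b')) • ℓ z
      - (t z * deriv φ (ℓ z b)) • ℓ z = (t z * (deriv φ (ℓ z b') - deriv φ (ℓ z b))) • ℓ z by
        module, norm_smul, Real.norm_eq_abs, abs_mul]
    have h1 := mv (deriv φ) (hφ1.differentiable (by norm_num)) fun x hx => (hA'' x hx).trans hMA''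
    calc |t z| * |deriv φ (ℓ z b') - deriv φ (ℓ z b)| * ‖ℓ z‖
        ≤ 1 * (M * (K * (‖b' - b‖ * s z))) * (K * s z) := by
          gcongr
          · exact h1.trans (by gcongr)
          · exact hℓK z
      _ = (M * K * K) * s z * (‖b' - b‖ * s z) := by ring
      _ ≤ _ := by
          gcongr
          have : 0 ≤ M * K := by positivity
          linarith

/-- In the product rule, `k` times the derivative of `f` has size `|k| s`, which is integrable by
Cauchy–Schwarz. This is where the second moments of `k` at the limit and of the weight enter. -/
lemma BddFactor.mul {f k : 𝓩 → (ι → ℝ) → ℝ} (hf : BddFactor P s f b) (hk : SmoothMean P s k b)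
    (hk2 : MemLp (fun z => k z b) 2 P) (hs2 : MemLp s 2 P) (hs : ∀ z, 0 ≤ s z) :
    SmoothMean P s (fun z b' => f z b' * k z b') b := by
  obtain ⟨C, hC, hf1⟩ := hf.bound
  obtain ⟨H, hH, hHb⟩ := hk.bound
  have hks : Integrable (fun z => |k z b| * s z) P := hk2.abs.integrable_mul hs2
  refine ⟨fun b' => (hf.meas b').mul (hk.meas b'), ⟨fun z => C * H z + C * (|k z b| * s z),
    (hH.const_mul C).add (hks.const_mul C), ?_⟩, fun ε hε => ?_⟩
  · filter_upwards [hf1, hHb, hk.differentiableAt] with z h1 h2 h3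
    obtain ⟨d1, a1, a2, a3, a4⟩ := h1 b (by simp)
    rw [fderiv_fun_mul d1 h3]
    refine (norm_add_le _ _).trans ?_
    rw [norm_smul, norm_smul, Real.norm_eq_abs, Real.norm_eq_abs]
    calc _ ≤ C * H z + |k z b| * (C * s z) := by gcongr
      _ = _ := by ring
  · set G : 𝓩 → ℝ := fun z => 2 * C * H z + C * (|k z b| * s z) with hG
    have hGi : Integrable G P := (hH.const_mul _).add (hks.const_mul C)
    set I := |∫ z, G z ∂P|
    -- The modulus of the product will be `2 C W + δ' G`. The choice `ε / (4 C + 1)` keeps the first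
    -- integral below `ε / 2`. The three bounds on `δ'` serve the modulus of `k`, the bounds on `f`,
    -- and the integral of `δ' G`.
    obtain ⟨δ, hδ, W, hW, hWε, hb⟩ := hk.modulus (ε / (4 * C + 1)) (by positivity)
    set δ' := min (min δ 1) (ε / (2 * (I + 1))) with hδ'
    have hI : 0 ≤ I := abs_nonneg _
    have hδ'0 : 0 < δ' := lt_min (lt_min hδ one_pos) (by positivity)
    refine ⟨δ', hδ'0, fun z => 2 * C * W z + δ' * G z,
      (hW.const_mul _).add (hGi.const_mul _), ?_, ?_⟩
    · rw [integral_add (hW.const_mul _) (hGi.const_mul _), integral_const_mul, integral_const_mul]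
      have h1 : 2 * C * ∫ z, W z ∂P ≤ ε / 2 := by
        calc _ ≤ 2 * C * (ε / (4 * C + 1)) := by gcongr
          _ ≤ ε / 2 := by
            rw [mul_div_assoc', div_le_div_iff₀ (by positivity) (by positivity)]
            nlinarith
      have h2 : δ' * ∫ z, G z ∂P ≤ ε / 2 := by
        calc _ ≤ (ε / (2 * (I + 1))) * (I + 1) := by
              have : ∫ z, G z ∂P ≤ I + 1 := (le_abs_self _).trans (by simp [I])
              have h3 : δ' ≤ ε / (2 * (I + 1)) := min_le_right _ _
              calc _ ≤ δ' * (I + 1) := by gcongr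
                _ ≤ _ := by gcongr
          _ = _ := by field_simp
      linarith
    · filter_upwards [hf1, hHb, hk.differentiableAt, hb] with z h1 h2 h3 h4 b' hb'
      have hbδ : ‖b' - b‖ * s z ≤ δ := hb'.trans ((min_le_left _ _).trans (min_le_left _ _))
      have hb1 : ‖b' - b‖ * s z ≤ 1 := hb'.trans ((min_le_left _ _).trans (min_le_right _ _))
      obtain ⟨d0, -, -, -, -⟩ := h1 b (by simp)
      obtain ⟨d1, a1, a2, a3, a4⟩ := h1 b' hb1
      obtain ⟨d2, e2⟩ := h4 b' hbδ
      refine ⟨d1.fun_mul d2, ?_⟩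
      rw [fderiv_fun_mul d0 h3, fderiv_fun_mul d1 d2]
      have hdk := abs_sub_le_of_modulus (hs z) h4 h2 hbδ
      have hW0 : 0 ≤ W z := (norm_nonneg _).trans e2
      have hH0 : 0 ≤ H z := (norm_nonneg _).trans h2
      -- Telescoping into four terms: each contains an increment of `f`, of `k` or of one of their
      -- derivatives, and so is controlled by `W` or by `‖b' - b‖ s(z)`.
      have key : f z b' • fderiv ℝ (k z) b' + k z b' • fderiv ℝ (f z) b'
          - (f z b • fderiv ℝ (k z) b + k z b • fderiv ℝ (f z) b)
          = f z b' • (fderiv ℝ (k z) b' - fderiv ℝ (k z) b)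
            + (f z b' - f z b) • fderiv ℝ (k z) b
            + (k z b' - k z b) • fderiv ℝ (f z) b'
            + k z b • (fderiv ℝ (f z) b' - fderiv ℝ (f z) b) := by module
      rw [key]
      refine (norm_add_le _ _).trans ((add_le_add_left (norm_add_le _ _) _).trans
        ((add_le_add_left (add_le_add_left (norm_add_le _ _) _) _).trans ?_))
      simp only [norm_smul, Real.norm_eq_abs]
      have hsz := hs z
      calc _ ≤ C * W z + C * δ' * H z + ((H z + W z) * ‖b' - b‖) * (C * s z)
            + |k z b| * (C * s z * δ') := by
              gcongr
              exact a2.trans (by gcongr)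
              exact a4.trans (by gcongr)
        _ = C * W z + C * δ' * H z + C * (H z + W z) * (‖b' - b‖ * s z)
            + |k z b| * (C * s z * δ') := by ring
        _ ≤ C * W z + C * δ' * H z + C * (H z * δ' + W z * 1)
            + |k z b| * (C * s z * δ') := by
              rw [mul_assoc C (H z + W z), add_mul (H z)]
              gcongr
        _ = _ := by simp only [hG]; ring

end Factor

end Smooth

/-! ### Sample means evaluated at an estimator. -/

section Plugin

variable {𝓩 Ω : Type*} [MeasurableSpace 𝓩] [MeasurableSpace Ω] {ι : Type*} [Fintype ι]
  {P : Measure 𝓩} {μ : Measure Ω} {Z : ℕ → Ω → 𝓩} {s : 𝓩 → ℝ} {F : 𝓩 → (ι → ℝ) → ℝ}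
  {b : ι → ℝ} {bh : ℕ × Ω → ι → ℝ}

/-- The estimator `bh` converges to `b` faster than the weights `s(Zⱼ)` grow. -/
def Localized (μ : Measure Ω) (Z : ℕ → Ω → 𝓩) (s : 𝓩 → ℝ) (bh : ℕ × Ω → ι → ℝ) (b : ι → ℝ) :
    Prop :=
  ∀ ε > 0, ∀ᶠ q in inProb μ, ∀ j < q.1, ‖bh q - b‖ * s (Z j q.2) ≤ ε

omit [MeasurableSpace 𝓩] in
-- With constant weight, consistency is enough. This starts the argument for the regression
-- parameters, whose rate is not yet known.
lemma Localized.of_tendsto (h : Tendsto bh (inProb μ) (𝓝 b)) :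
    Localized μ Z (fun _ => 1) bh b := by
  intro ε hε
  filter_upwards [h.eventually (Metric.ball_mem_nhds b hε)] with q hq j _
  rw [dist_eq_norm] at hq
  simpa using hq.le

/-- For square integrable `s` the largest weight in the sample is `o_P(√n)`, and the error of the
estimator is of order `n^{-1/2}`. -/
lemma Localized.of_op [IsProbabilityMeasure μ] (hZ : IsSample P μ Z) (hs : MemLp s 2 P)
    (hs0 : ∀ z, 0 ≤ s z) (h : OP μ (fun q => √(q.1 : ℝ) * ‖bh q - b‖)) :
    Localized μ Z s bh b := by
  intro ε hε
  filter_upwards [hZ.mul_max_le hs (fun q => norm_nonneg (bh q - b)) h hε] with q hq j hj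
  have := hq j hj
  rwa [abs_of_nonneg (hs0 _)] at this

lemma SmoothMean.eventually_differentiableAt (hF : SmoothMean P s F b) (hZ : IsSample P μ Z)
    (hb : Localized μ Z s bh b) :
    ∀ᶠ q in inProb μ, ∀ j < q.1, DifferentiableAt ℝ (F (Z j q.2)) (bh q) := by
  obtain ⟨δ, hδ, W, -, -, hWb⟩ := hF.modulus 1 one_pos
  filter_upwards [hZ.eventually hWb, hb δ hδ] with q h1 h2 j hj
  exact (h1 j (bh q) (h2 j hj)).1

/-- The average derivative at the estimator converges to the expected derivative at the limit. -/
lemma SmoothMean.tendsto_smean_fderiv [IsProbabilityMeasure μ] (hF : SmoothMean P s F b)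
    (hZ : IsSample P μ Z) (hb : Localized μ Z s bh b) (v : ι → ℝ) :
    Tendsto (fun q => smean Z q (fun z => fderiv ℝ (F z) (bh q) v)) (inProb μ)
      (𝓝 (∫ z, fderiv ℝ (F z) b v ∂P)) := by
  have h0 := hZ.tendsto_smean (hF.integrable_fderiv_apply v)
  suffices h : Tendsto (fun q => smean Z q (fun z => fderiv ℝ (F z) (bh q) v)
      - smean Z q (fun z => fderiv ℝ (F z) b v)) (inProb μ) (𝓝 0) by simpa using h.add h0
  rw [Metric.tendsto_nhds]
  intro ε hε
  obtain ⟨δ, hδ, W, hW, hWε, hWb⟩ := hF.modulus (ε / (2 * (‖v‖ + 1))) (by positivity)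
  have h1 := (hZ.tendsto_smean hW).eventually
    (gt_mem_nhds (hWε.trans_lt (div_lt_div_of_pos_left hε (by positivity)
      (by linarith [norm_nonneg v] : (‖v‖ + 1) < 2 * (‖v‖ + 1)))))
  filter_upwards [h1, hZ.eventually hWb, hb δ hδ] with q h1 h2 h3
  rw [Real.dist_0_eq_abs, ← smean_sub]
  have h4 : |smean Z q (fun z => fderiv ℝ (F z) (bh q) v - fderiv ℝ (F z) b v)|
      ≤ smean Z q (fun z => W z * ‖v‖) := by
    refine abs_smean_le fun j hj => ?_
    have h5 := (h2 j (bh q) (h3 j hj)).2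
    exact ((fderiv ℝ (F (Z j q.2)) (bh q) - fderiv ℝ (F (Z j q.2)) b).le_opNorm v).trans
      (by gcongr)
  rw [smean_mul_const] at h4
  refine h4.trans_lt ?_
  calc _ ≤ ε / (‖v‖ + 1) * ‖v‖ := by gcongr
    _ < ε / (‖v‖ + 1) * (‖v‖ + 1) := by gcongr; linarith
    _ = ε := by field_simp

/-- First order expansion of the sample mean at the estimator. -/
lemma SmoothMean.expansion [DecidableEq ι] [IsProbabilityMeasure μ] (hF : SmoothMean P s F b)
    (hs : ∀ z, 0 ≤ s z) (hZ : IsSample P μ Z) (hb : Localized μ Z s bh b) :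
    ∃ R : ℕ × Ω → ℝ, Tendsto R (inProb μ) (𝓝 0) ∧ ∀ q,
      |smean Z q (fun z => F z (bh q)) - smean Z q (fun z => F z b)
        - ∑ i, (∫ z, fderiv ℝ (F z) b (Pi.single i 1) ∂P) * (bh q i - b i)|
      ≤ R q * ‖bh q - b‖ := by
  set D : ℕ × Ω → ℝ := fun q => smean Z q (fun z => F z (bh q)) - smean Z q (fun z => F z b)
        - ∑ i, (∫ z, fderiv ℝ (F z) b (Pi.single i 1) ∂P) * (bh q i - b i) with hD
  -- At `bh q = b` the quotient is `0` by convention, and `D q` vanishes there too, so the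
  -- inequality holds without exception.
  refine ⟨fun q => |D q| / ‖bh q - b‖, ?_, fun q => ?_⟩
  · rw [Metric.tendsto_nhds]
    intro ε hε
    obtain ⟨δ, hδ, W, hW, hWε, hWb⟩ := hF.modulus (ε / 4) (by positivity)
    have h1 := (hZ.tendsto_smean hW).eventually (gt_mem_nhds (hWε.trans_lt
      (by linarith : ε / 4 < ε / 2)))
    have h2 : Tendsto (fun q => ∑ i, |smean Z q (fun z => fderiv ℝ (F z) b (Pi.single i 1))
        - ∫ z, fderiv ℝ (F z) b (Pi.single i 1) ∂P|) (inProb μ) (𝓝 0) := by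
      rw [show (0 : ℝ) = ∑ i : ι, |(0 : ℝ)| by simp]
      refine tendsto_finsetSum _ fun i _ => (Tendsto.abs ?_)
      simpa using (hZ.tendsto_smean (hF.integrable_fderiv_apply (Pi.single i 1))).sub_const
        (∫ z, fderiv ℝ (F z) b (Pi.single i 1) ∂P)
    filter_upwards [h1, h2.eventually (gt_mem_nhds (half_pos hε)), hZ.eventually hWb, hb δ hδ]
      with q h1 h2 h3 h4
    rw [Real.dist_0_eq_abs, abs_of_nonneg (by positivity)]
    rcases (norm_nonneg (bh q - b)).eq_or_lt with h0 | h0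
    · rw [← h0, div_zero]; exact hε
    rw [div_lt_iff₀ h0]
    have h5 : |smean Z q (fun z => F z (bh q) - F z b - fderiv ℝ (F z) b (bh q - b))|
        ≤ smean Z q W * ‖bh q - b‖ := by
      rw [← smean_mul_const]
      exact abs_smean_le fun j hj => norm_sub_sub_fderiv_le (hs _) (h3 j) (h4 j hj)
    rw [smean_sub, smean_sub] at h5
    have h6 : smean Z q (fun z => fderiv ℝ (F z) b (bh q - b))
        = ∑ i, smean Z q (fun z => fderiv ℝ (F z) b (Pi.single i 1)) * (bh q i - b i) := by
      rw [show (fun z => fderiv ℝ (F z) b (bh q - b)) = fun z => ∑ i,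
        fderiv ℝ (F z) b (Pi.single i 1) * (bh q i - b i) from
        funext fun z => clm_apply_eq_sum _ _, smean_sum]
      exact Finset.sum_congr rfl fun i _ => smean_mul_const _ _
    have h7 : |∑ i, (smean Z q (fun z => fderiv ℝ (F z) b (Pi.single i 1))
        - ∫ z, fderiv ℝ (F z) b (Pi.single i 1) ∂P) * (bh q i - b i)|
        ≤ (ε / 2) * ‖bh q - b‖ := by
      refine (Finset.abs_sum_le_sum_abs _ _).trans ?_
      refine le_trans ?_ (mul_le_mul_of_nonneg_right h2.le (norm_nonneg _))
      rw [Finset.sum_mul]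
      refine Finset.sum_le_sum fun i _ => ?_
      rw [abs_mul]
      gcongr
      exact norm_le_pi_norm (bh q - b) i
    -- The remainder is the averaged pointwise Taylor remainder, controlled by the modulus `W`, plus
    -- the deviation of the average derivative from its mean, controlled by the law of large
    -- numbers. Each contributes `ε / 2`.
    have h8 : D q = (smean Z q (fun z => F z (bh q)) - smean Z q (fun z => F z b)
        - smean Z q (fun z => fderiv ℝ (F z) b (bh q - b)))
        + ∑ i, (smean Z q (fun z => fderiv ℝ (F z) b (Pi.single i 1))
        - ∫ z, fderiv ℝ (F z) b (Pi.single i 1) ∂P) * (bh q i - b i) := by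
      simp only [sub_mul, Finset.sum_sub_distrib, hD, h6]; ring
    rw [h8]
    refine (abs_add_le _ _).trans_lt ?_
    have h9 : smean Z q W * ‖bh q - b‖ < ε / 2 * ‖bh q - b‖ := by gcongr
    linarith
  · rcases eq_or_ne (bh q - b) 0 with h0 | h0
    · have h1 : bh q = b := sub_eq_zero.1 h0
      simp [h1]
    · rw [div_mul_cancel₀ _ (norm_ne_zero_iff.2 h0)]

/-- Replacing the limit by a root-`n` consistent estimator changes the summands by a term that is
negligible in mean square. -/
lemma SmoothMean.tendsto_smean_sub_sq [IsProbabilityMeasure μ] (hF : SmoothMean P s F b)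
    (hs : ∀ z, 0 ≤ s z) (hZ : IsSample P μ Z) (hb : Localized μ Z s bh b)
    (hop : OP μ (fun q => √(q.1 : ℝ) * ‖bh q - b‖)) :
    Tendsto (fun q => smean Z q (fun z => (F z (bh q) - F z b) ^ 2)) (inProb μ) (𝓝 0) := by
  obtain ⟨H, hH, hHb⟩ := hF.bound
  obtain ⟨δ, hδ, W, hW, -, hWb⟩ := hF.modulus 1 one_pos
  -- The bound is `n ‖bh - b‖²` times `n⁻² ∑ (H + W)²`. The second factor tends to zero although `H
  -- + W` is merely integrable.
  have h1 := (hop.mul hop) _ (hZ.tendsto_smean_sq_div (hH.add hW))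
  refine squeeze_zero' (Eventually.of_forall fun q => smean_nonneg fun j _ => sq_nonneg _) ?_ h1
  filter_upwards [hZ.eventually hWb, hZ.eventually hHb, hb δ hδ,
    tendsto_fst_inProb.eventually (eventually_ge_atTop 1)] with q h2 h3 h4 h5
  have hq0 : (0 : ℝ) < q.1 := by exact_mod_cast h5
  have h6 : smean Z q (fun z => (F z (bh q) - F z b) ^ 2)
      ≤ smean Z q (fun z => (H + W) z ^ 2 * ‖bh q - b‖ ^ 2) := by
    refine smean_mono fun j hj => ?_
    rw [← sq_abs, ← mul_pow]
    gcongr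
    exact abs_sub_le_of_modulus (hs _) (h2 j) (h3 j) (h4 j hj)
  rw [smean_mul_const] at h6
  refine h6.trans (le_of_eq ?_)
  have h7 : √(q.1 : ℝ) * √(q.1 : ℝ) = q.1 := Real.mul_self_sqrt hq0.le
  rw [show √(q.1 : ℝ) * ‖bh q - b‖ * (√(q.1 : ℝ) * ‖bh q - b‖)
    = (√(q.1 : ℝ) * √(q.1 : ℝ)) * ‖bh q - b‖ ^ 2 by ring, h7]
  field_simp

/-- Root-`n` order of a plugged-in sample mean with a root-`n` consistent estimator. -/
lemma SmoothMean.op_sqrt_smean [IsProbabilityMeasure μ] (hF : SmoothMean P s F b)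
    (hs : ∀ z, 0 ≤ s z) (hZ : IsSample P μ Z) (hb : Localized μ Z s bh b)
    (hop : OP μ (fun q => √(q.1 : ℝ) * ‖bh q - b‖)) (h2 : MemLp (fun z => F z b) 2 P)
    (h0 : ∫ z, F z b ∂P = 0) :
    OP μ (fun q => √(q.1 : ℝ) * smean Z q (fun z => F z (bh q))) := by
  obtain ⟨H, hH, hHb⟩ := hF.bound
  obtain ⟨δ, hδ, W, hW, -, hWb⟩ := hF.modulus 1 one_pos
  have h1 : OP μ (fun q => (√(q.1 : ℝ) * ‖bh q - b‖) * smean Z q (fun z => H z + W z)) :=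
    hop.mul (OP.of_tendsto (hZ.tendsto_smean (hH.add hW)))
  refine (h1.abs.add (hZ.op_sqrt_smean h2 h0).abs).mono ?_
  filter_upwards [hZ.eventually hWb, hZ.eventually hHb, hb δ hδ] with q h2 h3 h4
  have h6 : |smean Z q (fun z => F z (bh q) - F z b)|
      ≤ smean Z q (fun z => (H z + W z) * ‖bh q - b‖) :=
    abs_smean_le fun j hj => abs_sub_le_of_modulus (hs _) (h2 j) (h3 j) (h4 j hj)
  rw [smean_mul_const, smean_sub] at h6
  set x := smean Z q (fun z => F z (bh q))
  set y := smean Z q (fun z => F z b)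
  have h7 : |√(q.1 : ℝ) * (x - y)|
      ≤ |√(q.1 : ℝ) * ‖bh q - b‖ * smean Z q (fun z => H z + W z)| := by
    rw [abs_mul]
    calc _ ≤ |√(q.1 : ℝ)| * (smean Z q (fun z => H z + W z) * ‖bh q - b‖) :=
          mul_le_mul_of_nonneg_left h6 (abs_nonneg _)
      _ ≤ |√(q.1 : ℝ)| * |smean Z q (fun z => H z + W z) * ‖bh q - b‖| :=
          mul_le_mul_of_nonneg_left (le_abs_self _) (abs_nonneg _)
      _ = _ := by rw [← abs_mul]; congr 1; ring
  rw [abs_of_nonneg (a := |_| + |_|) (add_nonneg (abs_nonneg _) (abs_nonneg _)),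
    show √(q.1 : ℝ) * x = √(q.1 : ℝ) * (x - y) + √(q.1 : ℝ) * y by ring]
  exact (abs_add_le _ _).trans (add_le_add_left h7 _)

end Plugin

/-! ### From dominated continuous differentiability to smoothness in mean. -/

section Dominated

variable {p : ℕ} {ι : Type*} [Fintype ι] {P : Measure (Obs p)}

lemma DominatedC1.component {κ : Type*} [Fintype κ] {F : Obs p → (ι → ℝ) → (κ → ℝ)} {b : ι → ℝ}
    (h : DominatedC1 P F b) (k : κ) : DominatedC1 P (fun z b' => F z b' k) b := by
  obtain ⟨r, hr, H, hH, hb⟩ := h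
  refine ⟨r, hr, H, hH, ?_⟩
  filter_upwards [hb] with z ⟨h1, h2⟩
  refine ⟨contDiffOn_pi.1 h1 k, fun b' hb' => ?_⟩
  have hd : DifferentiableAt ℝ (F z) b' :=
    (h1.differentiableOn (by norm_num)).differentiableAt (Metric.isOpen_ball.mem_nhds hb')
  have h3 : fderiv ℝ (fun b' => F z b' k) b'
      = (ContinuousLinearMap.proj k : (κ → ℝ) →L[ℝ] ℝ).comp (fderiv ℝ (F z) b') :=
    (hasFDerivAt_pi'.1 hd.hasFDerivAt k).fderiv
  rw [h3]
  refine le_trans ?_ (h2 b' hb')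
  refine ContinuousLinearMap.opNorm_le_bound _ (norm_nonneg _) fun v => ?_
  exact (norm_le_pi_norm (fderiv ℝ (F z) b' v) k).trans ((fderiv ℝ (F z) b').le_opNorm v)

/-- Continuous differentiability with dominated derivatives on a common ball. -/
lemma DominatedC1.smoothMean {F : Obs p → (ι → ℝ) → ℝ} {b : ι → ℝ} (h : DominatedC1 P F b)
    (hm : ∀ b', AEStronglyMeasurable (fun z => F z b') P) :
    SmoothMean P (fun _ => 1) F b := by
  classical
  obtain ⟨r, hr, H, hH, hb⟩ := h
  have hdiff : ∀ᵐ z ∂P, ∀ b' ∈ Metric.ball b r, DifferentiableAt ℝ (F z) b' := by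
    filter_upwards [hb] with z ⟨h1, h2⟩ b' hb'
    exact (h1.differentiableOn (by norm_num)).differentiableAt (Metric.isOpen_ball.mem_nhds hb')
  refine ⟨hm, ⟨H, hH, hb.mono fun z hz => hz.2 b (Metric.mem_ball_self hr)⟩, fun ε hε => ?_⟩
  set d := TopologicalSpace.denseSeq (ι → ℝ)
  -- The oscillation of the derivative on a shrinking ball, taken over a countable dense set so as
  -- to be measurable in `z`. The `+ 2` makes every radius strictly smaller than `r`.
  set w : ℕ → Obs p → ENNReal := fun k z => ⨆ n : ℕ,
    if d n ∈ Metric.ball b (r / (k + 2)) then ‖fderiv ℝ (F z) (d n) - fderiv ℝ (F z) b‖ₑ else 0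
  have hrk (k : ℕ) : 0 < r / (k + 2 : ℝ) := by positivity
  have hrk' (k : ℕ) : r / (k + 2 : ℝ) < r := by
    rw [div_lt_iff₀ (by positivity)]
    nlinarith [(Nat.cast_nonneg k : (0 : ℝ) ≤ k)]
  have hwm (k : ℕ) : AEMeasurable (w k) P := by
    refine AEMeasurable.iSup fun n => ?_
    split_ifs with hn
    · have e1 := aestronglyMeasurable_fderiv (P := P) (b := d n) hm (by
        filter_upwards [hdiff] with z hz using hz _ (Metric.ball_subset_ball (hrk' k).le hn))
      have e2 := aestronglyMeasurable_fderiv (P := P) (b := b) hm (by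
        filter_upwards [hdiff] with z hz using hz _ (Metric.mem_ball_self hr))
      exact (e1.sub e2).enorm
    · exact aemeasurable_const
  have hwb (k : ℕ) : ∀ᵐ z ∂P, w k z ≤ ENNReal.ofReal (2 * H z) := by
    filter_upwards [hb] with z ⟨h1, h2⟩
    refine iSup_le fun n => ?_
    split_ifs with hn
    · rw [← ofReal_norm]
      refine ENNReal.ofReal_le_ofReal ((norm_sub_le _ _).trans ?_)
      have := h2 _ (Metric.ball_subset_ball (hrk' k).le hn)
      have := h2 b (Metric.mem_ball_self hr)
      linarith
    · exact zero_le
  have hcont : ∀ᵐ z ∂P, ContinuousOn (fderiv ℝ (F z)) (Metric.ball b r) := by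
    filter_upwards [hb] with z ⟨h1, h2⟩
    exact h1.continuousOn_fderiv_of_isOpen Metric.isOpen_ball (by norm_num)
  have hfin : ∫⁻ z, ENNReal.ofReal (2 * H z) ∂P ≠ ⊤ := by
    have := (hH.const_mul 2).lintegral_lt_top
    exact this.ne
  -- Dominated convergence: the oscillation is at most `2 H` and vanishes pointwise by continuity of
  -- the derivative at `b`.
  have hlim : Tendsto (fun k => ∫⁻ z, w k z ∂P) atTop (𝓝 0) := by
    have := tendsto_lintegral_of_dominated_convergence' (μ := P) (F := w) (f := fun _ => 0)
      (fun z => ENNReal.ofReal (2 * H z)) hwm hwb hfin ?_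
    · simpa using this
    · filter_upwards [hcont] with z hz
      rw [ENNReal.tendsto_nhds_zero]
      intro η hη
      have h1 : ContinuousAt (fun b' => ‖fderiv ℝ (F z) b' - fderiv ℝ (F z) b‖ₑ) b := by
        have := (hz.continuousAt (Metric.ball_mem_nhds b hr)).sub_const (fderiv ℝ (F z) b)
        exact this.enorm
      have h2 : ∀ᶠ b' in 𝓝 b, ‖fderiv ℝ (F z) b' - fderiv ℝ (F z) b‖ₑ < η := by
        refine h1.eventually_lt_const ?_
        have h0 : ‖(0 : (ι → ℝ) →L[ℝ] ℝ)‖ₑ = 0 := by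
          rw [← ofReal_norm, norm_zero, ENNReal.ofReal_zero]
        simp only [sub_self]
        rw [h0]
        exact hη
      obtain ⟨t, ht, h3⟩ := Metric.eventually_nhds_iff_ball.1 h2
      have h4 : Tendsto (fun k : ℕ => r / (k + 2 : ℝ)) atTop (𝓝 0) :=
        tendsto_const_nhds.div_atTop
          (tendsto_atTop_add_const_right _ _ tendsto_natCast_atTop_atTop)
      filter_upwards [h4.eventually (gt_mem_nhds ht)] with k hk
      refine iSup_le fun n => ?_
      split_ifs with hn
      · exact (h3 _ (Metric.ball_subset_ball hk.le hn)).le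
      · exact zero_le
  obtain ⟨k, hk⟩ := (hlim.eventually (gt_mem_nhds (ENNReal.ofReal_pos.2 hε))).exists
  have hkfin : ∫⁻ z, w k z ∂P ≠ ⊤ := hk.ne_top
  -- Halving the radius puts the closed condition on `b'` inside the open ball of the supremum.
  refine ⟨r / (k + 2) / 2, by have := hrk k; positivity, fun z => (w k z).toReal,
    integrable_toReal_of_lintegral_ne_top (hwm k) hkfin, ?_, ?_⟩
  · rw [integral_toReal (hwm k) (ae_lt_top' (hwm k) hkfin)]
    exact ENNReal.toReal_le_of_le_ofReal hε.le hk.le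
  · filter_upwards [hdiff, hcont, ae_lt_top' (hwm k) hkfin] with z h1 h2 h3 b' hb'
    have hb'' : b' ∈ Metric.ball b (r / (k + 2)) := by
      rw [Metric.mem_ball, dist_eq_norm]
      have := hrk k
      linarith
    have hsub := Metric.ball_subset_ball (x := b) (hrk' k).le
    refine ⟨h1 b' (hsub hb''), ?_⟩
    refine ENNReal.ofReal_le_iff_le_toReal h3.ne |>.1 ?_
    rw [ofReal_norm]
    have h4 : ContinuousAt (fun b' => ‖fderiv ℝ (F z) b' - fderiv ℝ (F z) b‖ₑ) b' :=
      ((h2.continuousAt (Metric.isOpen_ball.mem_nhds (hsub hb''))).sub_const _).enorm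
    -- If the bound failed at `b'`, it would fail by continuity on an open subset of the ball, hence
    -- at a point of the dense sequence.
    by_contra hc
    rw [not_le] at hc
    have h5 := (h4.eventually_const_lt hc).and (Metric.isOpen_ball.mem_nhds hb'')
    obtain ⟨U, hU, hUo, hbU⟩ := mem_nhds_iff.1 h5
    obtain ⟨n, hn⟩ := (TopologicalSpace.denseRange_denseSeq (ι → ℝ)).exists_mem_open hUo ⟨b', hbU⟩
    have h6 : w k z < ‖fderiv ℝ (F z) (d n) - fderiv ℝ (F z) b‖ₑ ∧
      dist (d n) b < r / (k + 2) := hU hn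
    refine absurd h6.1 (not_lt.2 ?_)
    refine le_trans ?_ (le_iSup _ n)
    exact (if_pos (Metric.mem_ball.2 h6.2)).ge

end Dominated

/-! ### The logistic function and its monotonicity. -/

section Logistic

/-- The logistic function. -/
noncomputable def expit (u : ℝ) : ℝ := Real.exp u / (1 + Real.exp u)

lemma expit_pos (u : ℝ) : 0 < expit u := by unfold expit; positivity

lemma one_sub_expit (u : ℝ) : 1 - expit u = 1 / (1 + Real.exp u) := by
  unfold expit
  have : 1 + Real.exp u ≠ 0 := by positivity
  field_simp
  ring

lemma expit_lt_one (u : ℝ) : expit u < 1 := by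
  have h := one_sub_expit u
  have : 0 < 1 / (1 + Real.exp u) := by positivity
  linarith

lemma contDiff_expit {n : ℕ∞} : ContDiff ℝ n expit :=
  Real.contDiff_exp.div (contDiff_const.add Real.contDiff_exp) fun u => by positivity

lemma hasDerivAt_expit (u : ℝ) : HasDerivAt expit (expit u * (1 - expit u)) u := by
  have h := (Real.hasDerivAt_exp u).div ((Real.hasDerivAt_exp u).const_add 1) (by positivity)
  refine h.congr_deriv ?_
  rw [one_sub_expit]
  unfold expit
  field_simp
  ring

lemma strictMono_expit : StrictMono expit :=
  strictMono_of_hasDerivAt_pos hasDerivAt_expit fun u =>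
    mul_pos (expit_pos u) (by linarith [expit_lt_one u])

/-- Quantitative monotonicity of the logistic function. -/
lemma expit_increment_mul (a s : ℝ) :
    expit a * (1 - expit a) * Real.exp (-2 * |s|) * s ^ 2 ≤ (expit (a + s) - expit a) * s := by
  -- The increment factors exactly. The factor `1 / (1 + e^(a+s))` and the factor `(e^s - 1) s` each
  -- lose at most `e^(-|s|)` against `1 - expit a` and `s²`.
  have e1 : (expit (a + s) - expit a) * s
      = expit a * (1 / (1 + Real.exp (a + s))) * ((Real.exp s - 1) * s) := by
    unfold expit
    have : 1 + Real.exp (a + s) ≠ 0 := by positivity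
    have : 1 + Real.exp a ≠ 0 := by positivity
    field_simp
    rw [Real.exp_add]; ring
  have e2 : (1 - expit a) * Real.exp (-|s|) ≤ 1 / (1 + Real.exp (a + s)) := by
    rw [one_sub_expit, Real.exp_neg, ← one_div, one_div_mul_one_div]
    refine one_div_le_one_div_of_le (by positivity) ?_
    have h1 : Real.exp (a + s) ≤ Real.exp a * Real.exp |s| := by
      rw [← Real.exp_add]; exact Real.exp_le_exp.2 (by linarith [le_abs_self s])
    have h2 : 1 ≤ Real.exp |s| := Real.one_le_exp (abs_nonneg s)
    linarith
  have e3 : Real.exp (-|s|) * s ^ 2 ≤ (Real.exp s - 1) * s := by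
    rcases le_total 0 s with h | h
    · rw [abs_of_nonneg h]
      have h1 : Real.exp (-s) ≤ 1 := Real.exp_le_one_iff.2 (by linarith)
      have h2 : s + 1 ≤ Real.exp s := Real.add_one_le_exp s
      nlinarith [sq_nonneg s]
    · rw [abs_of_nonpos h, neg_neg]
      have h1 : -s + 1 ≤ Real.exp (-s) := Real.add_one_le_exp (-s)
      have h2 : Real.exp s * Real.exp (-s) = 1 := by rw [← Real.exp_add]; simp
      have h3 : Real.exp s * (-s + 1) ≤ 1 := by
        exact (mul_le_mul_of_nonneg_left h1 (Real.exp_pos s).le).trans h2.le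
      nlinarith
  have e4 : Real.exp (-2 * |s|) = Real.exp (-|s|) * Real.exp (-|s|) := by
    rw [← Real.exp_add]; ring_nf
  have h1 := expit_pos a
  have h2 := expit_lt_one a
  rw [e1, e4]
  calc _ = expit a * ((1 - expit a) * Real.exp (-|s|)) * (Real.exp (-|s|) * s ^ 2) := by ring
    _ ≤ _ := by gcongr

/-- Monotonicity alone: going further in the same direction only enlarges the increment. A quadratic
bound at bounded distance therefore remains useful far away. -/
lemma expit_increment_scale (a s : ℝ) {R : ℝ} (hR : 1 ≤ R) :
    (expit (a + s) - expit a) * s ≤ (expit (a + R * s) - expit a) * s := by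
  rcases le_total 0 s with h | h
  · have : expit (a + s) ≤ expit (a + R * s) := strictMono_expit.monotone (by nlinarith)
    nlinarith
  · have : expit (a + R * s) ≤ expit (a + s) := strictMono_expit.monotone (by nlinarith)
    nlinarith

end Logistic

/-! ### Measurability, moments and second moment matrices of the covariates. -/

section Covariates

variable {p : ℕ} {P : Measure (Obs p)}

lemma ps_eq (x : Fin p → ℝ) (α : Fin (p + 1) → ℝ) : ps x α = expit (xt x ⬝ᵥ α) := rfl

lemma measurable_covar : Measurable (covar : Obs p → Fin p → ℝ) := measurable_fst

lemma measurable_trt : Measurable (trt : Obs p → ℝ) :=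
  Measurable.ite (measurableSet_eq_fun (by fun_prop) measurable_const)
    measurable_const measurable_const

lemma measurable_y1 : Measurable (y1 : Obs p → ℝ) := by unfold y1; fun_prop

lemma measurable_y0 : Measurable (y0 : Obs p → ℝ) := by unfold y0; fun_prop

lemma measurable_xt : Measurable (xt : (Fin p → ℝ) → _) :=
  measurable_pi_lambda _ fun i => by
    refine Fin.cases ?_ (fun i => ?_) i
    · simp [xt]
    · simpa [xt] using measurable_pi_apply i

lemma measurable_xt_dotProduct (α : Fin (p + 1) → ℝ) :
    Measurable (fun x : Fin p → ℝ => xt x ⬝ᵥ α) := by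
  unfold dotProduct
  have := measurable_xt (p := p)
  fun_prop

lemma measurable_ps : Measurable (Function.uncurry (ps (p := p))) := by
  unfold Function.uncurry ps dotProduct
  have h (i : Fin (p + 1)) : Measurable fun a : (Fin p → ℝ) × (Fin (p + 1) → ℝ) => xt a.1 i :=
    (measurable_pi_apply i).comp (measurable_xt.comp measurable_fst)
  fun_prop

lemma trt_eq_zero_or_one (z : Obs p) : trt z = 0 ∨ trt z = 1 := by
  unfold trt; split_ifs <;> simp

lemma abs_trt_le (z : Obs p) : |trt z| ≤ 1 := by
  rcases trt_eq_zero_or_one z with h | h <;> simp [h]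

lemma abs_one_sub_trt_le (z : Obs p) : |1 - trt z| ≤ 1 := by
  rcases trt_eq_zero_or_one z with h | h <;> simp [h]

/-- The weight `1 + ‖x‖`, an upper bound for the norm of `x̃`. -/
noncomputable def wt (z : Obs p) : ℝ := 1 + ‖covar z‖

lemma one_le_wt (z : Obs p) : 1 ≤ wt z := by unfold wt; linarith [norm_nonneg (covar z)]

lemma wt_nonneg (z : Obs p) : 0 ≤ wt z := zero_le_one.trans (one_le_wt z)

lemma measurable_wt : Measurable (wt : Obs p → ℝ) := measurable_const.add measurable_covar.norm

lemma abs_xt_le (z : Obs p) (k : Fin (p + 1)) : |xt (covar z) k| ≤ wt z := by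
  refine Fin.cases ?_ (fun i => ?_) k
  · simpa [xt] using one_le_wt z
  · simp only [xt, Fin.cons_succ]
    exact (norm_le_pi_norm (covar z) i).trans (by simp [wt])

lemma abs_xt_dotProduct_le (z : Obs p) (u : Fin (p + 1) → ℝ) :
    |xt (covar z) ⬝ᵥ u| ≤ (p + 1) * wt z * ‖u‖ := by
  unfold dotProduct
  refine (Finset.abs_sum_le_sum_abs _ _).trans ?_
  calc _ ≤ ∑ _i : Fin (p + 1), wt z * ‖u‖ := by
        refine Finset.sum_le_sum fun i _ => ?_
        rw [abs_mul]
        exact mul_le_mul (abs_xt_le z i) (norm_le_pi_norm u i) (abs_nonneg _) (wt_nonneg z)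
    _ = _ := by simp; ring

lemma memLp_wt [IsFiniteMeasure P] (h : MemLp (covar : Obs p → Fin p → ℝ) 2 P) :
    MemLp (wt : Obs p → ℝ) 2 P := by
  have h1 : MemLp (fun _ : Obs p => (1 : ℝ)) 2 P := memLp_const 1
  have h2 : MemLp (fun z : Obs p => ‖covar z‖) 2 P := h.norm
  exact h1.add h2

lemma memLp_xt [IsFiniteMeasure P] (h : MemLp (covar : Obs p → Fin p → ℝ) 2 P)
    (k : Fin (p + 1)) : MemLp (fun z : Obs p => xt (covar z) k) 2 P :=
  (memLp_wt h).mono' (((measurable_pi_apply k).comp (measurable_xt.comp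
    measurable_covar)).aestronglyMeasurable) (Eventually.of_forall fun z => abs_xt_le z k)

/-- Nonsingularity of `E(x̃ x̃ᵀ)` means that the components of `x̃` are linearly independent. -/
lemma eq_zero_of_ae_dotProduct_eq_zero [IsFiniteMeasure P]
    (hx : MemLp (covar : Obs p → Fin p → ℝ) 2 P)
    (h : IsUnit (Matrix.det (Matrix.of fun k l : Fin (p + 1) =>
      ∫ z, xt (covar z) k * xt (covar z) l ∂P))) {u : Fin (p + 1) → ℝ}
    (hu : ∀ᵐ z ∂P, xt (covar z) ⬝ᵥ u = 0) : u = 0 := by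
  by_contra hne
  refine h.ne_zero (Matrix.exists_mulVec_eq_zero_iff.1 ⟨u, hne, ?_⟩)
  ext k
  simp only [Matrix.mulVec, dotProduct, Matrix.of_apply, Pi.zero_apply]
  simp_rw [← integral_mul_const]
  rw [← integral_finsetSum]
  · refine integral_eq_zero_of_ae ?_
    filter_upwards [hu] with z hz
    simp only [mul_assoc, ← Finset.mul_sum, Pi.zero_apply]
    rw [show ∑ i, xt (covar z) i * u i = 0 from hz, mul_zero]
  · exact fun i _ => ((memLp_xt hx k).integrable_mul (memLp_xt hx i)).mul_const _

lemma integrable_weighted_dotProduct_sq [IsFiniteMeasure P]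
    (hx : MemLp (covar : Obs p → Fin p → ℝ) 2 P) {w : Obs p → ℝ} (hw : Measurable w)
    (hw1 : ∀ z, |w z| ≤ 1) (k l : Fin (p + 1)) :
    Integrable (fun z => w z * (xt (covar z) k * xt (covar z) l)) P :=
  ((memLp_xt hx k).integrable_mul (memLp_xt hx l)).bdd_mul (c := 1) hw.aestronglyMeasurable
    (Eventually.of_forall hw1)

lemma dotProduct_sq (x u : Fin (p + 1) → ℝ) :
    (x ⬝ᵥ u) ^ 2 = ∑ k, ∑ l, x k * x l * (u k * u l) := by
  unfold dotProduct
  rw [sq, Finset.sum_mul_sum]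
  exact Finset.sum_congr rfl fun k _ => Finset.sum_congr rfl fun l _ => by ring

lemma integral_weighted_dotProduct_sq [IsFiniteMeasure P]
    (hx : MemLp (covar : Obs p → Fin p → ℝ) 2 P) {w : Obs p → ℝ} (hw : Measurable w)
    (hw1 : ∀ z, |w z| ≤ 1) (u : Fin (p + 1) → ℝ) :
    Integrable (fun z => w z * (xt (covar z) ⬝ᵥ u) ^ 2) P ∧
    ∫ z, w z * (xt (covar z) ⬝ᵥ u) ^ 2 ∂P
      = ∑ k, ∑ l, (∫ z, w z * (xt (covar z) k * xt (covar z) l) ∂P) * (u k * u l) := by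
  have hi (k l) := (integrable_weighted_dotProduct_sq hx hw hw1 k l).mul_const (u k * u l)
  have e : (fun z => w z * (xt (covar z) ⬝ᵥ u) ^ 2)
      = fun z => ∑ k, ∑ l, w z * (xt (covar z) k * xt (covar z) l) * (u k * u l) := by
    funext z
    rw [dotProduct_sq, Finset.mul_sum]
    refine Finset.sum_congr rfl fun k _ => ?_
    rw [Finset.mul_sum]
    exact Finset.sum_congr rfl fun l _ => by ring
  rw [e]
  refine ⟨integrable_finsetSum _ fun k _ => integrable_finsetSum _ fun l _ => hi k l, ?_⟩
  rw [integral_finsetSum _ fun k _ => integrable_finsetSum _ fun l _ => hi k l]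
  refine Finset.sum_congr rfl fun k _ => ?_
  rw [integral_finsetSum _ fun l _ => hi k l]
  exact Finset.sum_congr rfl fun l _ => integral_mul_const _ _

/-- Weighted second moment matrices of `x̃` with positive weights are positive definite. -/
lemma eq_zero_of_integral_weighted_eq_zero [IsFiniteMeasure P]
    (hx : MemLp (covar : Obs p → Fin p → ℝ) 2 P)
    (h : IsUnit (Matrix.det (Matrix.of fun k l : Fin (p + 1) =>
      ∫ z, xt (covar z) k * xt (covar z) l ∂P)))
    {w : Obs p → ℝ} (hw : Measurable w) (hw0 : ∀ z, 0 < w z) (hw1 : ∀ z, w z ≤ 1)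
    {u : Fin (p + 1) → ℝ} (hu : ∫ z, w z * (xt (covar z) ⬝ᵥ u) ^ 2 ∂P = 0) : u = 0 := by
  have hi := (integral_weighted_dotProduct_sq hx hw
    (fun z => by rw [abs_of_pos (hw0 z)]; exact hw1 z) u).1
  have h1 := (integral_eq_zero_iff_of_nonneg
    (fun z => mul_nonneg (hw0 z).le (sq_nonneg _)) hi).1 hu
  refine eq_zero_of_ae_dotProduct_eq_zero hx h ?_
  filter_upwards [h1] with z hz
  rcases mul_eq_zero.1 hz with h2 | h2
  · exact absurd h2 (hw0 z).ne'
  · exact pow_eq_zero_iff (two_ne_zero) |>.1 h2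

end Covariates

/-! ### Root-`n` consistency of the logistic maximum likelihood estimator. -/

section MLE

variable {p : ℕ} {P : Measure (Obs p)} {Ω : Type*} [MeasurableSpace Ω] {μ : Measure Ω}
  {Z : ℕ → Ω → Obs p}

/-- A maximum likelihood estimate of the logistic model solves the score equations. -/
lemma IsMLE.score_eq {n : ℕ} {z : ℕ → Obs p} {α : Fin (p + 1) → ℝ} (h : IsMLE n z α)
    (k : Fin (p + 1)) :
    ∑ j ∈ Finset.range n, (trt (z j) - ps (covar (z j)) α) * xt (covar (z j)) k = 0 := by
  set g : Obs p → ℝ → ℝ := fun y t =>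
    trt y * (xt (covar y) ⬝ᵥ α + t * xt (covar y) k)
      - Real.log (1 + Real.exp (xt (covar y) ⬝ᵥ α + t * xt (covar y) k)) with hg
  have hlin (y : Obs p) (t : ℝ) : xt (covar y) ⬝ᵥ (α + t • Pi.single k 1)
      = xt (covar y) ⬝ᵥ α + t * xt (covar y) k := by
    rw [dotProduct_add, dotProduct_smul, dotProduct_single, mul_one, smul_eq_mul]
  -- Along a coordinate line the likelihood is the exponential of a sum of differentiable functions,
  -- so its maximum at `t = 0` makes the derivative of the sum vanish. That derivative is the score.
  have hexp (t : ℝ) : likelihood n z (α + t • Pi.single k 1)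
      = Real.exp (∑ j ∈ Finset.range n, g (z j) t) := by
    rw [Real.exp_sum]
    refine Finset.prod_congr rfl fun j _ => ?_
    simp only [hg, ps, hlin, trt]
    set v := xt (covar (z j)) ⬝ᵥ α + t * xt (covar (z j)) k
    have h1 : 0 < 1 + Real.exp v := by positivity
    split_ifs with hT
    · rw [one_mul, Real.exp_sub, Real.exp_log h1]
    · rw [zero_mul, zero_sub, Real.exp_neg, Real.exp_log h1]
      field_simp
      ring
  have hmax : IsLocalMax (fun t => ∑ j ∈ Finset.range n, g (z j) t) 0 := by
    refine Eventually.of_forall fun t => ?_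
    have h1 := h (mem_univ (α + t • Pi.single k 1))
    have h2 := hexp 0
    rw [zero_smul, add_zero] at h2
    simp only [mem_ofPred_eq, hexp, h2] at h1
    exact Real.exp_le_exp.1 h1
  have hd (y : Obs p) : HasDerivAt (g y)
      ((trt y - ps (covar y) α) * xt (covar y) k) 0 := by
    have h1 : HasDerivAt (fun t : ℝ => xt (covar y) ⬝ᵥ α + t * xt (covar y) k)
        (xt (covar y) k) 0 := by
      simpa using ((hasDerivAt_id (0 : ℝ)).mul_const (xt (covar y) k)).const_add
        (xt (covar y) ⬝ᵥ α)
    have h2 := (h1.const_mul (trt y)).sub ((h1.exp.const_add 1).log (by positivity))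
    refine h2.congr_deriv ?_
    simp only [ps, zero_mul, add_zero]
    ring
  exact hmax.hasDerivAt_eq_zero (HasDerivAt.fun_sum fun j _ => hd (z j))

/-- Empirical weighted second moment matrices of `x̃` with positive weights are uniformly positive
definite, with probability tending to one. -/
lemma eventually_quadratic_lower_bound [IsProbabilityMeasure μ] [IsProbabilityMeasure P]
    (hZ : IsSample P μ Z) (hx : MemLp (covar : Obs p → Fin p → ℝ) 2 P)
    (hns : IsUnit (Matrix.det (Matrix.of fun k l : Fin (p + 1) =>
      ∫ z, xt (covar z) k * xt (covar z) l ∂P)))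
    {w : Obs p → ℝ} (hwm : Measurable w) (hw0 : ∀ z, 0 < w z) (hw1 : ∀ z, w z ≤ 1) :
    ∃ c > 0, ∀ᶠ q in inProb μ, ∀ u : Fin (p + 1) → ℝ, ‖u‖ = 1 →
      c ≤ smean Z q (fun z => w z * (xt (covar z) ⬝ᵥ u) ^ 2) := by
  have hw1' (z : Obs p) : |w z| ≤ 1 := by rw [abs_of_pos (hw0 z)]; exact hw1 z
  set M : Fin (p + 1) → Fin (p + 1) → ℝ :=
    fun k l => ∫ z, w z * (xt (covar z) k * xt (covar z) l) ∂P with hM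
  set Q : (Fin (p + 1) → ℝ) → ℝ := fun u => ∑ k, ∑ l, M k l * (u k * u l) with hQ
  have hQint (u) : ∫ z, w z * (xt (covar z) ⬝ᵥ u) ^ 2 ∂P = Q u :=
    (integral_weighted_dotProduct_sq hx hwm hw1' u).2
  have hQpos (u : Fin (p + 1) → ℝ) (hu : u ≠ 0) : 0 < Q u := by
    rw [← hQint]
    refine lt_of_le_of_ne (integral_nonneg fun z => mul_nonneg (hw0 z).le (sq_nonneg _)) ?_
    exact fun h => hu (eq_zero_of_integral_weighted_eq_zero hx hns hwm hw0 hw1 h.symm)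
  -- The population form is positive on the compact unit sphere, so it has a positive minimum there.
  -- Half of it survives for the empirical form once the entries of the two matrices are close, as
  -- the products `u k * u l` are at most one in absolute value.
  obtain ⟨u₀, hu₀, hmin⟩ := (isCompact_sphere (0 : Fin (p + 1) → ℝ) 1).exists_isMinOn
    (NormedSpace.sphere_nonempty.2 zero_le_one) (f := Q)
    (by simp only [hQ]; fun_prop : Continuous Q).continuousOn
  have hu₀' : u₀ ≠ 0 := by
    rintro rfl
    simp at hu₀
  have hcpos : 0 < Q u₀ := hQpos u₀ hu₀'
  have hMn : Tendsto (fun q => ∑ k, ∑ l,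
      |smean Z q (fun z => w z * (xt (covar z) k * xt (covar z) l)) - M k l|)
      (inProb μ) (𝓝 0) := by
    rw [show (0 : ℝ) = ∑ k : Fin (p + 1), ∑ l : Fin (p + 1), |(0 : ℝ)| by simp]
    refine tendsto_finsetSum _ fun k _ => tendsto_finsetSum _ fun l _ => Tendsto.abs ?_
    rw [← sub_self (M k l)]
    exact (hZ.tendsto_smean (integrable_weighted_dotProduct_sq hx hwm hw1' k l)).sub_const (M k l)
  refine ⟨Q u₀ / 2, half_pos hcpos, ?_⟩
  filter_upwards [hMn.eventually (gt_mem_nhds (half_pos hcpos))] with q h2 u hu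
  have e : smean Z q (fun z => w z * (xt (covar z) ⬝ᵥ u) ^ 2) = ∑ k, ∑ l,
      smean Z q (fun z => w z * (xt (covar z) k * xt (covar z) l)) * (u k * u l) := by
    rw [show (fun z : Obs p => w z * (xt (covar z) ⬝ᵥ u) ^ 2) = fun z => ∑ k, ∑ l,
      w z * (xt (covar z) k * xt (covar z) l) * (u k * u l) by
        funext z
        rw [dotProduct_sq, Finset.mul_sum]
        refine Finset.sum_congr rfl fun k _ => ?_
        rw [Finset.mul_sum]
        exact Finset.sum_congr rfl fun l _ => by ring, smean_sum]
    refine Finset.sum_congr rfl fun k _ => ?_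
    rw [smean_sum]
    exact Finset.sum_congr rfl fun l _ => smean_mul_const _ _
  have h5 : |smean Z q (fun z => w z * (xt (covar z) ⬝ᵥ u) ^ 2) - Q u| ≤ Q u₀ / 2 := by
    refine le_trans ?_ h2.le
    rw [e]
    simp only [hQ]
    rw [← Finset.sum_sub_distrib]
    refine (Finset.abs_sum_le_sum_abs _ _).trans (Finset.sum_le_sum fun k _ => ?_)
    rw [← Finset.sum_sub_distrib]
    refine (Finset.abs_sum_le_sum_abs _ _).trans (Finset.sum_le_sum fun l _ => ?_)
    rw [← sub_mul, abs_mul, abs_mul (u k)]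
    have hk : |u k| ≤ 1 := hu ▸ norm_le_pi_norm u k
    have hl : |u l| ≤ 1 := hu ▸ norm_le_pi_norm u l
    exact mul_le_of_le_one_right (abs_nonneg _) (mul_le_one₀ hk (abs_nonneg _) hl)
  have h6 : Q u₀ ≤ Q u := hmin (by simpa using hu)
  rw [abs_le] at h5
  linarith

/-- Lower bound for the increment of the expected score along a direction `u`. -/
lemma increment_lower_bound {c₁ c₂ a s R B : ℝ} (hc₁ : 0 < c₁) (hc₂ : c₂ < 1)
    (h1 : c₁ ≤ expit a) (h2 : expit a ≤ c₂) (hR : 0 < R) (hs : |s| ≤ B) :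
    (c₁ * (1 - c₂) * min 1 R) * (Real.exp (-2 * B) * s ^ 2)
      ≤ (expit (a + R * s) - expit a) * s := by
  -- The quantitative bound is used at `r s`, where the exponential loss is at most that for `B`.
  -- Monotonicity then stretches by `R / r ≥ 1` to reach `R s`.
  set r := min 1 R with hr
  have hr0 : 0 < r := lt_min one_pos hR
  have hr1 : r ≤ 1 := min_le_left _ _
  have e4 := expit_increment_mul a (r * s)
  have e5 := expit_increment_scale a (r * s) (R := R / r)
    ((one_le_div hr0).2 (min_le_right _ _))
  rw [show R / r * (r * s) = R * s by field_simp] at e5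
  have hwle : Real.exp (-2 * B) ≤ Real.exp (-2 * |r * s|) := by
    refine Real.exp_le_exp.2 ?_
    have h8 : |r * s| ≤ |s| := by
      rw [abs_mul, abs_of_pos hr0]
      exact mul_le_of_le_one_left (abs_nonneg _) hr1
    linarith
  have hκle : c₁ * (1 - c₂) ≤ expit a * (1 - expit a) :=
    mul_le_mul h1 (by linarith) (by linarith) (expit_pos a).le
  have h0 : 0 < c₁ * (1 - c₂) := mul_pos hc₁ (by linarith)
  have h10 : 0 ≤ expit a * (1 - expit a) := h0.le.trans hκle
  have h9 : c₁ * (1 - c₂) * Real.exp (-2 * B) * (r * s) ^ 2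
      ≤ (expit (a + R * s) - expit a) * (r * s) := by
    refine le_trans ?_ (e4.trans e5)
    gcongr
  have h11 : r * (c₁ * (1 - c₂) * r * (Real.exp (-2 * B) * s ^ 2))
      ≤ r * ((expit (a + R * s) - expit a) * s) := by linarith [h9]
  exact le_of_mul_le_mul_left h11 hr0

omit [MeasurableSpace Ω] in
-- In the direction `u` from `α` to `αh` the average increment of the propensity scores, weighted by
-- `x̃ᵀu`, is at least a constant times `min 1 R`, with `R` the distance. It is also at most the
-- size of the score at `α`. A small score rules out `R ≥ 1`, so one inequality gives consistency
-- and rate together.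
lemma IsMLE.norm_sub_le {q : ℕ × Ω} {α αh : Fin (p + 1) → ℝ} {c c₁ c₂ : ℝ}
    (hmle : IsMLE q.1 (fun j => Z j q.2) αh) (hc₁ : 0 < c₁) (hc₂ : c₂ < 1)
    (hov : ∀ j, c₁ ≤ ps (covar (Z j q.2)) α ∧ ps (covar (Z j q.2)) α ≤ c₂)
    (hlow : ∀ u : Fin (p + 1) → ℝ, ‖u‖ = 1 → c ≤ smean Z q
      (fun z => Real.exp (-2 * ((p + 1) * wt z)) * (xt (covar z) ⬝ᵥ u) ^ 2))
    (hsmall : ∑ k, |smean Z q (fun z => xt (covar z) k * (trt z - ps (covar z) α))|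
      < c₁ * (1 - c₂) * c) :
    c₁ * (1 - c₂) * c * ‖αh - α‖
      ≤ ∑ k, |smean Z q (fun z => xt (covar z) k * (trt z - ps (covar z) α))| := by
  have hκ0 : 0 < c₁ * (1 - c₂) := mul_pos hc₁ (by linarith)
  rcases eq_or_ne αh α with h0 | h0
  · rw [h0, sub_self, norm_zero, mul_zero]
    exact Finset.sum_nonneg fun k _ => abs_nonneg _
  set R := ‖αh - α‖ with hR
  have hR0 : 0 < R := norm_pos_iff.2 (sub_ne_zero.2 h0)
  set u : Fin (p + 1) → ℝ := R⁻¹ • (αh - α) with hu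
  have hu1 : ‖u‖ = 1 := by
    rw [hu, norm_smul, norm_inv, Real.norm_of_nonneg hR0.le, inv_mul_cancel₀ hR0.ne']
  have hαh : αh = α + R • u := by
    rw [hu, smul_smul, mul_inv_cancel₀ hR0.ne', one_smul, add_sub_cancel]
  set S : Fin (p + 1) → ℝ :=
    fun k => smean Z q (fun z => xt (covar z) k * (trt z - ps (covar z) α)) with hS
  -- Subtracting the score equations at `αh` turns the score at `α` into an increment and removes
  -- `T`.
  have hscore : ∑ k, u k * S k = smean Z q (fun z =>
      (ps (covar z) αh - ps (covar z) α) * (xt (covar z) ⬝ᵥ u)) := by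
    have e1 (k) : smean Z q (fun z => (trt z - ps (covar z) αh) * xt (covar z) k) = 0 := by
      simp only [smean]
      rw [hmle.score_eq k, mul_zero]
    have e2 (k) : u k * S k = smean Z q (fun z => u k *
        ((ps (covar z) αh - ps (covar z) α) * xt (covar z) k)) := by
      rw [smean_const_mul, ← sub_zero (S k), ← e1 k, hS, ← smean_sub]
      congr 2
      funext z
      ring
    rw [Finset.sum_congr rfl fun k _ => e2 k, ← smean_sum]
    congr 1
    funext z
    unfold dotProduct
    rw [Finset.mul_sum]
    exact Finset.sum_congr rfl fun k _ => by ring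
  have hup : ∑ k, u k * S k ≤ ∑ k, |S k| := by
    refine Finset.sum_le_sum fun k _ => (le_abs_self _).trans ?_
    rw [abs_mul]
    exact mul_le_of_le_one_left (abs_nonneg _) (hu1 ▸ norm_le_pi_norm u k)
  have hmin1 : c₁ * (1 - c₂) * c * min 1 R ≤ ∑ k, |S k| := by
    refine le_trans ?_ (hscore ▸ hup)
    calc c₁ * (1 - c₂) * c * min 1 R
        ≤ (c₁ * (1 - c₂) * min 1 R) * smean Z q
            (fun z => Real.exp (-2 * ((p + 1) * wt z)) * (xt (covar z) ⬝ᵥ u) ^ 2) := by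
          rw [mul_right_comm]
          exact mul_le_mul_of_nonneg_left (hlow u hu1) (by positivity)
      _ = _ := (smean_const_mul _ _).symm
      _ ≤ _ := by
        refine smean_mono fun j hj => ?_
        obtain ⟨h6, h7⟩ := hov j
        have e3 : ps (covar (Z j q.2)) αh
            = expit (xt (covar (Z j q.2)) ⬝ᵥ α + R * (xt (covar (Z j q.2)) ⬝ᵥ u)) := by
          rw [ps_eq, hαh, dotProduct_add, dotProduct_smul, smul_eq_mul]
        rw [e3]
        refine increment_lower_bound hc₁ hc₂ h6 h7 hR0 ?_
        have := abs_xt_dotProduct_le (Z j q.2) u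
        rwa [hu1, mul_one] at this
  rcases le_total R 1 with h5 | h5
  · rwa [min_eq_right h5] at hmin1
  · rw [min_eq_left h5, mul_one] at hmin1
    exact absurd hsmall (not_lt.2 hmin1)

lemma measurable_ps_covar (α : Fin (p + 1) → ℝ) : Measurable (fun z : Obs p => ps (covar z) α) := by
  have h : Measurable (fun z : Obs p => xt (covar z) ⬝ᵥ α) :=
    (measurable_xt_dotProduct α).comp measurable_covar
  unfold ps
  fun_prop

lemma memLp_score [IsFiniteMeasure P] (hx : MemLp (covar : Obs p → Fin p → ℝ) 2 P)
    (α : Fin (p + 1) → ℝ) (k : Fin (p + 1)) :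
    MemLp (fun z : Obs p => xt (covar z) k * (trt z - ps (covar z) α)) 2 P := by
  refine (memLp_wt hx).mono' ?_ (Eventually.of_forall fun z => ?_)
  · exact (((measurable_pi_apply k).comp (measurable_xt.comp measurable_covar)).mul
      (measurable_trt.sub (measurable_ps_covar α))).aestronglyMeasurable
  · rw [Real.norm_eq_abs, abs_mul]
    refine (mul_le_of_le_one_right (abs_nonneg _) ?_).trans (abs_xt_le z k)
    have h1 := expit_pos (xt (covar z) ⬝ᵥ α)
    have h2 := expit_lt_one (xt (covar z) ⬝ᵥ α)
    rw [ps_eq, abs_le]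
    rcases trt_eq_zero_or_one z with h | h <;> rw [h] <;> constructor <;> linarith

/-- Root-`n` consistency of the maximum likelihood estimator in the logistic working model. -/
lemma op_sqrt_mle [IsProbabilityMeasure μ] [IsProbabilityMeasure P] (hZ : IsSample P μ Z)
    (hx : MemLp (covar : Obs p → Fin p → ℝ) 2 P)
    (hns : IsUnit (Matrix.det (Matrix.of fun k l : Fin (p + 1) =>
      ∫ z, xt (covar z) k * xt (covar z) l ∂P)))
    {α : Fin (p + 1) → ℝ} (hα : IsPopScoreRoot P α)
    (hov : ∃ c₁ c₂ : ℝ, 0 < c₁ ∧ c₂ < 1 ∧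
      ∀ᵐ z ∂P, c₁ ≤ ps (covar z) α ∧ ps (covar z) α ≤ c₂)
    {αh : ℕ × Ω → Fin (p + 1) → ℝ}
    (hmle : ∀ᶠ q in inProb μ, IsMLE q.1 (fun j => Z j q.2) (αh q)) :
    OP μ (fun q => √(q.1 : ℝ) * ‖αh q - α‖) := by
  obtain ⟨c₁, c₂, hc₁, hc₂, hov⟩ := hov
  -- This weight is the exponential loss for `|x̃ᵀu| ≤ (p + 1) wt` with `‖u‖ = 1`. It is positive
  -- and at most one, so second moments of `x` suffice.
  obtain ⟨c, hc, hlow⟩ := eventually_quadratic_lower_bound hZ hx hns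
    (w := fun z => Real.exp (-2 * ((p + 1) * wt z)))
    (by have := measurable_wt (p := p); fun_prop) (fun z => Real.exp_pos _)
    (fun z => Real.exp_le_one_iff.2 (by
      have := wt_nonneg z
      have : 0 ≤ (p + 1 : ℝ) * wt z := by positivity
      linarith))
  set S : Fin (p + 1) → ℕ × Ω → ℝ :=
    fun k q => smean Z q (fun z => xt (covar z) k * (trt z - ps (covar z) α)) with hS
  have hSop (k) : OP μ (fun q => √(q.1 : ℝ) * S k q) :=
    hZ.op_sqrt_smean (memLp_score hx α k) (hα k)
  have hpos : 0 < c₁ * (1 - c₂) * c := mul_pos (mul_pos hc₁ (by linarith)) hc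
  have hS0 : Tendsto (fun q => ∑ k, |S k q|) (inProb μ) (𝓝 0) := by
    rw [show (0 : ℝ) = ∑ k : Fin (p + 1), |(0 : ℝ)| by simp]
    refine tendsto_finsetSum _ fun k _ => Tendsto.abs ?_
    have := hZ.tendsto_smean ((memLp_score hx α k).integrable (by simp))
    rwa [hα k] at this
  have hsum : OP μ (fun q => (c₁ * (1 - c₂) * c)⁻¹ * ∑ k, |√(q.1 : ℝ) * S k q|) :=
    (OP.const _).mul (OP.sum _ fun k _ => (hSop k).abs)
  refine hsum.mono ?_
  filter_upwards [hmle, hlow, hZ.eventually hov, hS0.eventually (gt_mem_nhds hpos)]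
    with q h1 h2 h3 h4
  have hq := h1.norm_sub_le hc₁ hc₂ h3 h2 h4
  rw [abs_of_nonneg (by positivity), abs_of_nonneg
    (mul_nonneg (inv_nonneg.2 hpos.le) (Finset.sum_nonneg fun k _ => abs_nonneg _))]
  simp only [abs_mul, abs_of_nonneg (Real.sqrt_nonneg (q.1 : ℝ)), ← Finset.mul_sum]
  rw [mul_left_comm]
  gcongr
  rw [le_inv_mul_iff₀ hpos]
  exact hq

end MLE

/-! ### Roots of estimating equations with a consistent estimator. -/

section ZEstimator

variable {𝓩 Ω : Type*} [MeasurableSpace 𝓩] [MeasurableSpace Ω] {ι : Type*} [Fintype ι]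
  [DecidableEq ι] {P : Measure 𝓩} {μ : Measure Ω} {Z : ℕ → Ω → 𝓩} {s : 𝓩 → ℝ}
  {F : 𝓩 → (ι → ℝ) → (ι → ℝ)} {b : ι → ℝ} {bh : ℕ × Ω → ι → ℝ}

/-- The empty event does not have probability tending to one. This makes limits in probability
unique. -/
instance inProb_neBot [IsProbabilityMeasure μ] : (inProb μ).NeBot := by
  refine ⟨fun h => ?_⟩
  have h1 : ∀ᶠ _ in inProb μ, False := by rw [h]; trivial
  rw [eventually_inProb] at h1
  simp only [not_false_eq_true] at h1
  have h2 : μ {_ω : Ω | True} = 1 := by simp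
  rw [h2] at h1
  exact one_ne_zero (tendsto_nhds_unique tendsto_const_nhds h1)

lemma jacobian_apply {f : (ι → ℝ) → (ι → ℝ)} (h : DifferentiableAt ℝ f b) (k l : ι) :
    jacobian f b k l = fderiv ℝ (fun b' => f b' k) b (Pi.single l 1) := by
  rw [(hasFDerivAt_pi'.1 h.hasFDerivAt k).fderiv]
  rfl

lemma norm_le_of_isUnit_det {A : Matrix ι ι ℝ} (hA : IsUnit A.det) :
    ∃ K > 0, ∀ d : ι → ℝ, ‖d‖ ≤ K * ∑ k, |(A.mulVec d) k| := by
  refine ⟨1 + ∑ i, ∑ k, |A⁻¹ i k|, by positivity, fun d => ?_⟩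
  have h1 : d = A⁻¹.mulVec (A.mulVec d) := by
    rw [Matrix.mulVec_mulVec, Matrix.nonsing_inv_mul _ hA, Matrix.one_mulVec]
  refine (pi_norm_le_iff_of_nonneg (by positivity)).2 fun i => ?_
  conv_lhs => rw [h1]
  set e := A.mulVec d
  simp only [Matrix.mulVec, dotProduct]
  rw [Real.norm_eq_abs]
  refine (Finset.abs_sum_le_sum_abs _ _).trans ?_
  rw [Finset.mul_sum]
  refine Finset.sum_le_sum fun k _ => ?_
  rw [abs_mul]
  gcongr
  have h2 : |A⁻¹ i k| ≤ ∑ k, |A⁻¹ i k| :=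
    Finset.single_le_sum (f := fun k => |A⁻¹ i k|) (fun _ _ => abs_nonneg _) (Finset.mem_univ k)
  have h3 : ∑ k, |A⁻¹ i k| ≤ ∑ i, ∑ k, |A⁻¹ i k| :=
    Finset.single_le_sum (f := fun i => ∑ k, |A⁻¹ i k|) (fun _ _ => by positivity)
      (Finset.mem_univ i)
  linarith

/-- The limit of the roots of estimating equations solves the population equations. -/
lemma integral_eq_zero_of_root [IsProbabilityMeasure μ]
    (hF : ∀ k, SmoothMean P s (fun z b' => F z b' k) b) (hs : ∀ z, 0 ≤ s z) (hZ : IsSample P μ Z)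
    (hb : Localized μ Z s bh b) (ht : Tendsto bh (inProb μ) (𝓝 b))
    (hint : ∀ k, Integrable (fun z => F z b k) P)
    (hroot : ∀ᶠ q in inProb μ, ∑ j ∈ Finset.range q.1, F (Z j q.2) (bh q) = 0) (k : ι) :
    ∫ z, F z b k ∂P = 0 := by
  obtain ⟨R, hR, hexp⟩ := (hF k).expansion hs hZ hb
  have h1 := hZ.tendsto_smean (hint k)
  have h2 : Tendsto (fun q => R q * ‖bh q - b‖) (inProb μ) (𝓝 0) := by
    simpa using hR.mul (tendsto_iff_norm_sub_tendsto_zero.1 ht)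
  have h3 : Tendsto (fun q => ∑ i, (∫ z, fderiv ℝ (fun b' => F z b' k) b (Pi.single i 1) ∂P)
      * (bh q i - b i)) (inProb μ) (𝓝 0) := by
    rw [show (0 : ℝ) = ∑ i : ι, (∫ z, fderiv ℝ (fun b' => F z b' k) b (Pi.single i 1) ∂P)
      * (b i - b i) by simp]
    exact tendsto_finsetSum _ fun i _ => (((tendsto_pi_nhds.1 ht i).sub_const _).const_mul _)
  -- Since the plugged-in mean vanishes, the expansion forces the sample mean at `b` to zero. By the
  -- law of large numbers it also tends to the integral.
  have h4 := (squeeze_zero_norm (fun q => hexp q) h2).add h3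
  have h5 : Tendsto (fun q => - smean Z q (fun z => F z b k)) (inProb μ) (𝓝 0) := by
    rw [add_zero] at h4
    refine h4.congr' ?_
    filter_upwards [hroot] with q hq
    have h6 : smean Z q (fun z => F z (bh q) k) = 0 := by
      have := congrFun hq k
      rw [Finset.sum_apply, Pi.zero_apply] at this
      simp only [smean]
      rw [this, mul_zero]
    rw [h6]; ring
  simpa using tendsto_nhds_unique h1.neg h5

/-- Root-`n` consistency of consistent roots of estimating equations. -/
lemma op_sqrt_root [IsProbabilityMeasure μ]
    (hF : ∀ k, SmoothMean P s (fun z b' => F z b' k) b) (hs : ∀ z, 0 ≤ s z) (hZ : IsSample P μ Z)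
    (hb : Localized μ Z s bh b) (h2 : ∀ k, MemLp (fun z => F z b k) 2 P)
    (h0 : ∀ k, ∫ z, F z b k ∂P = 0)
    (hA : IsUnit (Matrix.det (Matrix.of fun k l =>
      ∫ z, fderiv ℝ (fun b' => F z b' k) b (Pi.single l 1) ∂P)))
    (hroot : ∀ᶠ q in inProb μ, ∑ j ∈ Finset.range q.1, F (Z j q.2) (bh q) = 0) :
    OP μ (fun q => √(q.1 : ℝ) * ‖bh q - b‖) := by
  obtain ⟨K, hK, hinv⟩ := norm_le_of_isUnit_det hA
  choose R hR hexp using fun k => (hF k).expansion hs hZ hb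
  have hRs : Tendsto (fun q => ∑ k, R k q) (inProb μ) (𝓝 0) := by
    rw [show (0 : ℝ) = ∑ k : ι, (0 : ℝ) by simp]
    exact tendsto_finsetSum _ fun k _ => hR k
  have hsum : OP μ (fun q => (2 * K) * ∑ k, |√(q.1 : ℝ) * smean Z q (fun z => F z b k)|) :=
    (OP.const _).mul (OP.sum _ fun k _ => (hZ.op_sqrt_smean (h2 k) (h0 k)).abs)
  refine hsum.mono ?_
  -- The threshold `1 / (2 K)` makes the remainder at most half of `‖bh q - b‖`, which is absorbed
  -- on the left. This produces the factor `2 K`.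
  filter_upwards [hroot, hRs.eventually (gt_mem_nhds (by positivity : 0 < 1 / (2 * K)))]
    with q h1 h3
  have h4 (k : ι) : smean Z q (fun z => F z (bh q) k) = 0 := by
    have := congrFun h1 k
    rw [Finset.sum_apply, Pi.zero_apply] at this
    simp only [smean]
    rw [this, mul_zero]
  have h5 := hinv (bh q - b)
  have h6 : ∑ k, |((Matrix.of fun k l =>
      ∫ z, fderiv ℝ (fun b' => F z b' k) b (Pi.single l 1) ∂P).mulVec (bh q - b)) k|
      ≤ ∑ k, |smean Z q (fun z => F z b k)| + (∑ k, R k q) * ‖bh q - b‖ := by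
    rw [Finset.sum_mul, ← Finset.sum_add_distrib]
    refine Finset.sum_le_sum fun k _ => ?_
    have h7 := hexp k q
    rw [h4 k, zero_sub] at h7
    have h8 : ((Matrix.of fun k l =>
      ∫ z, fderiv ℝ (fun b' => F z b' k) b (Pi.single l 1) ∂P).mulVec (bh q - b)) k
      = ∑ i, (∫ z, fderiv ℝ (fun b' => F z b' k) b (Pi.single i 1) ∂P) * (bh q i - b i) := rfl
    rw [h8]
    set x := ∑ i, (∫ z, fderiv ℝ (fun b' => F z b' k) b (Pi.single i 1) ∂P) * (bh q i - b i)
    set y := smean Z q (fun z => F z b k)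
    have h9 : |x| ≤ |y| + |-y - x| := by
      have := abs_sub (-y) (-y - x)
      rwa [sub_sub_cancel, abs_neg] at this
    linarith
  have h7 : (∑ k, R k q) * ‖bh q - b‖ ≤ 1 / (2 * K) * ‖bh q - b‖ := by gcongr
  have h8 : ‖bh q - b‖ ≤ K * (∑ k, |smean Z q (fun z => F z b k)| + 1 / (2 * K) * ‖bh q - b‖) := by
    refine h5.trans ?_
    gcongr
    linarith
  have h9 : K * (1 / (2 * K) * ‖bh q - b‖) = ‖bh q - b‖ / 2 := by field_simp
  rw [mul_add, h9] at h8
  rw [abs_of_nonneg (by positivity), abs_of_nonneg (by positivity)]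
  simp only [abs_mul, abs_of_nonneg (Real.sqrt_nonneg (q.1 : ℝ)), ← Finset.mul_sum]
  rw [mul_left_comm]
  gcongr
  linarith

end ZEstimator

/-! ### Components of the stacked estimating function: moments and smoothness. -/

section EstimatingFunction

variable {p q₁ q₀ : ℕ} {P : Measure (Obs p)} {M₁ : OutcomeModel p q₁} {M₀ : OutcomeModel p q₀}

lemma OutcomeModel.measurable_m_covar {q : ℕ} (M : OutcomeModel p q) (β : Fin q → ℝ) :
    Measurable (fun z : Obs p => M.m (covar z) β) :=
  M.measurable_m.comp (measurable_covar.prodMk measurable_const)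

lemma OutcomeModel.measurable_a_covar {q : ℕ} (M : OutcomeModel p q) (β : Fin q → ℝ) :
    Measurable (fun z : Obs p => M.a (covar z) β) :=
  M.measurable_a.comp (measurable_covar.prodMk measurable_const)

lemma measurable_g1 {q : ℕ} (M : OutcomeModel p q) (β : Fin q → ℝ) :
    Measurable (fun z : Obs p => g1 M z β) :=
  (measurable_trt.mul (measurable_y1.sub (M.measurable_m_covar β))).smul (M.measurable_a_covar β)

lemma measurable_g0 {q : ℕ} (M : OutcomeModel p q) (β : Fin q → ℝ) :
    Measurable (fun z : Obs p => g0 M z β) :=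
  ((measurable_const.sub measurable_trt).mul
    (measurable_y0.sub (M.measurable_m_covar β))).smul (M.measurable_a_covar β)

/-- The linear predictor of the propensity score model as a function of the stacked parameter. -/
noncomputable def linPred (z : Obs p) : Param p q₁ q₀ →L[ℝ] ℝ :=
  ∑ k, xt (covar z) k • ContinuousLinearMap.proj (Sum.inr (Sum.inl k))

lemma linPred_apply (z : Obs p) (ψ : Param p q₁ q₀) :
    linPred z ψ = xt (covar z) ⬝ᵥ ψ.alpha := by
  simp [linPred, dotProduct, Param.alpha]

lemma norm_linPred_le (z : Obs p) :
    ‖(linPred z : Param p q₁ q₀ →L[ℝ] ℝ)‖ ≤ (p + 1) * wt z := by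
  have := wt_nonneg z
  refine ContinuousLinearMap.opNorm_le_bound _ (by positivity) fun ψ => ?_
  rw [linPred_apply]
  refine (abs_xt_dotProduct_le z _).trans ?_
  gcongr
  exact (pi_norm_le_iff_of_nonneg (norm_nonneg _)).2 fun k => norm_le_pi_norm ψ _

lemma measurable_linPred (ψ : Param p q₁ q₀) : Measurable (fun z : Obs p => linPred z ψ) := by
  simp_rw [linPred_apply]
  exact (measurable_xt_dotProduct _).comp measurable_covar

/-- Overlap bounds the linear predictor from both sides, because `expit u ≤ e^u` and `1 - expit u ≤
e^(-u)`. -/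
lemma exists_abs_linPred_le {ψ : Param p q₁ q₀} (hov : ∃ c₁ c₂ : ℝ, 0 < c₁ ∧ c₂ < 1 ∧
    ∀ᵐ z ∂P, c₁ ≤ ps (covar z) ψ.alpha ∧ ps (covar z) ψ.alpha ≤ c₂) :
    ∃ B, ∀ᵐ z ∂P, |linPred z ψ| ≤ B := by
  obtain ⟨c₁, c₂, hc₁, hc₂, hov⟩ := hov
  refine ⟨|Real.log c₁| + |Real.log (1 - c₂)|, ?_⟩
  filter_upwards [hov] with z ⟨h1, h2⟩
  rw [linPred_apply]
  rw [ps_eq] at h1 h2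
  set u := xt (covar z) ⬝ᵥ ψ.alpha
  have h3 : c₁ ≤ Real.exp u := by
    refine h1.trans ?_
    unfold expit
    exact div_le_self (Real.exp_pos u).le (by linarith [Real.exp_pos u])
  have h4 : 1 - c₂ ≤ Real.exp (-u) := by
    have h5 := one_sub_expit u
    have h6 : 1 / (1 + Real.exp u) ≤ 1 / Real.exp u :=
      one_div_le_one_div_of_le (Real.exp_pos u) (by linarith)
    rw [Real.exp_neg, ← one_div]
    linarith
  have h5 := (Real.log_le_iff_le_exp hc₁).2 h3
  have h6 := (Real.log_le_iff_le_exp (by linarith)).2 h4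
  have h7 := neg_abs_le (Real.log c₁)
  have h8 := neg_abs_le (Real.log (1 - c₂))
  have h9 := abs_nonneg (Real.log c₁)
  have h10 := abs_nonneg (Real.log (1 - c₂))
  rw [abs_le]
  constructor <;> linarith

lemma inv_expit (u : ℝ) : (expit u)⁻¹ = 1 + Real.exp (-u) := by
  unfold expit
  rw [inv_div, Real.exp_neg]
  have := Real.exp_pos u
  field_simp
  ring

lemma inv_one_sub_expit (u : ℝ) : (1 - expit u)⁻¹ = 1 + Real.exp u := by
  rw [one_sub_expit, one_div, inv_inv]

section Factors

variable {ψ : Param p q₁ q₀} (hov : ∃ c₁ c₂ : ℝ, 0 < c₁ ∧ c₂ < 1 ∧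
    ∀ᵐ z ∂P, c₁ ≤ ps (covar z) ψ.alpha ∧ ps (covar z) ψ.alpha ≤ c₂)

include hov

lemma bddFactor_of_contDiff {φ : ℝ → ℝ} (hφ : ContDiff ℝ 2 φ) {c t : Obs p → ℝ}
    (hc : Measurable c) (ht : Measurable t) (hc1 : ∀ z, |c z| ≤ 1) (ht1 : ∀ z, |t z| ≤ 1) :
    BddFactor P wt (fun z (ψ' : Param p q₁ q₀) => c z + t z * φ (linPred z ψ')) ψ := by
  obtain ⟨B, hB⟩ := exists_abs_linPred_le hov
  exact BddFactor.of_contDiff hφ hc.aestronglyMeasurable ht.aestronglyMeasurable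
    (fun v => (measurable_linPred v).aestronglyMeasurable) hc1 ht1 wt_nonneg
    (by positivity) norm_linPred_le hB

/-- The inverse propensity score is `1 + e^(-u)`, a smooth function of the linear predictor. The
minus sign matches the factorization of the estimating function below. -/
lemma bddFactor_treated :
    BddFactor P wt (fun z (ψ' : Param p q₁ q₀) => -(trt z / ps (covar z) ψ'.alpha)) ψ := by
  have := bddFactor_of_contDiff hov (φ := fun u => 1 + Real.exp (-u)) (c := fun _ => 0)
    (t := fun z => -trt z) (by fun_prop) measurable_const measurable_trt.neg (by simp)
    (fun z => by rw [abs_neg]; exact abs_trt_le z)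
  convert this using 3 with z ψ'
  rw [ps_eq, linPred_apply, ← inv_expit, zero_add, div_eq_mul_inv, neg_mul]

lemma bddFactor_control :
    BddFactor P wt (fun z (ψ' : Param p q₁ q₀) =>
      -((1 - trt z) / (1 - ps (covar z) ψ'.alpha))) ψ := by
  have := bddFactor_of_contDiff hov (φ := fun u => 1 + Real.exp u) (c := fun _ => 0)
    (t := fun z => -(1 - trt z)) (by fun_prop) measurable_const
    (measurable_const.sub measurable_trt).neg (by simp)
    (fun z => by rw [abs_neg]; exact abs_one_sub_trt_le z)
  convert this using 3 with z ψ'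
  rw [ps_eq, linPred_apply, ← inv_one_sub_expit, zero_add, div_eq_mul_inv, neg_mul]

lemma bddFactor_score :
    BddFactor P wt (fun z (ψ' : Param p q₁ q₀) => trt z - ps (covar z) ψ'.alpha) ψ := by
  have := bddFactor_of_contDiff hov (φ := expit) (c := trt)
    (t := fun z => -1) (contDiff_expit (n := 2)) measurable_trt measurable_const abs_trt_le
    (fun z => by simp)
  convert this using 3 with z ψ'
  rw [ps_eq, linPred_apply]; ring

end Factors

lemma BddFactor.memLp_mul {𝓩 ι : Type*} [MeasurableSpace 𝓩] [Fintype ι] {P : Measure 𝓩}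
    {s : 𝓩 → ℝ} {f : 𝓩 → (ι → ℝ) → ℝ} {b : ι → ℝ}
    (hf : BddFactor P s f b) {k : 𝓩 → ℝ} (hk : MemLp k 2 P) :
    MemLp (fun z => f z b * k z) 2 P := by
  obtain ⟨C, hC, hb⟩ := hf.bound
  refine MemLp.of_le_mul (c := C) hk ((hf.meas b).mul hk.aestronglyMeasurable) ?_
  filter_upwards [hb] with z hz
  rw [norm_mul]
  gcongr
  exact (hz b (by simp)).2.1

/-- Continuous projection to a coordinate of the stacked parameter. -/
noncomputable def coordL (i : PIdx p q₁ q₀) : Param p q₁ q₀ →L[ℝ] ℝ := ContinuousLinearMap.proj i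

/-- The `Δ₁` term turns the weight of `m̄₁ - μ₁` into `T/τ - (T - τ)/τ = 1`. What remains is a
bounded factor times a function smooth in mean, plus an affine term: the shape needed for
`BddFactor.mul`. -/
lemma estFun_mu1_aipw1 (z : Obs p) (ψ : Param p q₁ q₀) :
    estFun .aipw1 M₁ M₀ z ψ (Sum.inl 0)
      = -(trt z / ps (covar z) ψ.alpha) * (M₁.m (covar z) ψ.beta1 + (-y1 z))
        + (ψ.mbar1 - ψ.mu1) := by
  have h : ps (covar z) ψ.alpha ≠ 0 := (expit_pos _).ne'
  simp only [estFun, Param.mk, Sum.elim_inl, Delta1, Matrix.cons_val_zero]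
  field_simp
  ring

/-- Without `Δ₁` the difference `μ₁ - m̄₁` keeps the inverse weight, so it is moved into the second
factor, where it is affine in the parameter. -/
lemma estFun_mu1_aipw2 (z : Obs p) (ψ : Param p q₁ q₀) :
    estFun .aipw2 M₁ M₀ z ψ (Sum.inl 0)
      = -(trt z / ps (covar z) ψ.alpha)
        * (M₁.m (covar z) ψ.beta1 + (-y1 z + (ψ.mu1 - ψ.mbar1))) := by
  simp only [estFun, Param.mk, Sum.elim_inl, Delta1, Matrix.cons_val_zero]
  ring

lemma estFun_theta_aipw1 (z : Obs p) (ψ : Param p q₁ q₀) :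
    estFun .aipw1 M₁ M₀ z ψ idxTheta
      = -((1 - trt z) / (1 - ps (covar z) ψ.alpha)) * (M₀.m (covar z) ψ.beta0 + (-y0 z))
        + (ψ.mbar0 - (ψ.mu1 - ψ.theta)) := by
  have h : 1 - ps (covar z) ψ.alpha ≠ 0 := (sub_pos.2 (expit_lt_one _)).ne'
  simp only [estFun, Param.mk, Sum.elim_inl, Delta0, Matrix.cons_val_one, Matrix.cons_val_zero, idxTheta]
  field_simp
  ring

lemma estFun_theta_aipw2 (z : Obs p) (ψ : Param p q₁ q₀) :
    estFun .aipw2 M₁ M₀ z ψ idxTheta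
      = -((1 - trt z) / (1 - ps (covar z) ψ.alpha))
        * (M₀.m (covar z) ψ.beta0 + (-y0 z + (ψ.mu1 - ψ.theta - ψ.mbar0))) := by
  simp only [estFun, Param.mk, Sum.elim_inl, Delta0, Matrix.cons_val_one, Matrix.cons_val_zero, idxTheta]
  ring

lemma estFun_mbar1 (v : Variant) (z : Obs p) (ψ : Param p q₁ q₀) :
    estFun v M₁ M₀ z ψ (Sum.inl 2) = M₁.m (covar z) ψ.beta1 - ψ.mbar1 := rfl

lemma estFun_mbar0 (v : Variant) (z : Obs p) (ψ : Param p q₁ q₀) :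
    estFun v M₁ M₀ z ψ (Sum.inl 3) = M₀.m (covar z) ψ.beta0 - ψ.mbar0 := rfl

lemma estFun_alpha (v : Variant) (z : Obs p) (ψ : Param p q₁ q₀) (k : Fin (p + 1)) :
    estFun v M₁ M₀ z ψ (Sum.inr (Sum.inl k))
      = (trt z - ps (covar z) ψ.alpha) * xt (covar z) k := rfl

lemma estFun_beta1 (v : Variant) (z : Obs p) (ψ : Param p q₁ q₀) (k : Fin q₁) :
    estFun v M₁ M₀ z ψ (Sum.inr (Sum.inr (Sum.inl k))) = g1 M₁ z ψ.beta1 k := rfl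

lemma estFun_beta0 (v : Variant) (z : Obs p) (ψ : Param p q₁ q₀) (k : Fin q₀) :
    estFun v M₁ M₀ z ψ (Sum.inr (Sum.inr (Sum.inr k))) = g0 M₀ z ψ.beta0 k := rfl

lemma forall_pIdx {Q : PIdx p q₁ q₀ → Prop} (h0 : Q (Sum.inl 0)) (h1 : Q idxTheta)
    (h2 : Q (Sum.inl 2)) (h3 : Q (Sum.inl 3)) (hα : ∀ k, Q (Sum.inr (Sum.inl k)))
    (hβ₁ : ∀ k, Q (Sum.inr (Sum.inr (Sum.inl k))))
    (hβ₀ : ∀ k, Q (Sum.inr (Sum.inr (Sum.inr k)))) (i : PIdx p q₁ q₀) : Q i := by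
  rcases i with i | i | i | i
  · fin_cases i
    exacts [h0, h1, h2, h3]
  · exact hα i
  · exact hβ₁ i
  · exact hβ₀ i

variable {ψ : Param p q₁ q₀}

section Regular

variable (hreg : Regular P M₁ M₀ ψ.alpha ψ.beta1 ψ.beta0)

include hreg

lemma smoothMean_m1 : SmoothMean P wt
    (fun z (ψ' : Param p q₁ q₀) => M₁.m (covar z) ψ'.beta1) ψ :=
  ((hreg.m1_smooth.smoothMean fun b' =>
    (M₁.measurable_m_covar b').aestronglyMeasurable).mono_weight one_le_wt).reindex
      (b := ψ) (fun k => Sum.inr (Sum.inr (Sum.inl k))) wt_nonneg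

lemma smoothMean_m0 : SmoothMean P wt
    (fun z (ψ' : Param p q₁ q₀) => M₀.m (covar z) ψ'.beta0) ψ :=
  ((hreg.m0_smooth.smoothMean fun b' =>
    (M₀.measurable_m_covar b').aestronglyMeasurable).mono_weight one_le_wt).reindex
      (b := ψ) (fun k => Sum.inr (Sum.inr (Sum.inr k))) wt_nonneg

lemma smoothMean_g1 (k : Fin q₁) : SmoothMean P (fun _ => 1) (fun z b => g1 M₁ z b k) ψ.beta1 :=
  (hreg.g1_smooth.component k).smoothMean fun b' =>
    ((measurable_pi_apply k).comp (measurable_g1 M₁ b')).aestronglyMeasurable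

lemma smoothMean_g0 (k : Fin q₀) : SmoothMean P (fun _ => 1) (fun z b => g0 M₀ z b k) ψ.beta0 :=
  (hreg.g0_smooth.component k).smoothMean fun b' =>
    ((measurable_pi_apply k).comp (measurable_g0 M₀ b')).aestronglyMeasurable

/-- Each component of the stacked estimating function is square integrable and smooth in mean at
the limit. -/
lemma estFun_memLp_and_smoothMean [IsProbabilityMeasure P] (v : Variant) : ∀ i : PIdx p q₁ q₀,
    MemLp (fun z => estFun v M₁ M₀ z ψ i) 2 P ∧
      SmoothMean P wt (fun z ψ' => estFun v M₁ M₀ z ψ' i) ψ := by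
  have hwt := memLp_wt hreg.covar_sq
  refine forall_pIdx ?_ ?_ ?_ ?_ ?_ ?_ ?_
  · have hf := bddFactor_treated (q₁ := q₁) (q₀ := q₀) hreg.overlap
    cases v
    · simp_rw [estFun_mu1_aipw1]
      have hk2 : MemLp (fun z => M₁.m (covar z) ψ.beta1 + (-y1 z)) 2 P :=
        hreg.m1_sq.add hreg.y1_sq.neg
      refine ⟨(hf.memLp_mul hk2).add (memLp_const _), ?_⟩
      have hk : SmoothMean P wt (fun z (ψ' : Param p q₁ q₀) =>
          M₁.m (covar z) ψ'.beta1 + (-y1 z)) ψ := by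
        simpa using (smoothMean_m1 hreg).add
          (SmoothMean.affine measurable_y1.neg.aestronglyMeasurable 0)
      have := (hf.mul hk hk2 hwt wt_nonneg).add
        (SmoothMean.affine (a := fun _ => 0) aestronglyMeasurable_const
          (coordL (Sum.inl 2) - coordL (Sum.inl 0)))
      simp only [zero_add] at this
      exact this
    · simp_rw [estFun_mu1_aipw2]
      have hk2 : MemLp (fun z => M₁.m (covar z) ψ.beta1 + (-y1 z + (ψ.mu1 - ψ.mbar1))) 2 P :=
        hreg.m1_sq.add (hreg.y1_sq.neg.add (memLp_const _))
      refine ⟨hf.memLp_mul hk2, hf.mul ?_ hk2 hwt wt_nonneg⟩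
      exact (smoothMean_m1 hreg).add (SmoothMean.affine measurable_y1.neg.aestronglyMeasurable
        (coordL (Sum.inl 0) - coordL (Sum.inl 2)))
  · have hf := bddFactor_control (q₁ := q₁) (q₀ := q₀) hreg.overlap
    cases v
    · simp_rw [estFun_theta_aipw1]
      have hk2 : MemLp (fun z => M₀.m (covar z) ψ.beta0 + (-y0 z)) 2 P :=
        hreg.m0_sq.add hreg.y0_sq.neg
      refine ⟨(hf.memLp_mul hk2).add (memLp_const _), ?_⟩
      have hk : SmoothMean P wt (fun z (ψ' : Param p q₁ q₀) =>
          M₀.m (covar z) ψ'.beta0 + (-y0 z)) ψ := by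
        simpa using (smoothMean_m0 hreg).add
          (SmoothMean.affine measurable_y0.neg.aestronglyMeasurable 0)
      have := (hf.mul hk hk2 hwt wt_nonneg).add
        (SmoothMean.affine (a := fun _ => 0) aestronglyMeasurable_const
          (coordL (Sum.inl 3) - (coordL (Sum.inl 0) - coordL idxTheta)))
      simp only [zero_add] at this
      exact this
    · simp_rw [estFun_theta_aipw2]
      have hk2 : MemLp (fun z => M₀.m (covar z) ψ.beta0
          + (-y0 z + (ψ.mu1 - ψ.theta - ψ.mbar0))) 2 P :=
        hreg.m0_sq.add (hreg.y0_sq.neg.add (memLp_const _))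
      refine ⟨hf.memLp_mul hk2, hf.mul ?_ hk2 hwt wt_nonneg⟩
      exact (smoothMean_m0 hreg).add (SmoothMean.affine measurable_y0.neg.aestronglyMeasurable
        (coordL (Sum.inl 0) - coordL idxTheta - coordL (Sum.inl 3)))
  · simp_rw [estFun_mbar1]
    refine ⟨hreg.m1_sq.sub (memLp_const _), ?_⟩
    have := (smoothMean_m1 hreg).add (SmoothMean.affine (a := fun _ => 0)
      aestronglyMeasurable_const (-coordL (Sum.inl 2)))
    simp only [zero_add] at this
    simp only [sub_eq_add_neg]
    exact this
  · simp_rw [estFun_mbar0]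
    refine ⟨hreg.m0_sq.sub (memLp_const _), ?_⟩
    have := (smoothMean_m0 hreg).add (SmoothMean.affine (a := fun _ => 0)
      aestronglyMeasurable_const (-coordL (Sum.inl 3)))
    simp only [zero_add] at this
    simp only [sub_eq_add_neg]
    exact this
  · intro k
    simp_rw [estFun_alpha]
    have hf := bddFactor_score (q₁ := q₁) (q₀ := q₀) hreg.overlap
    have hk2 := memLp_xt hreg.covar_sq k
    refine ⟨hf.memLp_mul hk2, hf.mul ?_ hk2 hwt wt_nonneg⟩
    simpa using SmoothMean.affine (s := wt) (b := ψ) hk2.aestronglyMeasurable 0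
  · intro k
    simp_rw [estFun_beta1]
    exact ⟨(memLp_pi_iff.1 hreg.g1_sq) k,
      ((smoothMean_g1 hreg k).mono_weight one_le_wt).reindex (b := ψ)
      (fun k => Sum.inr (Sum.inr (Sum.inl k))) wt_nonneg⟩
  · intro k
    simp_rw [estFun_beta0]
    exact ⟨(memLp_pi_iff.1 hreg.g0_sq) k,
      ((smoothMean_g0 hreg k).mono_weight one_le_wt).reindex (b := ψ)
      (fun k => Sum.inr (Sum.inr (Sum.inr k))) wt_nonneg⟩

end Regular

end EstimatingFunction

lemma integral_fderiv_apply_eq_sum {𝓩 ι : Type*} [MeasurableSpace 𝓩] [Fintype ι] [DecidableEq ι]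
    {P : Measure 𝓩} {s : 𝓩 → ℝ} {F : 𝓩 → (ι → ℝ) → ℝ} {b : ι → ℝ}
    (h : SmoothMean P s F b) (u : ι → ℝ) :
    ∫ z, fderiv ℝ (F z) b u ∂P
      = ∑ l, (∫ z, fderiv ℝ (F z) b (Pi.single l 1) ∂P) * u l := by
  simp_rw [fun z => clm_apply_eq_sum (fderiv ℝ (F z) b) u]
  rw [integral_finsetSum _ fun l _ => (h.integrable_fderiv_apply _).mul_const _]
  exact Finset.sum_congr rfl fun l _ => integral_mul_const _ _

lemma fderiv_apply_eq_of_line {E : Type*} [NormedAddCommGroup E] [NormedSpace ℝ E] {f : E → ℝ}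
    {b v : E} {c : ℝ} (hf : DifferentiableAt ℝ f b)
    (h : HasDerivAt (fun t : ℝ => f (b + t • v)) c 0) : fderiv ℝ f b v = c := by
  have h1 : HasLineDerivAt ℝ f (fderiv ℝ f b v) b v := hf.hasFDerivAt.hasLineDerivAt v
  exact HasDerivAt.unique h1 h

lemma hasDerivAt_line {E : Type*} [NormedAddCommGroup E] [NormedSpace ℝ E] {f : E → ℝ}
    {b : E} (hf : DifferentiableAt ℝ f b) (v : E) :
    HasDerivAt (fun t : ℝ => f (b + t • v)) (fderiv ℝ f b v) 0 :=
  hf.hasFDerivAt.hasLineDerivAt v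

variable {p q₁ q₀ : ℕ} {P : Measure (Obs p)} {M₁ : OutcomeModel p q₁} {M₀ : OutcomeModel p q₀}

/-! ### Nonsingularity of the expected Jacobian. -/

section Population

variable {ψ : Param p q₁ q₀} [IsProbabilityMeasure P]
  (hreg : Regular P M₁ M₀ ψ.alpha ψ.beta1 ψ.beta0)

/-- A propensity score below one only enlarges the weight. The lower bound is free of `α`, so it
controls Hájek denominators at the estimate as well, without overlap there. -/
lemma trt_le_trt_div_ps (z : Obs p) (α : Fin (p + 1) → ℝ) : trt z ≤ trt z / ps (covar z) α := by
  have h1 := expit_pos (xt (covar z) ⬝ᵥ α)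
  have h2 := expit_lt_one (xt (covar z) ⬝ᵥ α)
  rw [ps_eq, le_div_iff₀ h1]
  rcases trt_eq_zero_or_one z with h | h <;> rw [h] <;> linarith

lemma one_sub_trt_le_div (z : Obs p) (α : Fin (p + 1) → ℝ) :
    1 - trt z ≤ (1 - trt z) / (1 - ps (covar z) α) := by
  have h1 := expit_pos (xt (covar z) ⬝ᵥ α)
  have h2 := expit_lt_one (xt (covar z) ⬝ᵥ α)
  rw [ps_eq, le_div_iff₀ (by linarith)]
  rcases trt_eq_zero_or_one z with h | h <;> rw [h] <;> linarith

omit [IsProbabilityMeasure P] in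
lemma integrable_trt [IsFiniteMeasure P] : Integrable (trt : Obs p → ℝ) P :=
  (integrable_const (1 : ℝ)).mono' measurable_trt.aestronglyMeasurable
    (Eventually.of_forall abs_trt_le)

include hreg

lemma integrable_trt_div_ps : Integrable (fun z => trt z / ps (covar z) ψ.alpha) P := by
  have h := (bddFactor_treated (q₁ := q₁) (q₀ := q₀) hreg.overlap).memLp_mul
    (memLp_const (-1 : ℝ))
  simpa using h.integrable (by simp)

lemma integrable_one_sub_trt_div_ps :
    Integrable (fun z => (1 - trt z) / (1 - ps (covar z) ψ.alpha)) P := by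
  have h := (bddFactor_control (q₁ := q₁) (q₀ := q₀) hreg.overlap).memLp_mul
    (memLp_const (-1 : ℝ))
  simpa using h.integrable (by simp)

lemma integrable_ipw1 :
    Integrable (fun z => trt z * (y1 z - M₁.m (covar z) ψ.beta1) / ps (covar z) ψ.alpha) P := by
  have h := ((bddFactor_treated (q₁ := q₁) (q₀ := q₀) hreg.overlap).memLp_mul
    (hreg.m1_sq.sub hreg.y1_sq)).integrable (by simp)
  refine h.congr (Eventually.of_forall fun z => ?_)
  simp only [Pi.sub_apply]
  ring

lemma integrable_ipw0 :
    Integrable (fun z => (1 - trt z) * (y0 z - M₀.m (covar z) ψ.beta0)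
      / (1 - ps (covar z) ψ.alpha)) P := by
  have h := ((bddFactor_control (q₁ := q₁) (q₀ := q₀) hreg.overlap).memLp_mul
    (hreg.m0_sq.sub hreg.y0_sq)).integrable (by simp)
  refine h.congr (Eventually.of_forall fun z => ?_)
  simp only [Pi.sub_apply]
  ring

lemma integral_trt_div_ps_pos : 0 < ∫ z, trt z / ps (covar z) ψ.alpha ∂P :=
  hreg.treat_prob.1.trans_le (integral_mono integrable_trt (integrable_trt_div_ps hreg)
    fun z => trt_le_trt_div_ps z _)

lemma integral_one_sub_trt_div_ps_pos :
    0 < ∫ z, (1 - trt z) / (1 - ps (covar z) ψ.alpha) ∂P := by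
  have h1 : 0 < ∫ z, 1 - trt z ∂P := by
    rw [integral_sub (integrable_const _) integrable_trt]
    simpa using hreg.treat_prob.2
  exact h1.trans_le (integral_mono ((integrable_const _).sub integrable_trt)
    (integrable_one_sub_trt_div_ps hreg) fun z => one_sub_trt_le_div z _)

lemma ae_differentiableAt_estFun (v : Variant) :
    ∀ᵐ z ∂P, DifferentiableAt ℝ (estFun v M₁ M₀ z) ψ := by
  have h : ∀ᵐ z ∂P, ∀ i, DifferentiableAt ℝ (fun ψ' => estFun v M₁ M₀ z ψ' i) ψ :=
    ae_all_iff.2 fun i => (estFun_memLp_and_smoothMean hreg v i).2.differentiableAt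
  filter_upwards [h] with z hz
  exact differentiableAt_pi.2 hz

lemma popJacobian_apply (v : Variant) (k l : PIdx p q₁ q₀) :
    popJacobian v P M₁ M₀ ψ k l
      = ∫ z, fderiv ℝ (fun ψ' => estFun v M₁ M₀ z ψ' k) ψ (Pi.single l 1) ∂P := by
  refine integral_congr_ae ?_
  filter_upwards [ae_differentiableAt_estFun hreg v] with z hz
  exact jacobian_apply hz k l

lemma popJacobian_mulVec (v : Variant) (u : Param p q₁ q₀) (k : PIdx p q₁ q₀) :
    (popJacobian v P M₁ M₀ ψ).mulVec u k
      = ∫ z, fderiv ℝ (fun ψ' => estFun v M₁ M₀ z ψ' k) ψ u ∂P := by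
  rw [integral_fderiv_apply_eq_sum (estFun_memLp_and_smoothMean hreg v k).2]
  simp only [Matrix.mulVec, dotProduct, popJacobian_apply hreg]

/-- Derivatives of the components of the estimating function along a line. -/
lemma popJacobian_mulVec_of_line (v : Variant) (u : Param p q₁ q₀) (k : PIdx p q₁ q₀)
    {c : Obs p → ℝ}
    (h : ∀ᵐ z ∂P, HasDerivAt (fun t : ℝ => estFun v M₁ M₀ z (ψ + t • u) k) (c z) 0) :
    (popJacobian v P M₁ M₀ ψ).mulVec u k = ∫ z, c z ∂P := by
  rw [popJacobian_mulVec hreg]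
  refine integral_congr_ae ?_
  filter_upwards [(estFun_memLp_and_smoothMean hreg v k).2.differentiableAt, h] with z h1 h2
  exact fderiv_apply_eq_of_line h1 h2

/-- The expected Jacobian of the stacked estimating function is nonsingular. -/
lemma isUnit_det_popJacobian (v : Variant) : IsUnit (popJacobian v P M₁ M₀ ψ).det := by
  rw [isUnit_iff_ne_zero]
  intro hdet
  obtain ⟨u, hu0, hu⟩ : ∃ u : Param p q₁ q₀, u ≠ 0 ∧ (popJacobian v P M₁ M₀ ψ).mulVec u = 0 :=
    Matrix.exists_mulVec_eq_zero_iff.2 hdet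
  refine hu0 ?_
  -- Back substitution for a kernel vector `u`. The rows of `β₁`, `β₀` and `α` involve only their
  -- own block; the rows of the means, and then those of `μ₁` and `θ`, are treated once these blocks
  -- of `u` are known to vanish.
  have hb1 : u.beta1 = 0 := by
    have hd : ∀ᵐ z ∂P, ∀ k, DifferentiableAt ℝ (fun b => g1 M₁ z b k) ψ.beta1 :=
      ae_all_iff.2 fun k => (smoothMean_g1 hreg k).differentiableAt
    refine Matrix.eq_zero_of_mulVec_eq_zero hreg.nonsing_1.ne_zero ?_
    ext k
    have h1 := popJacobian_mulVec_of_line hreg v u (Sum.inr (Sum.inr (Sum.inl k)))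
      (c := fun z => fderiv ℝ (fun b => g1 M₁ z b k) ψ.beta1 u.beta1) (by
        filter_upwards [hd] with z hz
        exact hasDerivAt_line (hz k) u.beta1)
    rw [hu, integral_fderiv_apply_eq_sum (smoothMean_g1 hreg k)] at h1
    refine Eq.trans ?_ h1.symm
    simp only [Matrix.mulVec, dotProduct, Matrix.of_apply]
    refine Finset.sum_congr rfl fun l _ => ?_
    congr 1
    refine integral_congr_ae ?_
    filter_upwards [hd] with z hz
    exact jacobian_apply (differentiableAt_pi.2 hz) k l
  have hb0 : u.beta0 = 0 := by
    have hd : ∀ᵐ z ∂P, ∀ k, DifferentiableAt ℝ (fun b => g0 M₀ z b k) ψ.beta0 :=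
      ae_all_iff.2 fun k => (smoothMean_g0 hreg k).differentiableAt
    refine Matrix.eq_zero_of_mulVec_eq_zero hreg.nonsing_0.ne_zero ?_
    ext k
    have h1 := popJacobian_mulVec_of_line hreg v u (Sum.inr (Sum.inr (Sum.inr k)))
      (c := fun z => fderiv ℝ (fun b => g0 M₀ z b k) ψ.beta0 u.beta0) (by
        filter_upwards [hd] with z hz
        exact hasDerivAt_line (hz k) u.beta0)
    rw [hu, integral_fderiv_apply_eq_sum (smoothMean_g0 hreg k)] at h1
    refine Eq.trans ?_ h1.symm
    simp only [Matrix.mulVec, dotProduct, Matrix.of_apply]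
    refine Finset.sum_congr rfl fun l _ => ?_
    congr 1
    refine integral_congr_ae ?_
    filter_upwards [hd] with z hz
    exact jacobian_apply (differentiableAt_pi.2 hz) k l
  -- Testing the `α` rows against `u.alpha` gives `E{τ(1 - τ)(x̃ᵀu)²} = 0`, and the weighted second
  -- moment matrix is positive definite.
  have hα : u.alpha = 0 := by
    set w : Obs p → ℝ := fun z => ps (covar z) ψ.alpha * (1 - ps (covar z) ψ.alpha) with hw
    have hw0 (z : Obs p) : 0 < w z :=
      mul_pos (expit_pos _) (sub_pos.2 (expit_lt_one _))
    have hw1 (z : Obs p) : w z ≤ 1 :=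
      mul_le_one₀ (expit_lt_one _).le (sub_pos.2 (expit_lt_one _)).le
        (by linarith [expit_pos (xt (covar z) ⬝ᵥ ψ.alpha), ps_eq (covar z) ψ.alpha])
    have hwm : Measurable w := by
      have := measurable_ps_covar (p := p) ψ.alpha
      fun_prop
    refine eq_zero_of_integral_weighted_eq_zero hreg.covar_sq hreg.nonsing_x hwm hw0 hw1 ?_
    have h1 (k : Fin (p + 1)) : ∫ z, -(w z * (xt (covar z) ⬝ᵥ u.alpha)) * xt (covar z) k ∂P = 0 := by
      rw [← popJacobian_mulVec_of_line hreg v u (Sum.inr (Sum.inl k)), hu]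
      · rfl
      · refine Eventually.of_forall fun z => ?_
        have h2 : HasDerivAt (fun t : ℝ => xt (covar z) ⬝ᵥ ψ.alpha
            + t * (xt (covar z) ⬝ᵥ u.alpha)) (xt (covar z) ⬝ᵥ u.alpha) 0 := by
          simpa using ((hasDerivAt_id (0 : ℝ)).mul_const (xt (covar z) ⬝ᵥ u.alpha)).const_add
            (xt (covar z) ⬝ᵥ ψ.alpha)
        have h3 := ((((hasDerivAt_expit _).comp (0 : ℝ) h2).const_sub (trt z)).mul_const
          (xt (covar z) k))
        refine (h3.congr_of_eventuallyEq (Eventually.of_forall fun t => ?_)).congr_deriv ?_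
        · rw [estFun_alpha, ps_eq, show (ψ + t • u).alpha = ψ.alpha + t • u.alpha from rfl,
            dotProduct_add, dotProduct_smul]
          rfl
        · simp only [hw, ps_eq, zero_mul, add_zero]
    have hx := hreg.covar_sq
    have hint (k : Fin (p + 1)) :
        Integrable (fun z => -(w z * (xt (covar z) ⬝ᵥ u.alpha)) * xt (covar z) k) P := by
      have h2 : Integrable (fun z => ∑ l, w z * (xt (covar z) l * xt (covar z) k)
          * (-u.alpha l)) P := integrable_finsetSum _ fun l _ =>
        (integrable_weighted_dotProduct_sq hx hwm
          (fun z => by rw [abs_of_pos (hw0 z)]; exact hw1 z) l k).mul_const _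
      refine h2.congr (Eventually.of_forall fun z => ?_)
      simp only [dotProduct, Finset.mul_sum, ← Finset.sum_neg_distrib, Finset.sum_mul]
      exact Finset.sum_congr rfl fun l _ => by ring
    have h2 : ∫ z, ∑ k, -(w z * (xt (covar z) ⬝ᵥ u.alpha)) * xt (covar z) k * (-u.alpha k) ∂P
        = 0 := by
      rw [integral_finsetSum _ fun k _ => (hint k).mul_const _]
      exact Finset.sum_eq_zero fun k _ => by rw [integral_mul_const, h1 k, zero_mul]
    rw [← h2]
    refine integral_congr_ae (Eventually.of_forall fun z => ?_)
    simp only [mul_assoc, ← Finset.mul_sum]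
    rw [sq, show ∑ i, xt (covar z) i * -u.alpha i = -(xt (covar z) ⬝ᵥ u.alpha) by
      simp [dotProduct]]
    ring
  -- The line `ψ + t • u` now keeps the model parameters fixed, so the four remaining rows are
  -- affine in `t` and can be differentiated by inspection.
  have hline1 (t : ℝ) : (ψ + t • u).beta1 = ψ.beta1 := by
    change ψ.beta1 + t • u.beta1 = ψ.beta1
    rw [hb1, smul_zero, add_zero]
  have hline0 (t : ℝ) : (ψ + t • u).beta0 = ψ.beta0 := by
    change ψ.beta0 + t • u.beta0 = ψ.beta0
    rw [hb0, smul_zero, add_zero]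
  have hlineα (t : ℝ) : (ψ + t • u).alpha = ψ.alpha := by
    change ψ.alpha + t • u.alpha = ψ.alpha
    rw [hα, smul_zero, add_zero]
  have hlin (a c : ℝ) : HasDerivAt (fun t : ℝ => a + t * c) c 0 := by
    simpa using ((hasDerivAt_id (0 : ℝ)).mul_const c).const_add a
  have hm1 : u.mbar1 = 0 := by
    have h1 := popJacobian_mulVec_of_line hreg v u (Sum.inl 2) (c := fun _ => -u.mbar1) (by
      refine Eventually.of_forall fun z => ?_
      refine (hlin (M₁.m (covar z) ψ.beta1 - ψ.mbar1) (-u.mbar1)).congr_of_eventuallyEq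
        (Eventually.of_forall fun t => ?_)
      simp only [estFun_mbar1, hline1]
      rw [show (ψ + t • u).mbar1 = ψ.mbar1 + t * u.mbar1 from rfl]
      ring)
    rw [hu] at h1
    simpa using h1
  have hm0 : u.mbar0 = 0 := by
    have h1 := popJacobian_mulVec_of_line hreg v u (Sum.inl 3) (c := fun _ => -u.mbar0) (by
      refine Eventually.of_forall fun z => ?_
      refine (hlin (M₀.m (covar z) ψ.beta0 - ψ.mbar0) (-u.mbar0)).congr_of_eventuallyEq
        (Eventually.of_forall fun t => ?_)
      simp only [estFun_mbar0, hline0]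
      rw [show (ψ + t • u).mbar0 = ψ.mbar0 + t * u.mbar0 from rfl]
      ring)
    rw [hu] at h1
    simpa using h1
  have hmu (t : ℝ) : (ψ + t • u).mu1 = ψ.mu1 + t * u.mu1 := rfl
  have hth (t : ℝ) : (ψ + t • u).theta = ψ.theta + t * u.theta := rfl
  have hmb1 (t : ℝ) : (ψ + t • u).mbar1 = ψ.mbar1 := by
    change ψ.mbar1 + t * u.mbar1 = ψ.mbar1
    rw [hm1, mul_zero, add_zero]
  have hmb0 (t : ℝ) : (ψ + t • u).mbar0 = ψ.mbar0 := by
    change ψ.mbar0 + t * u.mbar0 = ψ.mbar0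
    rw [hm0, mul_zero, add_zero]
  -- The coefficient of `u.mu1` is `-1` for AIPW1 and `-E(T/τ)` for AIPW2, which is nonzero because
  -- `E(T) > 0`.
  have hμ : u.mu1 = 0 := by
    cases v
    · have h1 := popJacobian_mulVec_of_line hreg .aipw1 u (Sum.inl 0) (c := fun _ => -u.mu1) (by
        refine Eventually.of_forall fun z => ?_
        refine (hlin (estFun .aipw1 M₁ M₀ z ψ (Sum.inl 0)) (-u.mu1)).congr_of_eventuallyEq
          (Eventually.of_forall fun t => ?_)
        simp only [estFun_mu1_aipw1, hline1, hlineα, hmu, hmb1]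
        ring)
      rw [hu] at h1
      simpa using h1
    · have h1 := popJacobian_mulVec_of_line hreg .aipw2 u (Sum.inl 0)
        (c := fun z => trt z / ps (covar z) ψ.alpha * (-u.mu1)) (by
        refine Eventually.of_forall fun z => ?_
        refine (hlin (estFun .aipw2 M₁ M₀ z ψ (Sum.inl 0)) _).congr_of_eventuallyEq
          (Eventually.of_forall fun t => ?_)
        simp only [estFun_mu1_aipw2, hline1, hlineα, hmu, hmb1]
        ring)
      rw [hu, integral_mul_const] at h1
      have h2 := (integral_trt_div_ps_pos hreg).ne'
      simpa [h2] using h1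
  have hθ : u.theta = 0 := by
    cases v
    · have h1 := popJacobian_mulVec_of_line hreg .aipw1 u idxTheta (c := fun _ => u.theta) (by
        refine Eventually.of_forall fun z => ?_
        refine (hlin (estFun .aipw1 M₁ M₀ z ψ idxTheta) u.theta).congr_of_eventuallyEq
          (Eventually.of_forall fun t => ?_)
        simp only [estFun_theta_aipw1, hline0, hlineα, hmu, hth, hmb0, hμ]
        ring)
      rw [hu] at h1
      simpa using h1.symm
    · have h1 := popJacobian_mulVec_of_line hreg .aipw2 u idxTheta
        (c := fun z => (1 - trt z) / (1 - ps (covar z) ψ.alpha) * u.theta) (by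
        refine Eventually.of_forall fun z => ?_
        refine (hlin (estFun .aipw2 M₁ M₀ z ψ idxTheta) _).congr_of_eventuallyEq
          (Eventually.of_forall fun t => ?_)
        simp only [estFun_theta_aipw2, hline0, hlineα, hmu, hth, hmb0, hμ]
        ring)
      rw [hu, integral_mul_const] at h1
      have h2 := (integral_one_sub_trt_div_ps_pos hreg).ne'
      simpa [h2] using h1
  funext i
  revert i
  exact forall_pIdx hμ hθ hm1 hm0 (congrFun hα) (congrFun hb1) (congrFun hb0)

end Population

/-! ### The population estimating equations at the limit. -/

section MeanZero

variable [IsProbabilityMeasure P]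

/-- The stacked estimating function has mean zero at a point whose components satisfy the defining
relations of the limit `Ψ*`. -/
lemma integral_estFun_eq_zero {ψ : Param p q₁ q₀} {v : Variant}
    (hreg : Regular P M₁ M₀ ψ.alpha ψ.beta1 ψ.beta0) (hα : IsPopScoreRoot P ψ.alpha)
    (hg1 : ∀ k, ∫ z, g1 M₁ z ψ.beta1 k ∂P = 0) (hg0 : ∀ k, ∫ z, g0 M₀ z ψ.beta0 k ∂P = 0)
    (hb1 : ψ.mbar1 = ∫ z, M₁.m (covar z) ψ.beta1 ∂P)
    (hb0 : ψ.mbar0 = ∫ z, M₀.m (covar z) ψ.beta0 ∂P)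
    (hmu1 : ψ.mu1 = mu1Star v P M₁ ψ.alpha ψ.beta1)
    (hmu0 : ψ.mu1 - ψ.theta = mu0Star v P M₀ ψ.alpha ψ.beta0) :
    ∀ i, ∫ z, estFun v M₁ M₀ z ψ i ∂P = 0 := by
  have i1 := integrable_ipw1 hreg
  have i0 := integrable_ipw0 hreg
  have s1 := integrable_trt_div_ps hreg
  have s0 := integrable_one_sub_trt_div_ps hreg
  have p1 := integral_trt_div_ps_pos hreg
  have p0 := integral_one_sub_trt_div_ps_pos hreg
  refine forall_pIdx ?_ ?_ ?_ ?_ ?_ hg1 hg0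
  · cases v
    · have e (z : Obs p) : estFun .aipw1 M₁ M₀ z ψ (Sum.inl 0)
          = trt z * (y1 z - M₁.m (covar z) ψ.beta1) / ps (covar z) ψ.alpha
            + (ψ.mbar1 - ψ.mu1) := by
        rw [estFun_mu1_aipw1]; ring
      simp_rw [e]
      rw [integral_add i1 (integrable_const _), integral_const, hmu1, hb1]
      simp [mu1Star]
    · have e (z : Obs p) : estFun .aipw2 M₁ M₀ z ψ (Sum.inl 0)
          = trt z * (y1 z - M₁.m (covar z) ψ.beta1) / ps (covar z) ψ.alpha
            + trt z / ps (covar z) ψ.alpha * (ψ.mbar1 - ψ.mu1) := by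
        rw [estFun_mu1_aipw2]; ring
      simp_rw [e]
      rw [integral_add i1 (s1.mul_const _), integral_mul_const, hmu1, hb1]
      simp only [mu1Star]
      field_simp
      ring
  · cases v
    · have e (z : Obs p) : estFun .aipw1 M₁ M₀ z ψ idxTheta
          = (1 - trt z) * (y0 z - M₀.m (covar z) ψ.beta0) / (1 - ps (covar z) ψ.alpha)
            + (ψ.mbar0 - (ψ.mu1 - ψ.theta)) := by
        rw [estFun_theta_aipw1]; ring
      simp_rw [e]
      rw [integral_add i0 (integrable_const _), integral_const, hmu0, hb0]
      simp [mu0Star]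
    · have e (z : Obs p) : estFun .aipw2 M₁ M₀ z ψ idxTheta
          = (1 - trt z) * (y0 z - M₀.m (covar z) ψ.beta0) / (1 - ps (covar z) ψ.alpha)
            + (1 - trt z) / (1 - ps (covar z) ψ.alpha) * (ψ.mbar0 - (ψ.mu1 - ψ.theta)) := by
        rw [estFun_theta_aipw2]; ring
      simp_rw [e]
      rw [integral_add i0 (s0.mul_const _), integral_mul_const, hmu0, hb0]
      simp only [mu0Star]
      field_simp
      ring
  · simp_rw [estFun_mbar1]
    rw [integral_sub (hreg.m1_sq.integrable (by simp)) (integrable_const _), hb1]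
    simp
  · simp_rw [estFun_mbar0]
    rw [integral_sub (hreg.m0_sq.integrable (by simp)) (integrable_const _), hb0]
    simp
  · intro k
    simp_rw [estFun_alpha, mul_comm _ (xt _ k)]
    exact hα k

lemma integral_estFun_psiStar {α : Fin (p + 1) → ℝ} {β₁ : Fin q₁ → ℝ} {β₀ : Fin q₀ → ℝ}
    (hreg : Regular P M₁ M₀ α β₁ β₀) (hα : IsPopScoreRoot P α)
    (hg1 : ∀ k, ∫ z, g1 M₁ z β₁ k ∂P = 0) (hg0 : ∀ k, ∫ z, g0 M₀ z β₀ k ∂P = 0) (v : Variant) :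
    ∀ i, ∫ z, estFun v M₁ M₀ z (psiStar v P M₁ M₀ α β₁ β₀) i ∂P = 0 :=
  integral_estFun_eq_zero (ψ := psiStar v P M₁ M₀ α β₁ β₀) hreg hα hg1 hg0 rfl rfl rfl
    (sub_sub_cancel (mu1Star v P M₁ α β₁) (mu0Star v P M₀ α β₀))

end MeanZero

/-! ### The stacked estimator as an exact root in finite samples. -/

section FiniteSample

variable {p q₁ q₀ q' : ℕ} {Ω : Type*} {Z : ℕ → Ω → Obs p} {q : ℕ × Ω}

lemma sum_treated (n : ℕ) (z : ℕ → Obs p) (f : ℕ → ℝ) :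
    ∑ j ∈ treated n z, f j = ∑ j ∈ Finset.range n, trt (z j) * f j := by
  rw [treated, Finset.sum_filter]
  refine Finset.sum_congr rfl fun j _ => ?_
  unfold trt
  split_ifs <;> simp

lemma sum_controls (n : ℕ) (z : ℕ → Obs p) (f : ℕ → ℝ) :
    ∑ j ∈ controls n z, f j = ∑ j ∈ Finset.range n, (1 - trt (z j)) * f j := by
  rw [controls, Finset.sum_filter]
  refine Finset.sum_congr rfl fun j _ => ?_
  unfold trt
  cases (z j).2.1 <;> simp

lemma mu1Hat_aipw1_eq (M : OutcomeModel p q') (α : Fin (p + 1) → ℝ) (β : Fin q' → ℝ) :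
    mu1Hat .aipw1 q.1 (fun j => Z j q.2) M α β
      = smean Z q (fun z => trt z * (y1 z - M.m (covar z) β) / ps (covar z) α)
        + mbarHat q.1 (fun j => Z j q.2) M β := by
  simp only [mu1Hat, sum_treated, smean, mul_div_assoc]

lemma mu0Hat_aipw1_eq (M : OutcomeModel p q') (α : Fin (p + 1) → ℝ) (β : Fin q' → ℝ) :
    mu0Hat .aipw1 q.1 (fun j => Z j q.2) M α β
      = smean Z q (fun z => (1 - trt z) * (y0 z - M.m (covar z) β) / (1 - ps (covar z) α))
        + mbarHat q.1 (fun j => Z j q.2) M β := by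
  simp only [mu0Hat, sum_controls, smean, mul_div_assoc]

lemma mu1Hat_aipw2_eq (hq : q.1 ≠ 0) (M : OutcomeModel p q') (α : Fin (p + 1) → ℝ)
    (β : Fin q' → ℝ) :
    mu1Hat .aipw2 q.1 (fun j => Z j q.2) M α β
      = smean Z q (fun z => trt z * (y1 z - M.m (covar z) β) / ps (covar z) α)
          / smean Z q (fun z => trt z / ps (covar z) α)
        + mbarHat q.1 (fun j => Z j q.2) M β := by
  have hn : ((q.1 : ℝ))⁻¹ ≠ 0 := inv_ne_zero (Nat.cast_ne_zero.2 hq)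
  simp only [mu1Hat, sum_treated, smean]
  rw [mul_div_mul_left _ _ hn, Finset.sum_div]
  congr 1
  refine Finset.sum_congr rfl fun j _ => ?_
  simp only [div_eq_mul_inv]
  ring

lemma mu0Hat_aipw2_eq (hq : q.1 ≠ 0) (M : OutcomeModel p q') (α : Fin (p + 1) → ℝ)
    (β : Fin q' → ℝ) :
    mu0Hat .aipw2 q.1 (fun j => Z j q.2) M α β
      = smean Z q (fun z => (1 - trt z) * (y0 z - M.m (covar z) β) / (1 - ps (covar z) α))
          / smean Z q (fun z => (1 - trt z) / (1 - ps (covar z) α))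
        + mbarHat q.1 (fun j => Z j q.2) M β := by
  have hn : ((q.1 : ℝ))⁻¹ ≠ 0 := inv_ne_zero (Nat.cast_ne_zero.2 hq)
  simp only [mu0Hat, sum_controls, smean]
  rw [mul_div_mul_left _ _ hn, Finset.sum_div]
  congr 1
  refine Finset.sum_congr rfl fun j _ => ?_
  simp only [div_eq_mul_inv]
  ring

variable {M₁ : OutcomeModel p q₁} {M₀ : OutcomeModel p q₀}

lemma estEq_apply (v : Variant) (ψ : Param p q₁ q₀) (i : PIdx p q₁ q₀) :
    estEq v M₁ M₀ q.1 (fun j => Z j q.2) ψ i = smean Z q (fun z => estFun v M₁ M₀ z ψ i) := by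
  simp only [estEq, Pi.smul_apply, Finset.sum_apply, smul_eq_mul, smean]

/-- The weight of `m̄₁ - μ₁` in the estimating equation for `μ₁`. -/
noncomputable def weight1 (v : Variant) (z : Obs p) (α : Fin (p + 1) → ℝ) : ℝ :=
  match v with
  | .aipw1 => 1
  | .aipw2 => trt z / ps (covar z) α

/-- The weight of `m̄₀ - μ₀` in the estimating equation for `μ₀ = μ₁ - θ`. -/
noncomputable def weight0 (v : Variant) (z : Obs p) (α : Fin (p + 1) → ℝ) : ℝ :=
  match v with
  | .aipw1 => 1
  | .aipw2 => (1 - trt z) / (1 - ps (covar z) α)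

lemma trt_le_weight1 (v : Variant) (z : Obs p) (α : Fin (p + 1) → ℝ) :
    trt z ≤ weight1 v z α := by
  cases v
  · exact (le_abs_self _).trans (abs_trt_le z)
  · exact trt_le_trt_div_ps z α

lemma one_sub_trt_le_weight0 (v : Variant) (z : Obs p) (α : Fin (p + 1) → ℝ) :
    1 - trt z ≤ weight0 v z α := by
  cases v
  · exact (le_abs_self _).trans (abs_one_sub_trt_le z)
  · exact one_sub_trt_le_div z α

/-- A common form for both estimators, in which the weight is at least `T`. It allows one argument
for the rate of `μ̂₁`. -/
lemma estFun_mu1_eq (v : Variant) (z : Obs p) (ψ : Param p q₁ q₀) :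
    estFun v M₁ M₀ z ψ (Sum.inl 0)
      = trt z * (y1 z - M₁.m (covar z) ψ.beta1) / ps (covar z) ψ.alpha
        + weight1 v z ψ.alpha * (ψ.mbar1 - ψ.mu1) := by
  cases v
  · rw [estFun_mu1_aipw1]; simp only [weight1]; ring
  · rw [estFun_mu1_aipw2]; simp only [weight1]; ring

lemma estFun_theta_eq (v : Variant) (z : Obs p) (ψ : Param p q₁ q₀) :
    estFun v M₁ M₀ z ψ idxTheta
      = (1 - trt z) * (y0 z - M₀.m (covar z) ψ.beta0) / (1 - ps (covar z) ψ.alpha)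
        + weight0 v z ψ.alpha * (ψ.mbar0 - (ψ.mu1 - ψ.theta)) := by
  cases v
  · rw [estFun_theta_aipw1]; simp only [weight0]; ring
  · rw [estFun_theta_aipw2]; simp only [weight0]; ring

/-- The stacked estimator solves the stacked estimating equations. -/
lemma smean_estFun_psiHat (v : Variant) (hT : 0 < smean Z q trt)
    (hC : 0 < smean Z q (fun z => 1 - trt z)) {α : Fin (p + 1) → ℝ} {β₁ : Fin q₁ → ℝ}
    {β₀ : Fin q₀ → ℝ} (hα : IsMLE q.1 (fun j => Z j q.2) α)
    (h1 : ∑ j ∈ Finset.range q.1, g1 M₁ (Z j q.2) β₁ = 0)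
    (h0 : ∑ j ∈ Finset.range q.1, g0 M₀ (Z j q.2) β₀ = 0) (i : PIdx p q₁ q₀) :
    smean Z q (fun z => estFun v M₁ M₀ z
      (psiHat v M₁ M₀ q.1 (fun j => Z j q.2) α β₁ β₀) i) = 0 := by
  have hq : q.1 ≠ 0 := by
    intro h
    simp [smean, h] at hT
  -- The denominators of AIPW2 are nonzero as soon as both treatment groups are nonempty.
  have hw1 : smean Z q (fun z => trt z / ps (covar z) α) ≠ 0 :=
    (hT.trans_le (smean_mono fun j _ => trt_le_trt_div_ps _ _)).ne'
  have hw0 : smean Z q (fun z => (1 - trt z) / (1 - ps (covar z) α)) ≠ 0 :=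
    (hC.trans_le (smean_mono fun j _ => one_sub_trt_le_div _ _)).ne'
  revert i
  refine forall_pIdx ?_ ?_ ?_ ?_ ?_ ?_ ?_
  · simp_rw [estFun_mu1_eq]
    rw [smean_add, smean_mul_const]
    change smean Z q (fun z => trt z * (y1 z - M₁.m (covar z) β₁) / ps (covar z) α)
      + smean Z q (fun z => weight1 v z α) * (mbarHat q.1 (fun j => Z j q.2) M₁ β₁
        - mu1Hat v q.1 (fun j => Z j q.2) M₁ α β₁) = 0
    cases v
    · simp only [weight1]
      rw [mu1Hat_aipw1_eq, smean_const _ hq]; ring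
    · simp only [weight1]
      rw [mu1Hat_aipw2_eq hq]
      field_simp
      ring
  · simp_rw [estFun_theta_eq]
    rw [smean_add, smean_mul_const]
    change smean Z q (fun z => (1 - trt z) * (y0 z - M₀.m (covar z) β₀) / (1 - ps (covar z) α))
      + smean Z q (fun z => weight0 v z α) * (mbarHat q.1 (fun j => Z j q.2) M₀ β₀
        - (mu1Hat v q.1 (fun j => Z j q.2) M₁ α β₁ - (mu1Hat v q.1 (fun j => Z j q.2) M₁ α β₁
          - mu0Hat v q.1 (fun j => Z j q.2) M₀ α β₀))) = 0
    rw [sub_sub_cancel]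
    cases v
    · simp only [weight0]
      rw [mu0Hat_aipw1_eq, smean_const _ hq]; ring
    · simp only [weight0]
      rw [mu0Hat_aipw2_eq hq]
      field_simp
      ring
  · simp_rw [estFun_mbar1]
    rw [smean_sub, smean_const _ hq]
    exact sub_self _
  · simp_rw [estFun_mbar0]
    rw [smean_sub, smean_const _ hq]
    exact sub_self _
  · intro k
    simp_rw [estFun_alpha]
    have h := hα.score_eq k
    simp only [smean]
    change _ * ∑ j ∈ Finset.range q.1,
      (trt (Z j q.2) - ps (covar (Z j q.2)) α) * xt (covar (Z j q.2)) k = 0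
    rw [h, mul_zero]
  · intro k
    simp_rw [estFun_beta1]
    have h := congrFun h1 k
    rw [Finset.sum_apply, Pi.zero_apply] at h
    simp only [smean]
    change _ * ∑ j ∈ Finset.range q.1, g1 M₁ (Z j q.2) β₁ k = 0
    rw [h, mul_zero]
  · intro k
    simp_rw [estFun_beta0]
    have h := congrFun h0 k
    rw [Finset.sum_apply, Pi.zero_apply] at h
    simp only [smean]
    change _ * ∑ j ∈ Finset.range q.1, g0 M₀ (Z j q.2) β₀ k = 0
    rw [h, mul_zero]

end FiniteSample

/-! ### Root-`n` consistency of the full stacked estimator. -/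

section Rate

variable {p q₁ q₀ : ℕ} {P : Measure (Obs p)} [IsProbabilityMeasure P]
  {M₁ : OutcomeModel p q₁} {M₀ : OutcomeModel p q₀} {ψ : Param p q₁ q₀}
  {Ω : Type*} [MeasurableSpace Ω] {μ : Measure Ω} [IsProbabilityMeasure μ] {Z : ℕ → Ω → Obs p}

/-- Both treatment groups make up a nonvanishing fraction of the sample. -/
lemma eventually_smean_trt_ge (hreg : Regular P M₁ M₀ ψ.alpha ψ.beta1 ψ.beta0)
    (hZ : IsSample P μ Z) :
    ∃ c > 0, ∀ᶠ q in inProb μ, c ≤ smean Z q trt ∧ c ≤ smean Z q (fun z => 1 - trt z) := by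
  set e := ∫ z, trt z ∂P with he
  have h0 : 0 < e := hreg.treat_prob.1
  have h1 : 0 < 1 - e := sub_pos.2 hreg.treat_prob.2
  have t1 := hZ.tendsto_smean (integrable_trt (P := P))
  have t0 := hZ.tendsto_smean (show Integrable (fun z => 1 - trt z) P from
    (integrable_const (1 : ℝ)).sub integrable_trt)
  have e0 : ∫ z, 1 - trt z ∂P = 1 - e := by
    rw [integral_sub (integrable_const _) integrable_trt]
    simp [he]
  rw [e0] at t0
  refine ⟨min e (1 - e) / 2, by positivity, ?_⟩
  have hm : 0 < min e (1 - e) := lt_min h0 h1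
  have l1 := min_le_left e (1 - e)
  have l2 := min_le_right e (1 - e)
  filter_upwards [t1.eventually (lt_mem_nhds (by linarith : min e (1 - e) / 2 < e)),
    t0.eventually (lt_mem_nhds (by linarith : min e (1 - e) / 2 < 1 - e))] with q h2 h3
  exact ⟨h2.le, h3.le⟩

/-- Root-`n` consistency of a solution of the stacked estimating equations follows from root-`n`
consistency of the estimators of the model parameters. -/
lemma op_sqrt_stacked (v : Variant) (hreg : Regular P M₁ M₀ ψ.alpha ψ.beta1 ψ.beta0)
    (hZ : IsSample P μ Z) (h0 : ∀ i, ∫ z, estFun v M₁ M₀ z ψ i ∂P = 0)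
    {ψh : ℕ × Ω → Param p q₁ q₀}
    (hroot : ∀ᶠ q in inProb μ, ∀ i, smean Z q (fun z => estFun v M₁ M₀ z (ψh q) i) = 0)
    (hα : OP μ (fun q => √(q.1 : ℝ) * ‖Param.alpha (ψh q) - ψ.alpha‖))
    (hβ₁ : OP μ (fun q => √(q.1 : ℝ) * ‖Param.beta1 (ψh q) - ψ.beta1‖))
    (hβ₀ : OP μ (fun q => √(q.1 : ℝ) * ‖Param.beta0 (ψh q) - ψ.beta0‖)) :
    OP μ (fun q => √(q.1 : ℝ) * ‖ψh q - ψ‖) := by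
  -- An intermediate point with estimated model parameters and the limits of the four scalars. Its
  -- rate is known, so the equations evaluated there are of order `n^{-1/2}`. Comparing them with
  -- the equations at `ψh`, which vanish, isolates the errors of the scalars.
  obtain ⟨ψt, hψt⟩ : ∃ ψt : ℕ × Ω → Param p q₁ q₀, ψt = fun q => Param.mk ψ.mu1 ψ.theta ψ.mbar1
    ψ.mbar0 (Param.alpha (ψh q)) (Param.beta1 (ψh q)) (Param.beta0 (ψh q)) := ⟨_, rfl⟩
  have ta (q) : Param.alpha (ψt q) = Param.alpha (ψh q) := by rw [hψt]; rfl
  have tb1 (q) : Param.beta1 (ψt q) = Param.beta1 (ψh q) := by rw [hψt]; rfl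
  have tb0 (q) : Param.beta0 (ψt q) = Param.beta0 (ψh q) := by rw [hψt]; rfl
  have tm1 (q) : Param.mu1 (ψt q) = ψ.mu1 := by rw [hψt]; rfl
  have tth (q) : Param.theta (ψt q) = ψ.theta := by rw [hψt]; rfl
  have tmb1 (q) : Param.mbar1 (ψt q) = ψ.mbar1 := by rw [hψt]; rfl
  have tmb0 (q) : Param.mbar0 (ψt q) = ψ.mbar0 := by rw [hψt]; rfl
  have hnorm (q) : ‖ψt q - ψ‖ ≤ ‖Param.alpha (ψh q) - ψ.alpha‖ + ‖Param.beta1 (ψh q) - ψ.beta1‖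
      + ‖Param.beta0 (ψh q) - ψ.beta0‖ := by
    have n1 := norm_nonneg (Param.alpha (ψh q) - ψ.alpha)
    have n2 := norm_nonneg (Param.beta1 (ψh q) - ψ.beta1)
    have n3 := norm_nonneg (Param.beta0 (ψh q) - ψ.beta0)
    refine (pi_norm_le_iff_of_nonneg (by positivity)).2 (forall_pIdx ?_ ?_ ?_ ?_ ?_ ?_ ?_)
    · rw [show (ψt q - ψ) (Sum.inl 0) = Param.mu1 (ψt q) - ψ.mu1 from rfl, tm1, sub_self, norm_zero]
      positivity
    · rw [show (ψt q - ψ) idxTheta = Param.theta (ψt q) - ψ.theta from rfl, tth, sub_self,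
        norm_zero]
      positivity
    · rw [show (ψt q - ψ) (Sum.inl 2) = Param.mbar1 (ψt q) - ψ.mbar1 from rfl, tmb1, sub_self,
        norm_zero]
      positivity
    · rw [show (ψt q - ψ) (Sum.inl 3) = Param.mbar0 (ψt q) - ψ.mbar0 from rfl, tmb0, sub_self,
        norm_zero]
      positivity
    · intro k
      rw [show (ψt q - ψ) (Sum.inr (Sum.inl k)) = (Param.alpha (ψt q) - ψ.alpha) k from rfl, ta]
      linarith [norm_le_pi_norm (Param.alpha (ψh q) - ψ.alpha) k]
    · intro k
      rw [show (ψt q - ψ) (Sum.inr (Sum.inr (Sum.inl k)))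
        = (Param.beta1 (ψt q) - ψ.beta1) k from rfl, tb1]
      linarith [norm_le_pi_norm (Param.beta1 (ψh q) - ψ.beta1) k]
    · intro k
      rw [show (ψt q - ψ) (Sum.inr (Sum.inr (Sum.inr k)))
        = (Param.beta0 (ψt q) - ψ.beta0) k from rfl, tb0]
      linarith [norm_le_pi_norm (Param.beta0 (ψh q) - ψ.beta0) k]
  have hopt : OP μ (fun q => √(q.1 : ℝ) * ‖ψt q - ψ‖) := by
    refine ((hα.add hβ₁).add hβ₀).mono (Eventually.of_forall fun q => ?_)
    rw [abs_of_nonneg (by positivity), abs_of_nonneg (by positivity), ← mul_add, ← mul_add]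
    exact mul_le_mul_of_nonneg_left (hnorm q) (Real.sqrt_nonneg _)
  have hloc : Localized μ Z wt ψt ψ :=
    Localized.of_op hZ (memLp_wt hreg.covar_sq) wt_nonneg hopt
  have hS (i : PIdx p q₁ q₀) :
      OP μ (fun q => √(q.1 : ℝ) * smean Z q (fun z => estFun v M₁ M₀ z (ψt q) i)) :=
    (estFun_memLp_and_smoothMean hreg v i).2.op_sqrt_smean wt_nonneg hZ hloc hopt
      (estFun_memLp_and_smoothMean hreg v i).1 (h0 i)
  obtain ⟨c, hc, hfrac⟩ := eventually_smean_trt_ge hreg hZ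
  have hne : ∀ᶠ q in inProb μ, q.1 ≠ 0 :=
    (tendsto_fst_inProb.eventually (eventually_ge_atTop 1)).mono fun q hq => by omega
  have ob1 : OP μ (fun q => √(q.1 : ℝ) * (Param.mbar1 (ψh q) - ψ.mbar1)) := by
    refine (hS (Sum.inl 2)).mono ?_
    filter_upwards [hroot, hne] with q h1 h2
    have h3 := h1 (Sum.inl 2)
    simp_rw [estFun_mbar1] at h3 ⊢
    rw [smean_sub, smean_const _ h2] at h3 ⊢
    rw [tb1, tmb1, sub_eq_zero.1 h3]
  have ob0 : OP μ (fun q => √(q.1 : ℝ) * (Param.mbar0 (ψh q) - ψ.mbar0)) := by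
    refine (hS (Sum.inl 3)).mono ?_
    filter_upwards [hroot, hne] with q h1 h2
    have h3 := h1 (Sum.inl 3)
    simp_rw [estFun_mbar0] at h3 ⊢
    rw [smean_sub, smean_const _ h2] at h3 ⊢
    rw [tb0, tmb0, sub_eq_zero.1 h3]
  -- Used with `a` the error of `μ̂`, `b` the error of `m̄̂` and `w` the mean weight. As the weight
  -- is at least the group fraction `c`, the equation can be solved for `a`.
  have key {n w S a b : ℝ} (hw : c ≤ w) (h : S = w * (a - b)) :
      |√n * a| ≤ |√n * b| + |c⁻¹ * (√n * S)| := by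
    have h1 : |a - b| ≤ c⁻¹ * |S| := by
      rw [h, abs_mul, abs_of_pos (hc.trans_le hw), le_inv_mul_iff₀ hc]
      gcongr
    have h2 : |a| ≤ |b| + |a - b| := by
      have := abs_add_le b (a - b)
      rwa [add_sub_cancel] at this
    simp only [abs_mul, abs_of_pos (inv_pos.2 hc)]
    rw [mul_left_comm, ← mul_add]
    exact mul_le_mul_of_nonneg_left (h2.trans (by linarith)) (abs_nonneg _)
  have om1 : OP μ (fun q => √(q.1 : ℝ) * (Param.mu1 (ψh q) - ψ.mu1)) := by
    refine (ob1.abs.add ((OP.const c⁻¹).mul (hS (Sum.inl 0))).abs).mono ?_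
    filter_upwards [hroot, hfrac] with q h1 h2
    rw [abs_of_nonneg (a := |_| + |_|) (by positivity)]
    have h3 := h1 (Sum.inl 0)
    simp_rw [estFun_mu1_eq] at h3 ⊢
    rw [smean_add, smean_mul_const] at h3 ⊢
    refine key (w := smean Z q (fun z => weight1 v z (Param.alpha (ψh q))))
      (h2.1.trans (smean_mono fun j _ => trt_le_weight1 v _ _)) ?_
    rw [tb1, ta, tmb1, tm1]
    linear_combination h3
  have om0 : OP μ (fun q => √(q.1 : ℝ)
      * ((Param.mu1 (ψh q) - Param.theta (ψh q)) - (ψ.mu1 - ψ.theta))) := by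
    refine (ob0.abs.add ((OP.const c⁻¹).mul (hS idxTheta)).abs).mono ?_
    filter_upwards [hroot, hfrac] with q h1 h2
    rw [abs_of_nonneg (a := |_| + |_|) (by positivity)]
    have h3 := h1 idxTheta
    simp_rw [estFun_theta_eq] at h3 ⊢
    rw [smean_add, smean_mul_const] at h3 ⊢
    refine key (w := smean Z q (fun z => weight0 v z (Param.alpha (ψh q))))
      (h2.2.trans (smean_mono fun j _ => one_sub_trt_le_weight0 v _ _)) ?_
    rw [tb0, ta, tmb0, tm1, tth]
    linear_combination h3
  have oth : OP μ (fun q => √(q.1 : ℝ) * (Param.theta (ψh q) - ψ.theta)) := by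
    refine (om1.add ((OP.const (-1)).mul om0)).mono (Eventually.of_forall fun q => le_of_eq ?_)
    congr 1
    ring
  have hcoord : ∀ i : PIdx p q₁ q₀, OP μ (fun q => |√(q.1 : ℝ) * (ψh q i - ψ i)|) := by
    have hle {ι : Type} [Fintype ι] {x : ℕ × Ω → ι → ℝ} {y : ι → ℝ}
        (h : OP μ (fun q => √(q.1 : ℝ) * ‖x q - y‖)) (k : ι) :
        OP μ (fun q => |√(q.1 : ℝ) * (x q k - y k)|) := by
      refine h.mono (Eventually.of_forall fun q => ?_)
      rw [abs_abs, abs_mul, abs_mul, abs_norm]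
      exact mul_le_mul_of_nonneg_left (norm_le_pi_norm (x q - y) k) (abs_nonneg _)
    exact forall_pIdx om1.abs oth.abs ob1.abs ob0.abs (hle hα) (hle hβ₁) (hle hβ₀)
  refine (OP.sum Finset.univ fun i _ => hcoord i).mono (Eventually.of_forall fun q => ?_)
  rw [abs_of_nonneg (by positivity), abs_of_nonneg (Finset.sum_nonneg fun _ _ => abs_nonneg _)]
  simp only [abs_mul, abs_of_nonneg (Real.sqrt_nonneg (q.1 : ℝ)), ← Finset.mul_sum]
  refine mul_le_mul_of_nonneg_left ?_ (Real.sqrt_nonneg _)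
  refine (pi_norm_le_iff_of_nonneg (Finset.sum_nonneg fun _ _ => abs_nonneg _)).2 fun i => ?_
  exact Finset.single_le_sum (f := fun i => |ψh q i - ψ i|) (fun _ _ => abs_nonneg _)
    (Finset.mem_univ i)

end Rate

/-! ### Matrix inverses, empirical second moments and the central limit theorem. -/

section General

variable {𝓩 Ω : Type*} [MeasurableSpace 𝓩] [MeasurableSpace Ω] {ι : Type*}
  {P : Measure 𝓩} {μ : Measure Ω} {Z : ℕ → Ω → 𝓩}

/-- The inverse is the adjugate divided by the determinant, both polynomial in the entries. -/
lemma tendsto_matrix_inv [Fintype ι] [DecidableEq ι] {α : Type*} {l : Filter α}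
    {F : α → Matrix ι ι ℝ} {A : Matrix ι ι ℝ} (h : Tendsto F l (𝓝 A)) (hA : IsUnit A.det) :
    Tendsto (fun a => (F a)⁻¹) l (𝓝 A⁻¹) := by
  simp only [Matrix.inv_def, Ring.inverse_eq_inv']
  exact (((continuous_id.matrix_det.tendsto A).comp h).inv₀ hA.ne_zero).smul
    ((continuous_id.matrix_adjugate.tendsto A).comp h)

omit [MeasurableSpace Ω] [MeasurableSpace 𝓩] in
lemma smean_neg {q : ℕ × Ω} (f : 𝓩 → ℝ) : smean Z q (fun z => -f z) = -smean Z q f := by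
  simp only [smean, Finset.sum_neg_distrib, mul_neg]

omit [MeasurableSpace 𝓩] in
-- Cauchy–Schwarz for sample means; only the second factor's mean square needs a finite limit.
lemma tendsto_smean_mul_zero {f g : ℕ × Ω → 𝓩 → ℝ} {c : ℝ}
    (hf : Tendsto (fun q => smean Z q (fun z => f q z ^ 2)) (inProb μ) (𝓝 0))
    (hg : Tendsto (fun q => smean Z q (fun z => g q z ^ 2)) (inProb μ) (𝓝 c)) :
    Tendsto (fun q => smean Z q (fun z => f q z * g q z)) (inProb μ) (𝓝 0) := by
  have h := (hf.mul hg).sqrt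
  rw [zero_mul, Real.sqrt_zero] at h
  refine squeeze_zero_norm (fun q => ?_) h
  rw [Real.norm_eq_abs]
  exact Real.abs_le_sqrt (smean_mul_sq_le _ _)

/-- Consistency of empirical second moments with estimated summands. -/
lemma tendsto_smean_mul_of_sub_sq [IsProbabilityMeasure μ] (hZ : IsSample P μ Z) {f g : 𝓩 → ℝ}
    {fh gh : ℕ × Ω → 𝓩 → ℝ} (hf : MemLp f 2 P) (hg : MemLp g 2 P)
    (hfh : Tendsto (fun q => smean Z q (fun z => (fh q z - f z) ^ 2)) (inProb μ) (𝓝 0))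
    (hgh : Tendsto (fun q => smean Z q (fun z => (gh q z - g z) ^ 2)) (inProb μ) (𝓝 0)) :
    Tendsto (fun q => smean Z q (fun z => fh q z * gh q z)) (inProb μ)
      (𝓝 (∫ z, f z * g z ∂P)) := by
  -- The product of estimated summands splits into `f g`, two mixed terms and the product of the two
  -- errors. All but the first vanish.
  have h1 : Tendsto (fun q => smean Z q (fun z => f z * g z)) (inProb μ)
      (𝓝 (∫ z, f z * g z ∂P)) := hZ.tendsto_smean (hf.integrable_mul hg)
  have h2 := tendsto_smean_mul_zero (f := fun q z => fh q z - f z) (g := fun _ => g) hfh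
    (hZ.tendsto_smean hg.integrable_sq)
  have h3 := tendsto_smean_mul_zero (f := fun q z => gh q z - g z) (g := fun _ => f) hgh
    (hZ.tendsto_smean hf.integrable_sq)
  have h4 := tendsto_smean_mul_zero (f := fun q z => fh q z - f z)
    (g := fun q z => gh q z - g z) hfh hgh
  have h5 := ((h1.add h2).add h3).add h4
  rw [add_zero, add_zero, add_zero] at h5
  refine h5.congr fun q => ?_
  rw [← smean_add, ← smean_add, ← smean_add]
  refine congrArg (smean Z q) (funext fun z => ?_)
  ring

/-- The central limit theorem for sample means. -/
lemma IsSample.tendstoInDistribution [IsProbabilityMeasure μ] (h : IsSample P μ Z) {f : 𝓩 → ℝ}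
    (hf : MemLp f 2 P) (h0 : ∫ z, f z ∂P = 0) {V : NNReal} (hV : (V : ℝ) = ∫ z, f z ^ 2 ∂P) :
    TendstoInDistribution (fun (n : ℕ) ω => √(n : ℝ) * smean Z (n, ω) f) atTop (id : ℝ → ℝ)
      (fun _ => μ) (gaussianReal 0 V) := by
  have hvar : variance (fun ω => f (Z 0 ω)) μ = V := by
    rw [variance_of_integral_eq_zero (h.memLp_comp hf 0).aestronglyMeasurable.aemeasurable
      (by rw [h.integral_comp hf.aestronglyMeasurable, h0]), hV]
    exact h.integral_comp (f := fun z => f z ^ 2) (hf.aestronglyMeasurable.pow 2) 0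
  have h1 := tendstoInDistribution_inv_sqrt_mul_sum_sub (P := μ) (P' := gaussianReal 0 V)
    (X := fun j ω => f (Z j ω)) (Y := id) (by
      rw [hvar, Real.toNNReal_coe]
      exact HasLaw.id) (h.memLp_comp hf 0)
    (h.indepFun_comp hf.aestronglyMeasurable.aemeasurable)
    (h.identDistrib_comp hf.aestronglyMeasurable.aemeasurable)
  rw [h.integral_comp hf.aestronglyMeasurable, h0] at h1
  convert h1 using 3 with n ω
  simp only [smean, mul_zero, sub_zero, ← mul_assoc]
  congr 1
  rcases eq_or_ne (n : ℝ) 0 with hn | hn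
  · simp [hn]
  · rw [← div_eq_mul_inv, Real.sqrt_div_self]

end General

/-! ### Rates for the outcome regression parameters. -/

section Nuisance

variable {p k : ℕ} {P : Measure (Obs p)} [IsProbabilityMeasure P]
  {Ω : Type*} [MeasurableSpace Ω] {μ : Measure Ω} [IsProbabilityMeasure μ] {Z : ℕ → Ω → Obs p}

/-- Consistent roots of smooth estimating equations are root-`n` consistent. -/
lemma DominatedC1.op_sqrt_root {F : Obs p → (Fin k → ℝ) → (Fin k → ℝ)} {b : Fin k → ℝ}
    (hF : DominatedC1 P F b) (hm : ∀ b', Measurable fun z => F z b')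
    (hsq : MemLp (fun z => F z b) 2 P)
    (hns : IsUnit (Matrix.det (Matrix.of fun i l => ∫ z, jacobian (F z) b i l ∂P)))
    (hZ : IsSample P μ Z) {bh : ℕ × Ω → Fin k → ℝ} (hb : Tendsto bh (inProb μ) (𝓝 b))
    (hroot : ∀ᶠ q in inProb μ, ∑ j ∈ Finset.range q.1, F (Z j q.2) (bh q) = 0) :
    (∀ i, ∫ z, F z b i ∂P = 0) ∧ OP μ (fun q => √(q.1 : ℝ) * ‖bh q - b‖) := by
  have hs (i : Fin k) : SmoothMean P (fun _ => 1) (fun z (b' : Fin k → ℝ) => F z b' i) b :=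
    (DominatedC1.component hF i).smoothMean fun b' =>
      ((measurable_pi_apply i).comp (hm b')).aestronglyMeasurable
  have hL (i : Fin k) : MemLp (fun z => F z b i) 2 P := memLp_pi_iff.1 hsq i
  have h0 := integral_eq_zero_of_root hs (fun _ => zero_le_one) hZ (Localized.of_tendsto hb) hb
    (fun i => (hL i).integrable (by simp)) hroot
  refine ⟨h0, AIPW.op_sqrt_root hs (fun _ => zero_le_one) hZ (Localized.of_tendsto hb) hL h0 ?_
    hroot⟩
  have hd : ∀ᵐ z ∂P, ∀ i, DifferentiableAt ℝ (fun b' : Fin k → ℝ => F z b' i) b :=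
    ae_all_iff.2 fun i => (hs i).differentiableAt
  have e (i l : Fin k) : ∫ z, fderiv ℝ (fun b' : Fin k → ℝ => F z b' i) b (Pi.single l 1) ∂P
      = ∫ z, jacobian (F z) b i l ∂P := by
    refine integral_congr_ae ?_
    filter_upwards [hd] with z hz
    exact (jacobian_apply (differentiableAt_pi.2 hz) i l).symm
  simp_rw [e]
  exact hns

end Nuisance

/-! ### Asymptotic linearity, normality and consistency of the sandwich. -/

section Asymptotics

variable {p q₁ q₀ : ℕ} {P : Measure (Obs p)} [IsProbabilityMeasure P]
  {M₁ : OutcomeModel p q₁} {M₀ : OutcomeModel p q₀} {ψ : Param p q₁ q₀}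
  {Ω : Type*} [MeasurableSpace Ω] {μ : Measure Ω} [IsProbabilityMeasure μ] {Z : ℕ → Ω → Obs p}
  {ψh : ℕ × Ω → Param p q₁ q₀}

omit [MeasurableSpace Ω] in
lemma differentiableAt_estEq {v : Variant} {q : ℕ × Ω} {ψ' : Param p q₁ q₀}
    (h : ∀ i, ∀ j < q.1, DifferentiableAt ℝ (fun ψ' => estFun v M₁ M₀ (Z j q.2) ψ' i) ψ') :
    DifferentiableAt ℝ (estEq v M₁ M₀ q.1 (fun j => Z j q.2)) ψ' := by
  refine differentiableAt_pi.2 fun i => ?_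
  simp_rw [estEq_apply]
  exact (DifferentiableAt.fun_sum fun j hj => h i j (Finset.mem_range.1 hj)).const_mul _

omit [MeasurableSpace Ω] in
lemma jacobian_estEq {v : Variant} {q : ℕ × Ω} {ψ' : Param p q₁ q₀}
    (h : ∀ i, ∀ j < q.1, DifferentiableAt ℝ (fun ψ' => estFun v M₁ M₀ (Z j q.2) ψ' i) ψ')
    (i l : PIdx p q₁ q₀) :
    jacobian (estEq v M₁ M₀ q.1 (fun j => Z j q.2)) ψ' i l
      = smean Z q (fun z => fderiv ℝ (fun ψ' => estFun v M₁ M₀ z ψ' i) ψ' (Pi.single l 1)) := by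
  rw [jacobian_apply (differentiableAt_estEq h)]
  simp_rw [estEq_apply]
  have h1 (j) (hj : j ∈ Finset.range q.1) := (h i j (Finset.mem_range.1 hj)).hasFDerivAt
  have h2 := (HasFDerivAt.fun_sum h1).const_mul (q.1 : ℝ)⁻¹
  have h3 : fderiv ℝ (fun ψ' => smean Z q (fun z => estFun v M₁ M₀ z ψ' i)) ψ'
      = (q.1 : ℝ)⁻¹ • ∑ j ∈ Finset.range q.1,
        fderiv ℝ (fun ψ' => estFun v M₁ M₀ (Z j q.2) ψ' i) ψ' := h2.fderiv
  rw [h3]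
  simp [smean]

variable (v : Variant) (hreg : Regular P M₁ M₀ ψ.alpha ψ.beta1 ψ.beta0) (hZ : IsSample P μ Z)
  (hop : OP μ (fun q => √(q.1 : ℝ) * ‖ψh q - ψ‖))

include hreg hZ hop

/-- The rate and the second moment of `x` together place the estimator in the neighbourhood
belonging to every sampled observation. -/
lemma localized_of_regular : Localized μ Z wt ψh ψ :=
  Localized.of_op hZ (memLp_wt hreg.covar_sq) wt_nonneg hop

lemma eventually_differentiableAt_estFun :
    ∀ᶠ q in inProb μ, ∀ i, ∀ j < q.1,
      DifferentiableAt ℝ (fun ψ' => estFun v M₁ M₀ (Z j q.2) ψ' i) (ψh q) :=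
  eventually_all.2 fun i => (estFun_memLp_and_smoothMean hreg v i).2.eventually_differentiableAt hZ
    (localized_of_regular hreg hZ hop)

lemma eventually_differentiableAt_estEq :
    ∀ᶠ q in inProb μ, DifferentiableAt ℝ (estEq v M₁ M₀ q.1 (fun j => Z j q.2)) (ψh q) :=
  (eventually_differentiableAt_estFun v hreg hZ hop).mono fun _ h => differentiableAt_estEq h

/-- The empirical Jacobian is consistent for the expected one. -/
lemma tendsto_jacobian_estEq :
    Tendsto (fun q => jacobian (estEq v M₁ M₀ q.1 (fun j => Z j q.2)) (ψh q)) (inProb μ)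
      (𝓝 (popJacobian v P M₁ M₀ ψ)) := by
  refine tendsto_pi_nhds.2 fun i => tendsto_pi_nhds.2 fun l => ?_
  rw [popJacobian_apply hreg]
  refine ((estFun_memLp_and_smoothMean hreg v i).2.tendsto_smean_fderiv hZ
    (localized_of_regular hreg hZ hop) (Pi.single l 1)).congr' ?_
  filter_upwards [eventually_differentiableAt_estFun v hreg hZ hop] with q hq
  exact (jacobian_estEq hq i l).symm

lemma eventually_isUnit_det_jacobian :
    ∀ᶠ q in inProb μ, IsUnit (jacobian (estEq v M₁ M₀ q.1 (fun j => Z j q.2)) (ψh q)).det := by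
  have h := (continuous_id.matrix_det.tendsto _).comp (tendsto_jacobian_estEq v hreg hZ hop)
  filter_upwards [h.eventually_ne (isUnit_det_popJacobian hreg v).ne_zero] with q hq
  exact isUnit_iff_ne_zero.2 hq

/-- The empirical second moment matrix of the estimating functions is consistent. -/
lemma tendsto_smean_outer :
    Tendsto (fun q => Matrix.of fun k l => smean Z q (fun z =>
      estFun v M₁ M₀ z (ψh q) k * estFun v M₁ M₀ z (ψh q) l)) (inProb μ)
      (𝓝 (popOuter v P M₁ M₀ ψ)) := by
  refine tendsto_pi_nhds.2 fun k => tendsto_pi_nhds.2 fun l => ?_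
  have hd (i) := (estFun_memLp_and_smoothMean hreg v i).2.tendsto_smean_sub_sq wt_nonneg hZ
    (localized_of_regular hreg hZ hop) hop
  change Tendsto (fun q => smean Z q (fun z => estFun v M₁ M₀ z (ψh q) k
    * estFun v M₁ M₀ z (ψh q) l)) (inProb μ)
    (𝓝 (∫ z, estFun v M₁ M₀ z ψ k * estFun v M₁ M₀ z ψ l ∂P))
  exact tendsto_smean_mul_of_sub_sq hZ (fh := fun q z => estFun v M₁ M₀ z (ψh q) k)
    (gh := fun q z => estFun v M₁ M₀ z (ψh q) l) (estFun_memLp_and_smoothMean hreg v k).1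
    (estFun_memLp_and_smoothMean hreg v l).1 (hd k) (hd l)

omit [MeasurableSpace Ω] [IsProbabilityMeasure μ] hreg hZ hop [IsProbabilityMeasure P] in
lemma smul_sandwich {q : ℕ × Ω} (hq : q.1 ≠ 0) (ψ' : Param p q₁ q₀) :
    (q.1 : ℝ) • sandwich v M₁ M₀ q.1 (fun j => Z j q.2) ψ'
      = (jacobian (estEq v M₁ M₀ q.1 (fun j => Z j q.2)) ψ')⁻¹
        * (Matrix.of fun k l => smean Z q (fun z =>
          estFun v M₁ M₀ z ψ' k * estFun v M₁ M₀ z ψ' l))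
        * ((jacobian (estEq v M₁ M₀ q.1 (fun j => Z j q.2)) ψ').transpose)⁻¹ := by
  have hn : (q.1 : ℝ) ≠ 0 := Nat.cast_ne_zero.2 hq
  rw [sandwich, ← Matrix.smul_mul, ← Matrix.mul_smul]
  congr 2
  ext k l
  simp only [Matrix.smul_apply, Matrix.sum_apply, Matrix.vecMulVec_apply, Matrix.of_apply,
    smul_eq_mul, smean]
  field_simp

/-- The sandwich variance estimator is consistent. -/
lemma tendsto_sandwich :
    Tendsto (fun q => (q.1 : ℝ) * sandwich v M₁ M₀ q.1 (fun j => Z j q.2) (ψh q)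
      idxTheta idxTheta) (inProb μ) (𝓝 (popSandwich v P M₁ M₀ ψ idxTheta idxTheta)) := by
  have hJ := tendsto_jacobian_estEq v hreg hZ hop
  have hA := isUnit_det_popJacobian hreg v
  have hJt := (continuous_id.matrix_transpose.tendsto _).comp hJ
  have h1 := ((tendsto_matrix_inv hJ hA).mul (tendsto_smean_outer v hreg hZ hop)).mul
    (tendsto_matrix_inv hJt (by rwa [id, Matrix.det_transpose]))
  have h2 := tendsto_pi_nhds.1 (tendsto_pi_nhds.1 h1 idxTheta) idxTheta
  refine h2.congr' ?_
  filter_upwards [tendsto_fst_inProb.eventually (eventually_ge_atTop 1)] with q hq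
  have := congrFun (congrFun (smul_sandwich (M₁ := M₁) (M₀ := M₀) (Z := Z) v (q := q)
    (by omega) (ψh q)) idxTheta) idxTheta
  rw [Matrix.smul_apply, smul_eq_mul] at this
  rw [this]
  rfl

/-- Asymptotic linearity of the solution of the stacked estimating equations. -/
lemma tendsto_linearization
    (hroot : ∀ᶠ q in inProb μ, ∀ i, smean Z q (fun z => estFun v M₁ M₀ z (ψh q) i) = 0)
    (i : PIdx p q₁ q₀) :
    Tendsto (fun q => √(q.1 : ℝ) * (ψh q i - ψ i) - √(q.1 : ℝ) * smean Z q (fun z =>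
      ∑ k, (popJacobian v P M₁ M₀ ψ)⁻¹ i k * -estFun v M₁ M₀ z ψ k)) (inProb μ) (𝓝 0) := by
  set A := popJacobian v P M₁ M₀ ψ with hA
  have hdet : IsUnit A.det := isUnit_det_popJacobian hreg v
  -- The expansion leaves a remainder at most `R ‖ψh - ψ‖` with `R → 0`. Multiplied by `√n` it still
  -- vanishes, by the root-`n` rate.
  have hrow (k) : Tendsto (fun q => √(q.1 : ℝ) * (A.mulVec (ψh q - ψ) k
      + smean Z q (fun z => estFun v M₁ M₀ z ψ k))) (inProb μ) (𝓝 0) := by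
    obtain ⟨R, hR, hexp⟩ := (estFun_memLp_and_smoothMean hreg v k).2.expansion wt_nonneg hZ
      (localized_of_regular hreg hZ hop)
    refine squeeze_zero_norm' ?_ (hop R hR)
    filter_upwards [hroot] with q hq
    have h1 := hexp q
    rw [hq k] at h1
    have h2 : A.mulVec (ψh q - ψ) k = ∑ l, (∫ z, fderiv ℝ (fun ψ' => estFun v M₁ M₀ z ψ' k) ψ
        (Pi.single l 1) ∂P) * (ψh q l - ψ l) := by
      simp only [Matrix.mulVec, dotProduct, hA, popJacobian_apply hreg, Pi.sub_apply]
    rw [h2, Real.norm_eq_abs, abs_mul, abs_of_nonneg (Real.sqrt_nonneg _), mul_assoc, mul_comm ‖_‖]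
    refine mul_le_mul_of_nonneg_left (le_trans (le_of_eq ?_) h1) (Real.sqrt_nonneg _)
    rw [← abs_neg]
    congr 1
    ring
  have hsum : Tendsto (fun q => ∑ k, A⁻¹ i k * (√(q.1 : ℝ) * (A.mulVec (ψh q - ψ) k
      + smean Z q (fun z => estFun v M₁ M₀ z ψ k)))) (inProb μ) (𝓝 0) := by
    rw [show (0 : ℝ) = ∑ k, A⁻¹ i k * 0 by simp]
    exact tendsto_finsetSum _ fun k _ => (hrow k).const_mul _
  refine hsum.congr fun q => ?_
  have h1 : ψh q i - ψ i = ∑ k, A⁻¹ i k * A.mulVec (ψh q - ψ) k := by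
    have h2 : A⁻¹.mulVec (A.mulVec (ψh q - ψ)) = ψh q - ψ := by
      rw [Matrix.mulVec_mulVec, Matrix.nonsing_inv_mul _ hdet, Matrix.one_mulVec]
    exact (congrFun h2 i).symm
  have h2 : smean Z q (fun z => ∑ k, A⁻¹ i k * -estFun v M₁ M₀ z ψ k)
      = -∑ k, A⁻¹ i k * smean Z q (fun z => estFun v M₁ M₀ z ψ k) := by
    rw [smean_sum, ← Finset.sum_neg_distrib]
    refine Finset.sum_congr rfl fun k _ => ?_
    rw [smean_const_mul, smean_neg, mul_neg]
  rw [h1, h2, mul_neg, sub_neg_eq_add, ← mul_add, ← Finset.sum_add_distrib, Finset.mul_sum]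
  refine Finset.sum_congr rfl fun k _ => ?_
  ring

omit hZ hop in
lemma memLp_influence (i : PIdx p q₁ q₀) :
    MemLp (fun z => ∑ k, (popJacobian v P M₁ M₀ ψ)⁻¹ i k * -estFun v M₁ M₀ z ψ k) 2 P :=
  memLp_finsetSum _ fun k _ => (estFun_memLp_and_smoothMean hreg v k).1.neg.const_mul _

omit hZ hop in
/-- The sandwich form of the variance of the influence function. -/
lemma popSandwich_eq_integral_sq (i : PIdx p q₁ q₀) :
    popSandwich v P M₁ M₀ ψ i i
      = ∫ z, (∑ k, (popJacobian v P M₁ M₀ ψ)⁻¹ i k * -estFun v M₁ M₀ z ψ k) ^ 2 ∂P := by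
  set A := popJacobian v P M₁ M₀ ψ
  have hint (k l) : Integrable (fun z => estFun v M₁ M₀ z ψ k * estFun v M₁ M₀ z ψ l) P :=
    (estFun_memLp_and_smoothMean hreg v k).1.integrable_mul (estFun_memLp_and_smoothMean hreg v l).1
  have e (z : Obs p) : (∑ k, A⁻¹ i k * -estFun v M₁ M₀ z ψ k) ^ 2
      = ∑ l, ∑ k, (A⁻¹ i k * A⁻¹ i l) * (estFun v M₁ M₀ z ψ k * estFun v M₁ M₀ z ψ l) := by
    rw [sq, Finset.sum_mul_sum, Finset.sum_comm]
    exact Finset.sum_congr rfl fun l _ => Finset.sum_congr rfl fun k _ => by ring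
  simp_rw [e]
  rw [integral_finsetSum _ fun l _ => integrable_finsetSum _ fun k _ => (hint k l).const_mul _]
  simp only [popSandwich, Matrix.mul_apply, ← Matrix.transpose_nonsing_inv, Matrix.transpose_apply]
  refine Finset.sum_congr rfl fun l _ => ?_
  rw [integral_finsetSum _ fun k _ => (hint k l).const_mul _, Finset.sum_mul]
  refine Finset.sum_congr rfl fun k _ => ?_
  rw [integral_const_mul]
  simp only [popOuter, Matrix.of_apply, A]
  ring

/-- Slutsky: the scaled error differs by a term vanishing in probability from the scaled sample mean
of the influence function, to which the central limit theorem applies. -/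
lemma tendstoInDistribution_theta (h0 : ∀ i, ∫ z, estFun v M₁ M₀ z ψ i ∂P = 0)
    (hroot : ∀ᶠ q in inProb μ, ∀ i, smean Z q (fun z => estFun v M₁ M₀ z (ψh q) i) = 0)
    (i : PIdx p q₁ q₀) (hm : ∀ n, AEMeasurable (fun ω => ψh (n, ω) i) μ) {V : NNReal}
    (hV : (V : ℝ) = popSandwich v P M₁ M₀ ψ i i) :
    TendstoInDistribution (fun (n : ℕ) ω => √(n : ℝ) * (ψh (n, ω) i - ψ i)) atTop (id : ℝ → ℝ)
      (fun _ => μ) (gaussianReal 0 V) := by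
  rw [popSandwich_eq_integral_sq v hreg] at hV
  have hmean : ∫ z, ∑ k, (popJacobian v P M₁ M₀ ψ)⁻¹ i k * -estFun v M₁ M₀ z ψ k ∂P = 0 := by
    have hint (k : PIdx p q₁ q₀) : Integrable (fun z => -estFun v M₁ M₀ z ψ k) P :=
      ((estFun_memLp_and_smoothMean hreg v k).1.integrable (by simp)).neg
    rw [integral_finsetSum _ fun k _ => (hint k).const_mul _]
    refine Finset.sum_eq_zero fun k _ => ?_
    rw [integral_const_mul, integral_neg, h0 k, neg_zero, mul_zero]
  refine tendstoInDistribution_of_tendstoInMeasure_sub _ _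
    (hZ.tendstoInDistribution (memLp_influence v hreg i) hmean hV)
    (tendsto_inProb_iff.1 (tendsto_linearization v hreg hZ hop hroot i)) fun n => ?_
  exact ((hm n).sub_const _).const_mul _

end Asymptotics

/-! ### Weighted integrals determined by rectangles. -/

section Weighted

variable {Ω α β : Type*} {mΩ : MeasurableSpace Ω} [MeasurableSpace α] [MeasurableSpace β]
  {P : Measure Ω}

/-- Nonnegative functions whose integrals over rectangles agree give the same weighted integrals. -/
lemma integral_mul_comp_eq_of_rectangles {f₁ f₂ : Ω → ℝ} (h₁ : Integrable f₁ P)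
    (h₂ : Integrable f₂ P) (h₁0 : 0 ≤ᵐ[P] f₁) (h₂0 : 0 ≤ᵐ[P] f₂) {X : Ω → α} {Y : Ω → β}
    (hX : Measurable X) (hY : Measurable Y)
    (h : ∀ s t, MeasurableSet s → MeasurableSet t →
      ∫ ω in X ⁻¹' s ∩ Y ⁻¹' t, f₁ ω ∂P = ∫ ω in X ⁻¹' s ∩ Y ⁻¹' t, f₂ ω ∂P)
    {g : α × β → ℝ} (hg : Measurable g) :
    ∫ ω, f₁ ω * g (X ω, Y ω) ∂P = ∫ ω, f₂ ω * g (X ω, Y ω) ∂P := by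
  have hφ : Measurable fun ω => (X ω, Y ω) := hX.prodMk hY
  have := isFiniteMeasure_withDensity_ofReal h₁.2
  -- The two weighted laws of `(X, Y)` are finite and agree on rectangles, hence are equal.
  -- Integrals of `g` then coincide even when `g` is not integrable.
  have key : (P.withDensity fun ω => ENNReal.ofReal (f₁ ω)).map (fun ω => (X ω, Y ω))
      = (P.withDensity fun ω => ENNReal.ofReal (f₂ ω)).map (fun ω => (X ω, Y ω)) := by
    refine Measure.ext_prod fun {s t} hs ht => ?_
    have hst : MeasurableSet (X ⁻¹' s ∩ Y ⁻¹' t) := (hX hs).inter (hY ht)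
    rw [Measure.map_apply hφ (hs.prod ht), Measure.map_apply hφ (hs.prod ht), mk_preimage_prod,
      withDensity_apply _ hst, withDensity_apply _ hst,
      ← ofReal_integral_eq_lintegral_ofReal h₁.restrict (ae_restrict_of_ae h₁0),
      ← ofReal_integral_eq_lintegral_ofReal h₂.restrict (ae_restrict_of_ae h₂0), h s t hs ht]
  have e {f : Ω → ℝ} (hf : Integrable f P) (hf0 : 0 ≤ᵐ[P] f) :
      ∫ ω, f ω * g (X ω, Y ω) ∂P
        = ∫ y, g y ∂((P.withDensity fun ω => ENNReal.ofReal (f ω)).map fun ω => (X ω, Y ω)) := by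
    rw [integral_map hφ.aemeasurable hg.aestronglyMeasurable,
      integral_withDensity_eq_integral_toReal_smul₀ hf.aemeasurable.ennreal_ofReal
        (Eventually.of_forall fun _ => ENNReal.ofReal_lt_top)]
    refine integral_congr_ae ?_
    filter_upwards [hf0] with ω hω
    rw [ENNReal.toReal_ofReal hω, smul_eq_mul]
  rw [e h₁ h₁0, e h₂ h₂0, key]

end Weighted

/-! ### Double robustness under strong ignorability. -/

section Ignorability

variable {p q : ℕ} {P : Measure (Obs p)} [IsProbabilityMeasure P]

/-- Under strong ignorability the indicator of a treatment group may be replaced by its conditional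
probability given the covariates. -/
lemma SITA.integral_indicator_mul (h : SITA P) {s : Set ℝ} (hs : MeasurableSet s)
    {g : (Fin p → ℝ) × (ℝ × ℝ) → ℝ} (hg : Measurable g) :
    ∫ z, (trt ⁻¹' s).indicator (fun _ => (1 : ℝ)) z * g (covar z, (y1 z, y0 z)) ∂P
      = ∫ z, (P[(trt ⁻¹' s).indicator (fun _ => (1 : ℝ)) | covarSigma p]) z
        * g (covar z, (y1 z, y0 z)) ∂P := by
  have hm := covarSigma_le p
  have hS : MeasurableSet ((trt : Obs p → ℝ) ⁻¹' s) := measurable_trt hs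
  have hi : Integrable ((trt ⁻¹' s).indicator (fun _ : Obs p => (1 : ℝ))) P :=
    (integrable_const _).indicator hS
  have hY : Measurable fun z : Obs p => (y1 z, y0 z) := measurable_y1.prodMk measurable_y0
  refine integral_mul_comp_eq_of_rectangles hi integrable_condExp
    (Eventually.of_forall fun z => indicator_nonneg (fun _ _ => zero_le_one) _)
    (condExp_nonneg (Eventually.of_forall fun z => indicator_nonneg (fun _ _ => zero_le_one) _))
    measurable_covar hY (fun c t hc ht => ?_) hg
  have hC : MeasurableSet[covarSigma p] (covar ⁻¹' c : Set (Obs p)) := ⟨c, hc, rfl⟩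
  have hD : MeasurableSet ((fun z : Obs p => (y1 z, y0 z)) ⁻¹' t) := hY ht
  have hci := (condIndepFun_iff_condExp_inter_preimage_eq_mul measurable_trt hY).1 h s t hs ht
  set D := (fun z : Obs p => (y1 z, y0 z)) ⁻¹' t
  set S := (trt : Obs p → ℝ) ⁻¹' s
  set C := (covar ⁻¹' c : Set (Obs p))
  have hDi : Integrable (D.indicator (fun _ : Obs p => (1 : ℝ))) P :=
    (integrable_const _).indicator hD
  have e1 : D.indicator (S.indicator fun _ : Obs p => (1 : ℝ)) = (S ∩ D).indicator fun _ => 1 := by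
    rw [indicator_indicator, inter_comm]
  have e2 : D.indicator (P[S.indicator fun _ => (1 : ℝ) | covarSigma p])
      = P[S.indicator fun _ => (1 : ℝ) | covarSigma p] * D.indicator fun _ => (1 : ℝ) := by
    funext z
    by_cases hz : z ∈ D <;> simp [hz]
  have hpi : Integrable (P[S.indicator fun _ => (1 : ℝ) | covarSigma p]
      * D.indicator fun _ => (1 : ℝ)) P := by
    rw [← e2]
    exact integrable_condExp.indicator hD
  -- Both sides become integrals over `C` of conditional expectations: `P(S ∩ D ∣ x)` on the left,
  -- and on the right `P(S ∣ x) P(D ∣ x)` after pulling out the `x`-measurable factor. Conditional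
  -- independence equates them.
  rw [← setIntegral_indicator hD, ← setIntegral_indicator hD, e1, e2,
    ← setIntegral_condExp hm ((integrable_const _).indicator (hS.inter hD)) hC,
    ← setIntegral_condExp hm hpi hC]
  refine integral_congr_ae (ae_restrict_of_ae ?_)
  filter_upwards [hci, condExp_mul_of_stronglyMeasurable_left stronglyMeasurable_condExp hpi hDi]
    with z h1 h2
  rw [h1, h2, Pi.mul_apply]

lemma SITA.integral_trt_mul (h : SITA P) {g : (Fin p → ℝ) × (ℝ × ℝ) → ℝ} (hg : Measurable g) :
    ∫ z, trt z * g (covar z, (y1 z, y0 z)) ∂P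
      = ∫ z, (P[trt | covarSigma p]) z * g (covar z, (y1 z, y0 z)) ∂P := by
  have e : ((trt : Obs p → ℝ) ⁻¹' {1}).indicator (fun _ => (1 : ℝ)) = trt := by
    funext z
    rcases trt_eq_zero_or_one z with hz | hz <;> simp [indicator, hz]
  have := h.integral_indicator_mul (measurableSet_singleton 1) hg
  rwa [e] at this

lemma SITA.integral_one_sub_trt_mul (h : SITA P) {g : (Fin p → ℝ) × (ℝ × ℝ) → ℝ}
    (hg : Measurable g) :
    ∫ z, (1 - trt z) * g (covar z, (y1 z, y0 z)) ∂P
      = ∫ z, (P[fun z => 1 - trt z | covarSigma p]) z * g (covar z, (y1 z, y0 z)) ∂P := by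
  have e : ((trt : Obs p → ℝ) ⁻¹' {0}).indicator (fun _ => (1 : ℝ)) = fun z => 1 - trt z := by
    funext z
    rcases trt_eq_zero_or_one z with hz | hz <;> simp [indicator, hz]
  have := h.integral_indicator_mul (measurableSet_singleton 0) hg
  rwa [e] at this

/-- Inverse probability weighting with the true propensity score. -/
lemma integral_ipw_of_ps_correct {t Y m e : Obs p → ℝ} (he0 : ∀ z, 0 < e z)
    (ht : ∀ g : (Fin p → ℝ) × (ℝ × ℝ) → ℝ, Measurable g →
      ∫ z, t z * g (covar z, (y1 z, y0 z)) ∂P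
        = ∫ z, (P[t | covarSigma p]) z * g (covar z, (y1 z, y0 z)) ∂P)
    (he : P[t | covarSigma p] =ᵐ[P] e) {g : (Fin p → ℝ) × (ℝ × ℝ) → ℝ} (hg : Measurable g)
    {e' : (Fin p → ℝ) → ℝ} (he' : Measurable e') (hee' : ∀ z, e z = e' (covar z))
    (hYm : ∀ z, Y z - m z = g (covar z, (y1 z, y0 z))) (hY : Integrable Y P)
    (hm : Integrable m P) :
    ∫ z, t z * (Y z - m z) / e z ∂P = (∫ z, Y z ∂P) - ∫ z, m z ∂P
      ∧ ∫ z, t z / e z ∂P = 1 := by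
  constructor
  · rw [← integral_sub hY hm]
    have h1 := ht (fun y => g y / e' y.1) (by fun_prop)
    simp only [← hYm, ← hee', ← mul_div_assoc] at h1
    rw [h1]
    refine integral_congr_ae ?_
    filter_upwards [he] with z hz
    rw [hz, mul_div_cancel_left₀ _ (he0 z).ne']
  · have h1 := ht (fun y => 1 / e' y.1) (by fun_prop)
    simp only [← hee', ← mul_div_assoc, mul_one] at h1
    rw [h1, integral_congr_ae (g := fun _ => (1 : ℝ))]
    · simp
    · filter_upwards [he] with z hz
      rw [hz, div_self (he0 z).ne']

/-- Weighted residuals of a correct regression model have mean zero. -/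
lemma integral_ipw_of_or_correct {t Y m e : Obs p → ℝ} {c : ℝ} (hc : 0 < c)
    (hec : ∀ᵐ z ∂P, c ≤ e z) (htm : Measurable t) (ht1 : ∀ z, |t z| ≤ 1)
    (ht : ∀ g : (Fin p → ℝ) × (ℝ × ℝ) → ℝ, Measurable g →
      ∫ z, t z * g (covar z, (y1 z, y0 z)) ∂P
        = ∫ z, (P[t | covarSigma p]) z * g (covar z, (y1 z, y0 z)) ∂P)
    {g : (Fin p → ℝ) × (ℝ × ℝ) → ℝ} (hg : Measurable g)
    {e' m' : (Fin p → ℝ) → ℝ} (he' : Measurable e') (hee' : ∀ z, e z = e' (covar z))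
    (hm' : Measurable m') (hmm' : ∀ z, m z = m' (covar z))
    (hYm : ∀ z, Y z - m z = g (covar z, (y1 z, y0 z))) (hY : Integrable Y P)
    (hm : Integrable m P) (hcor : P[Y | covarSigma p] =ᵐ[P] m) :
    ∫ z, t z * (Y z - m z) / e z ∂P = 0 := by
  have hle := covarSigma_le p
  have hcov : Measurable[covarSigma p] (covar : Obs p → Fin p → ℝ) := comap_measurable _
  have h1 := ht (fun y => g y / e' y.1) (by fun_prop)
  simp only [← hYm, ← hee', ← mul_div_assoc] at h1
  rw [h1]
  have hti : Integrable t P := (integrable_const (1 : ℝ)).mono' htm.aestronglyMeasurable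
    (Eventually.of_forall ht1)
  have hpi : ∀ᵐ z ∂P, |(P[t | covarSigma p]) z| ≤ 1 :=
    ae_bdd_abs_condExp_of_ae_bdd_abs (R := (1 : ℝ)) (Eventually.of_forall ht1)
  -- After the treatment indicator is replaced by its conditional mean, the weight is a bounded
  -- function of `x`. It can be pulled out of the conditional expectation, leaving `E(Y - m ∣ x) =
  -- 0`.
  set w : Obs p → ℝ := fun z => (P[t | covarSigma p]) z / e z with hw
  have hwm : StronglyMeasurable[covarSigma p] w := by
    have e1 : StronglyMeasurable[covarSigma p] e := by
      rw [show e = fun z => e' (covar z) from funext hee']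
      exact (he'.comp hcov).stronglyMeasurable
    exact stronglyMeasurable_condExp.div e1
  have hwb : ∀ᵐ z ∂P, ‖w z‖ ≤ c⁻¹ := by
    filter_upwards [hpi, hec] with z h2 h3
    have h4 : 0 < e z := hc.trans_le h3
    rw [hw, Real.norm_eq_abs, abs_div, abs_of_pos h4, ← one_div]
    exact div_le_div₀ zero_le_one h2 hc h3
  have h2 := condExp_stronglyMeasurable_mul_of_bound hle hwm (hY.sub hm) _ hwb
  have hmm : P[m | covarSigma p] = m := by
    refine condExp_of_stronglyMeasurable hle ?_ hm
    rw [show m = fun z => m' (covar z) from funext hmm']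
    exact (hm'.comp hcov).stronglyMeasurable
  have h3 : P[w * (Y - m) | covarSigma p] =ᵐ[P] 0 := by
    filter_upwards [h2, condExp_sub hY hm (covarSigma p), hcor] with z h4 h5 h6
    rw [h4, Pi.mul_apply, h5, Pi.sub_apply, h6, hmm, sub_self, mul_zero, Pi.zero_apply]
  have h4 : ∫ z, (w * (Y - m)) z ∂P = 0 := by
    rw [← integral_condExp hle, integral_congr_ae h3]
    simp
  rw [← h4]
  refine integral_congr_ae (Eventually.of_forall fun z => ?_)
  simp only [hw, Pi.mul_apply, Pi.sub_apply]
  ring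

/-- If the propensity score model is correct, the root of the population score equations gives the
true propensity score. -/
lemma condExp_trt_of_psCorrect (h : SITA P) (hps : PSCorrect P) {α : Fin (p + 1) → ℝ}
    (hx : MemLp (covar : Obs p → Fin p → ℝ) 2 P) (hα : IsPopScoreRoot P α) :
    P[trt | covarSigma p] =ᵐ[P] fun z => ps (covar z) α := by
  obtain ⟨α', hα'⟩ := hps
  have hxi (k) : Integrable (fun z : Obs p => xt (covar z) k) P := (memLp_xt hx k).integrable (by simp)
  have hb {f : Obs p → ℝ} (hf : Measurable f) (hf1 : ∀ z, |f z| ≤ 1) (k) :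
      Integrable (fun z => f z * xt (covar z) k) P :=
    (hxi k).bdd_mul (c := 1) hf.aestronglyMeasurable (Eventually.of_forall hf1)
  have hps1 (a : Fin (p + 1) → ℝ) (z : Obs p) : |ps (covar z) a| ≤ 1 := by
    rw [ps_eq, abs_of_pos (expit_pos _)]
    exact (expit_lt_one _).le
  have hscore (k) : ∫ z, (ps (covar z) α' - ps (covar z) α) * xt (covar z) k ∂P = 0 := by
    have h1 := h.integral_trt_mul (g := fun y => xt y.1 k)
      ((measurable_pi_apply k).comp (measurable_xt.comp measurable_fst))
    have h2 : ∫ z, (P[trt | covarSigma p]) z * xt (covar z) k ∂P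
        = ∫ z, ps (covar z) α' * xt (covar z) k ∂P := by
      refine integral_congr_ae ?_
      filter_upwards [hα'] with z hz
      rw [hz]
    have h3 := hα k
    simp only [sub_mul]
    rw [integral_sub (hb (measurable_ps_covar α') (hps1 α') k)
      (hb (measurable_ps_covar α) (hps1 α) k), ← h2, ← h1,
      ← integral_sub (hb measurable_trt abs_trt_le k) (hb (measurable_ps_covar α) (hps1 α) k), ← h3]
    refine integral_congr_ae (Eventually.of_forall fun z => ?_)
    simp only
    ring
  have hdi (k) : Integrable (fun z => (ps (covar z) α' - ps (covar z) α) * xt (covar z) k) P := by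
    simp only [sub_mul]
    exact (hb (measurable_ps_covar α') (hps1 α') k).sub (hb (measurable_ps_covar α) (hps1 α) k)
  have e (z : Obs p) : (ps (covar z) α' - ps (covar z) α) * (xt (covar z) ⬝ᵥ (α' - α))
      = ∑ k, (ps (covar z) α' - ps (covar z) α) * xt (covar z) k * (α' - α) k := by
    simp only [dotProduct, Finset.mul_sum, mul_assoc]
  -- Both `α'` and `α` solve the score equations, so the difference tested against `α' - α`
  -- integrates to zero. By monotonicity of the logistic function the integrand is nonnegative,
  -- hence zero almost everywhere, and there the two scores agree.
  have hsum : ∫ z, (ps (covar z) α' - ps (covar z) α) * (xt (covar z) ⬝ᵥ (α' - α)) ∂P = 0 := by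
    simp_rw [e]
    rw [integral_finsetSum _ fun k _ => (hdi k).mul_const _]
    exact Finset.sum_eq_zero fun k _ => by rw [integral_mul_const, hscore k, zero_mul]
  have hint : Integrable (fun z => (ps (covar z) α' - ps (covar z) α)
      * (xt (covar z) ⬝ᵥ (α' - α))) P := by
    simp_rw [e]
    exact integrable_finsetSum _ fun k _ => (hdi k).mul_const _
  have hnn (z : Obs p) : 0 ≤ (ps (covar z) α' - ps (covar z) α) * (xt (covar z) ⬝ᵥ (α' - α)) := by
    rw [ps_eq, ps_eq, dotProduct_sub]
    rcases le_total (xt (covar z) ⬝ᵥ α) (xt (covar z) ⬝ᵥ α') with hle | hle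
    · exact mul_nonneg (sub_nonneg.2 (strictMono_expit.monotone hle)) (sub_nonneg.2 hle)
    · exact mul_nonneg_of_nonpos_of_nonpos (sub_nonpos.2 (strictMono_expit.monotone hle))
        (sub_nonpos.2 hle)
  filter_upwards [hα', (integral_eq_zero_iff_of_nonneg hnn hint).1 hsum] with z h1 h2
  rw [h1]
  rcases mul_eq_zero.1 h2 with h3 | h3
  · exact sub_eq_zero.1 h3
  · rw [dotProduct_sub, sub_eq_zero] at h3
    rw [ps_eq, ps_eq, h3]

variable {q₁ q₀ : ℕ} {M₁ : OutcomeModel p q₁} {M₀ : OutcomeModel p q₀} {α : Fin (p + 1) → ℝ}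
  {β₁ : Fin q₁ → ℝ} {β₀ : Fin q₀ → ℝ}

/-- Double robustness of the limits of the estimators. -/
lemma thetaStar_eq (v : Variant) (hreg : Regular P M₁ M₀ α β₁ β₀) (hα : IsPopScoreRoot P α)
    (h : SITA P) (hcor : PSCorrect P ∨ ORCorrect P M₁ M₀ β₁ β₀) :
    thetaStar v P M₁ M₀ α β₁ β₀ = (∫ z, y1 z ∂P) - ∫ z, y0 z ∂P := by
  have hpsm : Measurable fun x : Fin p → ℝ => ps x α :=
    measurable_ps.comp (measurable_id.prodMk measurable_const)
  have hm1 : Measurable fun x : Fin p → ℝ => M₁.m x β₁ :=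
    M₁.measurable_m.comp (measurable_id.prodMk measurable_const)
  have hm0 : Measurable fun x : Fin p → ℝ => M₀.m x β₀ :=
    M₀.measurable_m.comp (measurable_id.prodMk measurable_const)
  have iy1 : Integrable (y1 : Obs p → ℝ) P := hreg.y1_sq.integrable (by simp)
  have iy0 : Integrable (y0 : Obs p → ℝ) P := hreg.y0_sq.integrable (by simp)
  have im1 := hreg.m1_sq.integrable (by simp)
  have im0 := hreg.m0_sq.integrable (by simp)
  have hg1 : Measurable fun y : (Fin p → ℝ) × (ℝ × ℝ) => y.2.1 - M₁.m y.1 β₁ :=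
    (measurable_fst.comp measurable_snd).sub (hm1.comp measurable_fst)
  have hg0 : Measurable fun y : (Fin p → ℝ) × (ℝ × ℝ) => y.2.2 - M₀.m y.1 β₀ :=
    (measurable_snd.comp measurable_snd).sub (hm0.comp measurable_fst)
  rcases hcor with hps | ⟨ho1, ho0⟩
  · have hp1 := condExp_trt_of_psCorrect h hps hreg.covar_sq hα
    have hp0 : P[fun z => 1 - trt z | covarSigma p] =ᵐ[P] fun z => 1 - ps (covar z) α := by
      filter_upwards [hp1, condExp_sub (integrable_const (1 : ℝ)) (integrable_trt (P := P))
        (covarSigma p)] with z h1 h2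
      rw [← h1]
      refine h2.trans ?_
      rw [Pi.sub_apply, condExp_const (covarSigma_le p)]
    obtain ⟨a1, b1⟩ := integral_ipw_of_ps_correct (e := fun z => ps (covar z) α) (fun z => expit_pos _)
      (fun g => h.integral_trt_mul) hp1 hg1 hpsm (fun z => rfl)
      (Y := y1) (m := fun z => M₁.m (covar z) β₁) (fun z => rfl) iy1 im1
    obtain ⟨a0, b0⟩ := integral_ipw_of_ps_correct (e := fun z => 1 - ps (covar z) α)
      (t := fun z => 1 - trt z) (fun z => sub_pos.2 (expit_lt_one _))
      (fun g => h.integral_one_sub_trt_mul) hp0 hg0 (measurable_const.sub hpsm) (fun z => rfl)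
      (Y := y0) (m := fun z => M₀.m (covar z) β₀) (fun z => rfl) iy0 im0
    -- With the true propensity score the Hájek denominators equal one, so both variants have the
    -- same limit and the regression means cancel.
    cases v <;> simp only [thetaStar, mu1Star, mu0Star, a1, b1, a0, b0] <;> ring
  · obtain ⟨c₁, c₂, hc₁, hc₂, hov⟩ := hreg.overlap
    have a1 := integral_ipw_of_or_correct hc₁ (hov.mono fun z hz => hz.1) measurable_trt abs_trt_le
      (fun g => h.integral_trt_mul) hg1 hpsm (fun z => rfl) hm1 (fun z => rfl)
      (Y := y1) (m := fun z => M₁.m (covar z) β₁) (fun z => rfl) iy1 im1 ho1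
    have a0 := integral_ipw_of_or_correct (e := fun z => 1 - ps (covar z) α)
      (t := fun z => 1 - trt z) (sub_pos.2 hc₂)
      (hov.mono fun z hz => sub_le_sub_left hz.2 1)
      (measurable_const.sub measurable_trt) abs_one_sub_trt_le
      (fun g => h.integral_one_sub_trt_mul) hg0 (measurable_const.sub hpsm) (fun z => rfl) hm0
      (fun z => rfl) (Y := y0) (m := fun z => M₀.m (covar z) β₀) (fun z => rfl) iy0 im0 ho0
    -- The weighted residuals contribute zero to either variant, so only the means of the
    -- regressions remain.
    have c1 : ∫ z, M₁.m (covar z) β₁ ∂P = ∫ z, y1 z ∂P := by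
      rw [← integral_congr_ae ho1, integral_condExp (covarSigma_le p)]
    have c0 : ∫ z, M₀.m (covar z) β₀ ∂P = ∫ z, y0 z ∂P := by
      rw [← integral_congr_ae ho0, integral_condExp (covarSigma_le p)]
    cases v <;> simp only [thetaStar, mu1Star, mu0Star, a1, a0, c1, c0, zero_div, zero_add]

end Ignorability

/-! ### Measurability of the estimators. -/

section Measurability

variable {p q₁ q₀ q : ℕ} {Ω : Type*} [MeasurableSpace Ω] {Z : ℕ → Ω → Obs p}

lemma measurable_ps_apply {x : Ω → Fin p → ℝ} {α : Ω → Fin (p + 1) → ℝ} (hx : Measurable x)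
    (hα : Measurable α) : Measurable fun ω => ps (x ω) (α ω) := by
  have h : Measurable (Function.uncurry (ps (p := p)) ∘ fun ω => (x ω, α ω)) :=
    measurable_ps.comp (hx.prodMk hα)
  exact h

lemma measurable_mbarHat (hZ : ∀ j, Measurable (Z j)) (n : ℕ) (M : OutcomeModel p q)
    {β : Ω → Fin q → ℝ} (hβ : Measurable β) :
    Measurable fun ω => mbarHat n (fun j => Z j ω) M (β ω) := by
  have h1 (j) : Measurable fun ω => M.m (covar (Z j ω)) (β ω) :=
    M.measurable_m.comp ((measurable_covar.comp (hZ j)).prodMk hβ)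
  unfold mbarHat
  fun_prop

lemma measurable_mu1Hat (hZ : ∀ j, Measurable (Z j)) (v : Variant) (n : ℕ) (M : OutcomeModel p q)
    {α : Ω → Fin (p + 1) → ℝ} (hα : Measurable α) {β : Ω → Fin q → ℝ} (hβ : Measurable β) :
    Measurable fun ω => mu1Hat v n (fun j => Z j ω) M (α ω) (β ω) := by
  have h1 (j) : Measurable fun ω => M.m (covar (Z j ω)) (β ω) :=
    M.measurable_m.comp ((measurable_covar.comp (hZ j)).prodMk hβ)
  have hE (j) : Measurable fun ω => ps (covar (Z j ω)) (α ω) :=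
    measurable_ps_apply (measurable_covar.comp (hZ j)) hα
  have hT (j) : Measurable fun ω => trt (Z j ω) := measurable_trt.comp (hZ j)
  have h4 (j) : Measurable fun ω => y1 (Z j ω) := measurable_y1.comp (hZ j)
  have h5 := measurable_mbarHat hZ n M hβ
  cases v
  · simp only [mu1Hat, sum_treated]
    exact ((Finset.measurable_fun_sum _ fun j _ =>
      (hT j).mul (((h4 j).sub (h1 j)).div (hE j))).const_mul _).add h5
  · simp only [mu1Hat, sum_treated]
    exact (Finset.measurable_fun_sum _ fun j _ => (hT j).mul (((hE j).inv.div
      (Finset.measurable_fun_sum _ fun l _ => (hT l).mul (hE l).inv)).mul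
        ((h4 j).sub (h1 j)))).add h5

lemma measurable_mu0Hat (hZ : ∀ j, Measurable (Z j)) (v : Variant) (n : ℕ) (M : OutcomeModel p q)
    {α : Ω → Fin (p + 1) → ℝ} (hα : Measurable α) {β : Ω → Fin q → ℝ} (hβ : Measurable β) :
    Measurable fun ω => mu0Hat v n (fun j => Z j ω) M (α ω) (β ω) := by
  have h1 (j) : Measurable fun ω => M.m (covar (Z j ω)) (β ω) :=
    M.measurable_m.comp ((measurable_covar.comp (hZ j)).prodMk hβ)
  have hE (j) : Measurable fun ω => 1 - ps (covar (Z j ω)) (α ω) :=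
    measurable_const.sub (measurable_ps_apply (measurable_covar.comp (hZ j)) hα)
  have hT (j) : Measurable fun ω => 1 - trt (Z j ω) :=
    measurable_const.sub (measurable_trt.comp (hZ j))
  have h4 (j) : Measurable fun ω => y0 (Z j ω) := measurable_y0.comp (hZ j)
  have h5 := measurable_mbarHat hZ n M hβ
  cases v
  · simp only [mu0Hat, sum_controls]
    exact ((Finset.measurable_fun_sum _ fun j _ =>
      (hT j).mul (((h4 j).sub (h1 j)).div (hE j))).const_mul _).add h5
  · simp only [mu0Hat, sum_controls]
    exact (Finset.measurable_fun_sum _ fun j _ => (hT j).mul (((hE j).inv.div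
      (Finset.measurable_fun_sum _ fun l _ => (hT l).mul (hE l).inv)).mul
        ((h4 j).sub (h1 j)))).add h5

end Measurability

end AIPW

/-! ### Assembly of the theorem. -/

/-- Here `α`, `β₁`, `β₀` are the limits and `αh`, `βh₁`, `βh₀` the estimators. -/
theorem mainTheorem5 {p q₁ q₀ : ℕ}
    (P : Measure (AIPW.Obs p)) [IsProbabilityMeasure P]
    (M₁ : AIPW.OutcomeModel p q₁) (M₀ : AIPW.OutcomeModel p q₀)
    (α : Fin (p + 1) → ℝ) (β₁ : Fin q₁ → ℝ) (β₀ : Fin q₀ → ℝ)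
    (hreg : AIPW.Regular P M₁ M₀ α β₁ β₀)
    (hα : AIPW.IsPopScoreRoot P α)
    {Ω : Type*} [MeasurableSpace Ω] (μ : Measure Ω) [IsProbabilityMeasure μ]
    -- a random sample from the population
    (Z : ℕ → Ω → AIPW.Obs p) (hZ : ∀ j, Measurable (Z j))
    (hindep : iIndepFun Z μ) (hlaw : ∀ j, μ.map (Z j) = P)
    -- the estimators of the model parameters
    (αh : ℕ → Ω → Fin (p + 1) → ℝ) (βh₁ : ℕ → Ω → Fin q₁ → ℝ) (βh₀ : ℕ → Ω → Fin q₀ → ℝ)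
    (hαm : ∀ n, Measurable (αh n)) (hβ₁m : ∀ n, Measurable (βh₁ n))
    (hβ₀m : ∀ n, Measurable (βh₀ n))
    (hmle : Tendsto (fun n => μ {ω | ¬ AIPW.IsMLE n (fun j => Z j ω) (αh n ω)}) atTop (𝓝 0))
    (hg₁ : Tendsto (fun n => μ {ω |
      ¬ ∑ j ∈ Finset.range n, AIPW.g1 M₁ (Z j ω) (βh₁ n ω) = 0}) atTop (𝓝 0))
    (hg₀ : Tendsto (fun n => μ {ω |
      ¬ ∑ j ∈ Finset.range n, AIPW.g0 M₀ (Z j ω) (βh₀ n ω) = 0}) atTop (𝓝 0))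
    (hβ₁ : TendstoInMeasure μ βh₁ atTop (fun _ => β₁))
    (hβ₀ : TendstoInMeasure μ βh₀ atTop (fun _ => β₀))
    (v : AIPW.Variant) :
    -- the stacked estimator solves the stacked estimating equations, and the sandwich
    -- variance estimator is well defined, with probability tending to one
    Tendsto (fun n => μ {ω | ¬
      (AIPW.estEq v M₁ M₀ n (fun j => Z j ω)
          (AIPW.psiHat v M₁ M₀ n (fun j => Z j ω) (αh n ω) (βh₁ n ω) (βh₀ n ω)) = 0
        ∧ DifferentiableAt ℝ (AIPW.estEq v M₁ M₀ n (fun j => Z j ω))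
            (AIPW.psiHat v M₁ M₀ n (fun j => Z j ω) (αh n ω) (βh₁ n ω) (βh₀ n ω))
        ∧ IsUnit (AIPW.jacobian (AIPW.estEq v M₁ M₀ n (fun j => Z j ω))
            (AIPW.psiHat v M₁ M₀ n (fun j => Z j ω) (αh n ω) (βh₁ n ω) (βh₀ n ω))).det)})
      atTop (𝓝 0)
    ∧ IsUnit (AIPW.popJacobian v P M₁ M₀ (AIPW.psiStar v P M₁ M₀ α β₁ β₀)).det
    -- the asymptotic variance of the estimator of the treatment effect, and its estimation
    ∧ (∃ V : NNReal,
        (V : ℝ) = AIPW.popSandwich v P M₁ M₀ (AIPW.psiStar v P M₁ M₀ α β₁ β₀)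
          AIPW.idxTheta AIPW.idxTheta
        ∧ TendstoInDistribution
            (fun (n : ℕ) ω => √(n : ℝ) *
              (AIPW.thetaHat v n (fun j => Z j ω) M₁ M₀ (αh n ω) (βh₁ n ω) (βh₀ n ω)
                - AIPW.thetaStar v P M₁ M₀ α β₁ β₀))
            atTop (id : ℝ → ℝ) (fun _ => μ) (gaussianReal 0 V)
        ∧ TendstoInMeasure μ
            (fun (n : ℕ) ω => (n : ℝ) *
              AIPW.sandwich v M₁ M₀ n (fun j => Z j ω)
                (AIPW.psiHat v M₁ M₀ n (fun j => Z j ω) (αh n ω) (βh₁ n ω) (βh₀ n ω))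
                AIPW.idxTheta AIPW.idxTheta)
            atTop (fun _ => (V : ℝ)))
    -- the limit is the average treatment effect when one set of models is correct
    ∧ (AIPW.SITA P → AIPW.PSCorrect P ∨ AIPW.ORCorrect P M₁ M₀ β₁ β₀ →
        AIPW.thetaStar v P M₁ M₀ α β₁ β₀
          = (∫ z, AIPW.y1 z ∂P) - ∫ z, AIPW.y0 z ∂P) := by
  have hs : AIPW.IsSample P μ Z := ⟨hZ, hindep, hlaw⟩
  have hβ₁' : Tendsto (fun q : ℕ × Ω => βh₁ q.1 q.2) (AIPW.inProb μ) (𝓝 β₁) :=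
    AIPW.tendsto_inProb_iff.2 hβ₁
  have hβ₀' : Tendsto (fun q : ℕ × Ω => βh₀ q.1 q.2) (AIPW.inProb μ) (𝓝 β₀) :=
    AIPW.tendsto_inProb_iff.2 hβ₀
  have hmle' : ∀ᶠ q in AIPW.inProb μ, AIPW.IsMLE q.1 (fun j => Z j q.2) (αh q.1 q.2) := hmle
  have hg₁' : ∀ᶠ q in AIPW.inProb μ,
      ∑ j ∈ Finset.range q.1, AIPW.g1 M₁ (Z j q.2) (βh₁ q.1 q.2) = 0 := hg₁
  have hg₀' : ∀ᶠ q in AIPW.inProb μ,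
      ∑ j ∈ Finset.range q.1, AIPW.g0 M₀ (Z j q.2) (βh₀ q.1 q.2) = 0 := hg₀
  -- Besides the rate, this gives the population equation at `β₁`, which is known only as a limit of
  -- roots.
  obtain ⟨z1, r1⟩ := hreg.g1_smooth.op_sqrt_root (AIPW.measurable_g1 M₁) hreg.g1_sq hreg.nonsing_1
    hs hβ₁' hg₁'
  obtain ⟨z0, r0⟩ := hreg.g0_smooth.op_sqrt_root (AIPW.measurable_g0 M₀) hreg.g0_sq hreg.nonsing_0
    hs hβ₀' hg₀'
  have rα := AIPW.op_sqrt_mle hs hreg.covar_sq hreg.nonsing_x hα hreg.overlap hmle'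
  have h0 := AIPW.integral_estFun_psiStar hreg hα z1 z0 v
  obtain ⟨c, hc, hfrac⟩ := AIPW.eventually_smean_trt_ge
    (ψ := AIPW.psiStar v P M₁ M₀ α β₁ β₀) hreg hs
  obtain ⟨ψh, hψh⟩ : ∃ ψh : ℕ × Ω → AIPW.Param p q₁ q₀, ψh = fun q =>
    AIPW.psiHat v M₁ M₀ q.1 (fun j => Z j q.2) (αh q.1 q.2) (βh₁ q.1 q.2) (βh₀ q.1 q.2) := ⟨_, rfl⟩
  have hroot : ∀ᶠ q in AIPW.inProb μ, ∀ i,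
      AIPW.smean Z q (fun z => AIPW.estFun v M₁ M₀ z (ψh q) i) = 0 := by
    rw [hψh]
    filter_upwards [hmle', hg₁', hg₀', hfrac] with q h1 h2 h3 h4 i
    exact AIPW.smean_estFun_psiHat v (hc.trans_le h4.1) (hc.trans_le h4.2) h1 h2 h3 i
  have hop : AIPW.OP μ
      (fun q => √(q.1 : ℝ) * ‖ψh q - AIPW.psiStar v P M₁ M₀ α β₁ β₀‖) := by
    refine AIPW.op_sqrt_stacked v hreg hs h0 hroot ?_ ?_ ?_
    · rw [hψh]; exact rα
    · rw [hψh]; exact r1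
    · rw [hψh]; exact r0
  have hreg' : AIPW.Regular P M₁ M₀ (AIPW.psiStar v P M₁ M₀ α β₁ β₀).alpha
    (AIPW.psiStar v P M₁ M₀ α β₁ β₀).beta1 (AIPW.psiStar v P M₁ M₀ α β₁ β₀).beta0 := hreg
  -- The diagonal entry is the second moment of the influence function, hence a legitimate variance.
  have hV0 : 0 ≤ AIPW.popSandwich v P M₁ M₀ (AIPW.psiStar v P M₁ M₀ α β₁ β₀)
      AIPW.idxTheta AIPW.idxTheta := by
    rw [AIPW.popSandwich_eq_integral_sq v hreg']
    exact integral_nonneg fun z => sq_nonneg _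
  refine ⟨?_, AIPW.isUnit_det_popJacobian hreg' v, ⟨⟨_, hV0⟩, rfl, ?_, ?_⟩,
    AIPW.thetaStar_eq v hreg hα⟩
  · have hE : ∀ᶠ q in AIPW.inProb μ,
        AIPW.estEq v M₁ M₀ q.1 (fun j => Z j q.2) (ψh q) = 0
        ∧ DifferentiableAt ℝ (AIPW.estEq v M₁ M₀ q.1 (fun j => Z j q.2)) (ψh q)
        ∧ IsUnit (AIPW.jacobian (AIPW.estEq v M₁ M₀ q.1 (fun j => Z j q.2)) (ψh q)).det := by
      filter_upwards [hroot, AIPW.eventually_differentiableAt_estEq v hreg' hs hop,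
        AIPW.eventually_isUnit_det_jacobian v hreg' hs hop] with q h1 h2 h3
      refine ⟨?_, h2, h3⟩
      funext i
      rw [AIPW.estEq_apply, h1 i, Pi.zero_apply]
    rw [hψh] at hE
    exact hE
  · have hm (n : ℕ) : AEMeasurable (fun ω => ψh (n, ω) AIPW.idxTheta) μ := by
      rw [hψh]
      exact ((AIPW.measurable_mu1Hat hZ v n M₁ (hαm n) (hβ₁m n)).sub
        (AIPW.measurable_mu0Hat hZ v n M₀ (hαm n) (hβ₀m n))).aemeasurable
    have hd := AIPW.tendstoInDistribution_theta v hreg' hs hop h0 hroot AIPW.idxTheta hm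
      (V := ⟨_, hV0⟩) rfl
    rw [hψh] at hd
    exact hd
  · have ht := AIPW.tendsto_inProb_iff.1 (AIPW.tendsto_sandwich v hreg' hs hop)
    rw [hψh] at ht
    exact ht
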